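/- Manifolds are smooth, finite dimensional, Hausdorff and second countable. For a closed 3-form $\phi$ on $M$, a $\phi$-twisted Dirac structure on $M$ is a smooth subbundle $L\subset TM\oplus T^*M$ that is maximal isotropic for the pairing $\langle (X,\alpha),(Y,\beta)\rangle=\beta(X)+\alpha(Y)$ and whose space of sections is closed under the bracket $$[(X,\alpha),(Y,\beta)]_\phi=\bigl([X,Y],\ \mathcal L_X\beta-i_Yd\alpha+\phi(X,Y,\cdot)\bigr).$$ A bivector field $\pi$ has the graph $L_\pi=\{(\pi^\sharp\alpha,\alpha)\}$, where $\beta(\pi^\sharp\alpha)=\pi(\alpha,\beta)$; it is a Poisson structure if $\{f,g\}=\pi(df,dg)$ satisfies the Jacobi identity. For a smooth map $f:N\to M$ and fields of subspaces $L_N\subset TN\oplus T^*N$, $L_M\subset TM\oplus T^*M$, the map $f$ is forward Dirac (f-Dirac) if for every $y\in N$ $$(L_M)_{f(y)}=\{(df_y(Y),\alpha)\mid Y\in T_yN,\ \alpha\in T^*_{f(y)}M,\ (Y,df_y^*\alpha)\in (L_N)_y\},$$ and backward Dirac (b-Dirac) if $L_N=f^*L_M$, where $(f^*L_M)_y=\{(Y,df_y^*\alpha)\mid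 (df_y(Y),\alpha)\in (L_M)_{f(y)}\}$. Let $L_M$ be a $\phi$-twisted Dirac structure on $M$ and let $J:(N,L_N)\to(M,L_M)$ be a Dirac realization, that is, $L_N$ is a $J^*\phi$-twisted Dirac structure on $N$, $J$ is f-Dirac, and $\ker(dJ)\cap(L_N\cap TN)=\{0\}$. Let $x\in M$ be a regular value of $J$, let $\iota:\mathcal C=J^{-1}(x)\hookrightarrow N$ be the inclusion of the embedded submanifold $\mathcal C$, and let $\mathfrak l_x=\{\alpha\in T_x^*M\mid (0,\alpha)\in L_M\}$ be the isotropy Lie algebra at $x$. It acts infinitesimally on $\mathcal C$: the generator of $\alpha\in\mathfrak l_x$ is the vector field whose value at $c\in\mathcal C$ is the unique $Y\in T_cN$ with $dJ_c(Y)=0$ and $(Y,dJ_c^*\alpha)\in (L_N)_c$. Let $\mathcal C/\mathfrak l_x$ be the orbit space, two points being in the same orbit when they are joined by finitely many integral curves of generators. Suppose that $\mathcal C/\mathfrak l_x$ is a smooth manifold such that the projection $p:\mathcal C\to\mathcal C/\mathfrak l_x$ is a submersion. Then $\iota^*L_N$ is an (untwisted) Dirac structure on $\mathcal C$, and there is a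 unique Poisson structure $\pi_{\mathrm{red}}$ on $\mathcal C/\mathfrak l_x$ for which $p:(\mathcal C,\iota^*L_N)\to(\mathcal C/\mathfrak l_x,L_{\pi_{\mathrm{red}}})$ is an f-Dirac map. Moreover, for this $\pi_{\mathrm{red}}$ the map $p$ is also b-Dirac, and $\pi_{\mathrm{red}}$ is the unique Poisson structure with this property as well. -/

import Mathlib

open scoped Manifold ContDiff

/-! Smooth manifolds are finite dimensional, without boundary, and modelled on a normed space `E`
through the model with corners `𝓘(ℝ, E)`. -/

namespace DiracReduction

section Basic

variable (E : Type*) [NormedAddCommGroup E] [NormedSpace ℝ E]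
  {M : Type*} [TopologicalSpace M] [ChartedSpace E M]

/-- The cotangent space `T_p^* M`. -/
abbrev Cotangent (p : M) : Type _ := TangentSpace 𝓘(ℝ, E) p →L[ℝ] ℝ

/-- The fibre at `p` of `TM ⊕ T^*M`. -/
abbrev GenTangent (p : M) : Type _ := TangentSpace 𝓘(ℝ, E) p × Cotangent E p

/-- A (not necessarily continuous) vector field. -/
abbrev VField (M : Type*) [TopologicalSpace M] [ChartedSpace E M] : Type _ :=
  ∀ p : M, TangentSpace 𝓘(ℝ, E) p

/-- A (not necessarily continuous) section of `TM ⊕ T^*M`. -/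
abbrev GenSection (M : Type*) [TopologicalSpace M] [ChartedSpace E M] : Type _ :=
  ∀ p : M, GenTangent E p

/-- An alternating covariant 3-tensor field, i.e. a (not necessarily continuous) 3-form. -/
abbrev ThreeForm (M : Type*) [TopologicalSpace M] [ChartedSpace E M] : Type _ :=
  ∀ p : M, (TangentSpace 𝓘(ℝ, E) p) [⋀^Fin 3]→ₗ[ℝ] ℝ

/-- A field of subspaces of `TM ⊕ T^*M`. -/
abbrev GenSubspace (M : Type*) [TopologicalSpace M] [ChartedSpace E M] : Type _ :=
  ∀ p : M, Submodule ℝ (GenTangent E p)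

/-- Smooth vector fields. -/
def SmoothVF [IsManifold 𝓘(ℝ, E) ∞ M] (X : VField E M) : Prop :=
  ContMDiff 𝓘(ℝ, E) (𝓘(ℝ, E)).tangent ∞ (fun p => (⟨p, X p⟩ : TangentBundle 𝓘(ℝ, E) M))

/-- Smooth 1-forms, as smooth sections of the bundle of continuous linear maps from the tangent
bundle to the trivial line bundle. -/
def SmoothOneForm [IsManifold 𝓘(ℝ, E) ∞ M] (α : ∀ p : M, Cotangent E p) : Prop :=
  ContMDiff 𝓘(ℝ, E) (𝓘(ℝ, E).prod 𝓘(ℝ, E →L[ℝ] ℝ)) ∞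
    (fun p => Bundle.TotalSpace.mk' (E →L[ℝ] ℝ)
      (E := fun q : M => TangentSpace 𝓘(ℝ, E) q →L[ℝ] Bundle.Trivial M ℝ q) p (α p))

/-- Smooth sections of `TM ⊕ T^*M`. -/
def SmoothSection [IsManifold 𝓘(ℝ, E) ∞ M] (e : GenSection E M) : Prop :=
  SmoothVF E (fun p => (e p).1) ∧ SmoothOneForm E (fun p => (e p).2)

/-- A 3-form is smooth if its values on smooth vector fields are smooth functions. -/
def SmoothThreeForm [IsManifold 𝓘(ℝ, E) ∞ M] (φ : ThreeForm E M) : Prop :=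
  ∀ X Y Z : VField E M, SmoothVF E X → SmoothVF E Y → SmoothVF E Z →
    ContMDiff 𝓘(ℝ, E) 𝓘(ℝ) ∞ (fun p => φ p ![X p, Y p, Z p])

/-- The derivative `X(f)` of a function along a vector field. -/
noncomputable def dirDeriv (X : VField E M) (f : M → ℝ) (p : M) : ℝ :=
  mvfderiv 𝓘(ℝ, E) f p (X p)

/-- The Lie bracket of vector fields. -/
noncomputable abbrev lieBr (X Y : VField E M) : VField E M :=
  VectorField.mlieBracket 𝓘(ℝ, E) X Y

/-- `(dφ)(W, X, Y, Z)` for a 3-form `φ`. -/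
noncomputable def extDerivThree (φ : ThreeForm E M) (W X Y Z : VField E M) (p : M) : ℝ :=
  dirDeriv E W (fun q => φ q ![X q, Y q, Z q]) p
    - dirDeriv E X (fun q => φ q ![W q, Y q, Z q]) p
    + dirDeriv E Y (fun q => φ q ![W q, X q, Z q]) p
    - dirDeriv E Z (fun q => φ q ![W q, X q, Y q]) p
    - φ p ![lieBr E W X p, Y p, Z p]
    + φ p ![lieBr E W Y p, X p, Z p]
    - φ p ![lieBr E W Z p, X p, Y p]
    - φ p ![lieBr E X Y p, W p, Z p]
    + φ p ![lieBr E X Z p, W p, Y p]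
    - φ p ![lieBr E Y Z p, W p, X p]

/-- Smooth closed 3-forms. -/
def ClosedThreeForm [IsManifold 𝓘(ℝ, E) ∞ M] (φ : ThreeForm E M) : Prop :=
  SmoothThreeForm E φ ∧
    ∀ W X Y Z : VField E M, SmoothVF E W → SmoothVF E X → SmoothVF E Y → SmoothVF E Z →
      ∀ p, extDerivThree E φ W X Y Z p = 0

/-- `(𝓛_X β)(Z)`. -/
noncomputable def lieDerivOneForm (X : VField E M) (β : ∀ p : M, Cotangent E p)
    (Z : VField E M) (p : M) : ℝ :=
  dirDeriv E X (fun q => β q (Z q)) p - β p (lieBr E X Z p)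

/-- `(dα)(Y, Z)` for a 1-form `α`. -/
noncomputable def extDerivOne (α : ∀ p : M, Cotangent E p) (Y Z : VField E M) (p : M) : ℝ :=
  dirDeriv E Y (fun q => α q (Z q)) p - dirDeriv E Z (fun q => α q (Y q)) p
    - α p (lieBr E Y Z p)

/-- `e₃` is the `φ`-twisted Courant bracket of `e₁ = (X, α)` and `e₂ = (Y, β)`, that is
`e₃ = ([X, Y], 𝓛_X β - i_Y dα + φ(X, Y, ·))`; the 1-form is tested on all smooth vector fields. -/
def IsCourantBracket [IsManifold 𝓘(ℝ, E) ∞ M] (φ : ThreeForm E M)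
    (e₁ e₂ e₃ : GenSection E M) : Prop :=
  (∀ p, (e₃ p).1 = lieBr E (fun q => (e₁ q).1) (fun q => (e₂ q).1) p) ∧
    ∀ Z : VField E M, SmoothVF E Z → ∀ p,
      (e₃ p).2 (Z p) =
        lieDerivOneForm E (fun q => (e₁ q).1) (fun q => (e₂ q).2) Z p
          - extDerivOne E (fun q => (e₁ q).2) (fun q => (e₂ q).1) Z p
          + φ p ![(e₁ p).1, (e₂ p).1, Z p]

/-- `e` is a smooth section of `L`, i.e. `e ∈ Γ(L)`. -/
def IsSectionOf [IsManifold 𝓘(ℝ, E) ∞ M] (L : GenSubspace E M) (e : GenSection E M) : Prop :=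
  SmoothSection E e ∧ ∀ p, e p ∈ L p

/-- `L` is a `φ`-twisted Dirac structure: a smooth subbundle of `TM ⊕ T^*M` which is maximal
isotropic and whose sections are closed under the `φ`-twisted Courant bracket.
Maximal isotropy is isotropy together with `rank L = dim M`; as the rank is constant,
`L` is a smooth subbundle as soon as each of its vectors is the value of a smooth section. -/
structure IsDirac [IsManifold 𝓘(ℝ, E) ∞ M] (φ : ThreeForm E M) (L : GenSubspace E M) :
    Prop where
  isotropic : ∀ p, ∀ e ∈ L p, ∀ e' ∈ L p, e'.2 e.1 + e.2 e'.1 = 0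
  rank : ∀ p, Module.finrank ℝ (L p) = Module.finrank ℝ E
  smooth : ∀ p, ∀ v ∈ L p, ∃ e : GenSection E M, IsSectionOf E L e ∧ e p = v
  involutive : ∀ e₁ e₂ : GenSection E M, IsSectionOf E L e₁ → IsSectionOf E L e₂ →
    ∃ e₃ : GenSection E M, IsSectionOf E L e₃ ∧ IsCourantBracket E φ e₁ e₂ e₃

/-- A field of bilinear forms on the cotangent spaces. -/
abbrev BiTensor (M : Type*) [TopologicalSpace M] [ChartedSpace E M] : Type _ :=
  ∀ p : M, Cotangent E p →ₗ[ℝ] Cotangent E p →ₗ[ℝ] ℝ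

/-- The bracket `{f, g} = π(df, dg)`. -/
noncomputable def poissonBr (π : BiTensor E M) (f g : M → ℝ) (p : M) : ℝ :=
  π p (mvfderiv 𝓘(ℝ, E) f p) (mvfderiv 𝓘(ℝ, E) g p)

/-- `π` is a Poisson structure: a smooth bivector field whose bracket on `C^∞(M)` satisfies the
Jacobi identity. -/
structure IsPoisson (π : BiTensor E M) : Prop where
  skew : ∀ p, ∀ α : Cotangent E p, π p α α = 0
  smooth : ∀ f g : M → ℝ, ContMDiff 𝓘(ℝ, E) 𝓘(ℝ) ∞ f → ContMDiff 𝓘(ℝ, E) 𝓘(ℝ) ∞ g →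
    ContMDiff 𝓘(ℝ, E) 𝓘(ℝ) ∞ (poissonBr E π f g)
  jacobi : ∀ f g h : M → ℝ, ContMDiff 𝓘(ℝ, E) 𝓘(ℝ) ∞ f → ContMDiff 𝓘(ℝ, E) 𝓘(ℝ) ∞ g →
    ContMDiff 𝓘(ℝ, E) 𝓘(ℝ) ∞ h → ∀ p,
    poissonBr E π f (poissonBr E π g h) p + poissonBr E π g (poissonBr E π h f) p
      + poissonBr E π h (poissonBr E π f g) p = 0

/-- The graph `L_π = {(π^♯ α, α)}` of a bivector field, where `β(π^♯ α) = π(α, β)`. -/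
def graphOf (π : BiTensor E M) : GenSubspace E M := fun p =>
  { carrier := {e | ∀ β : Cotangent E p, β e.1 = π p e.2 β}
    add_mem' := by
      intro a b ha hb β
      simp [ha β, hb β]
    zero_mem' := by
      intro β
      simp
    smul_mem' := by
      intro c a ha β
      simp [ha β] }

end Basic

section Maps

variable {EN : Type*} [NormedAddCommGroup EN] [NormedSpace ℝ EN]
  {N : Type*} [TopologicalSpace N] [ChartedSpace EN N]
  {EM : Type*} [NormedAddCommGroup EM] [NormedSpace ℝ EM]
  {M : Type*} [TopologicalSpace M] [ChartedSpace EM M]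

/-- The differential of `f` at `y`. -/
noncomputable abbrev diff (EN EM : Type*) [NormedAddCommGroup EN] [NormedSpace ℝ EN]
    [NormedAddCommGroup EM] [NormedSpace ℝ EM] {N : Type*} [TopologicalSpace N]
    [ChartedSpace EN N] {M : Type*} [TopologicalSpace M] [ChartedSpace EM M]
    (f : N → M) (y : N) : TangentSpace 𝓘(ℝ, EN) y →L[ℝ] TangentSpace 𝓘(ℝ, EM) (f y) :=
  mfderiv 𝓘(ℝ, EN) 𝓘(ℝ, EM) f y

/-- The pull-back `f^* φ` of a 3-form. -/
noncomputable def pullThree (f : N → M) (φ : ThreeForm EM M) : ThreeForm EN N := fun y =>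
  (φ (f y)).compLinearMap (diff EN EM f y).toLinearMap

/-- The pull-back `f^* L = {(Y, df^* α) | (df Y, α) ∈ L}`. -/
noncomputable def pullDirac (f : N → M) (L : GenSubspace EM M) : GenSubspace EN N := fun y =>
  { carrier := {e | ∃ α : Cotangent EM (f y),
      e.2 = α.comp (diff EN EM f y) ∧ (diff EN EM f y e.1, α) ∈ L (f y)}
    add_mem' := by
      rintro a b ⟨α, hα, ha⟩ ⟨β, hβ, hb⟩
      refine ⟨α + β, ?_, ?_⟩
      · ext v
        simp [hα, hβ]
      · simpa using (L (f y)).add_mem ha hb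
    zero_mem' := by
      refine ⟨0, ?_, ?_⟩
      · ext v
        simp
      · have h : (diff EN EM f y (0 : GenTangent EN y).1, (0 : Cotangent EM (f y))) = 0 := by
          simp
        rw [h]
        exact (L (f y)).zero_mem
    smul_mem' := by
      rintro c a ⟨α, hα, ha⟩
      refine ⟨c • α, ?_, ?_⟩
      · ext v
        simp [hα]
      · simpa using (L (f y)).smul_mem c ha }

/-- `f : (N, L_N) → (M, L_M)` is forward Dirac: at each point of `N`,
`L_M = {(df Y, α) | (Y, df^* α) ∈ L_N}`. -/
def IsForwardDirac (f : N → M) (LN : GenSubspace EN N) (LM : GenSubspace EM M) : Prop :=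
  ContMDiff 𝓘(ℝ, EN) 𝓘(ℝ, EM) ∞ f ∧
    ∀ y : N, ∀ (X : TangentSpace 𝓘(ℝ, EM) (f y)) (α : Cotangent EM (f y)),
      (X, α) ∈ LM (f y) ↔
        ∃ Y : TangentSpace 𝓘(ℝ, EN) y,
          diff EN EM f y Y = X ∧ (Y, α.comp (diff EN EM f y)) ∈ LN y

/-- `f : (N, L_N) → (M, L_M)` is backward Dirac: `L_N = f^* L_M`. -/
def IsBackwardDirac (f : N → M) (LN : GenSubspace EN N) (LM : GenSubspace EM M) : Prop :=
  ContMDiff 𝓘(ℝ, EN) 𝓘(ℝ, EM) ∞ f ∧ ∀ y : N, LN y = pullDirac f LM y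

/-- `J : (N, L_N) → (M, L_M)` is a Dirac realization of the `φ`-twisted Dirac manifold
`(M, L_M)`. -/
structure IsDiracRealization [IsManifold 𝓘(ℝ, EN) ∞ N] [IsManifold 𝓘(ℝ, EM) ∞ M]
    (φ : ThreeForm EM M) (J : N → M) (LN : GenSubspace EN N) (LM : GenSubspace EM M) :
    Prop where
  closed : ClosedThreeForm EM φ
  target : IsDirac EM φ LM
  source : IsDirac EN (pullThree J φ) LN
  forward : IsForwardDirac J LN LM
  nondegenerate : ∀ (y : N) (Y : TangentSpace 𝓘(ℝ, EN) y),
    diff EN EM J y Y = 0 → (Y, (0 : Cotangent EN y)) ∈ LN y → Y = 0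

/-- `x` is a regular value of `J`. -/
def IsRegularValue (EN EM : Type*) [NormedAddCommGroup EN] [NormedSpace ℝ EN]
    [NormedAddCommGroup EM] [NormedSpace ℝ EM] {N : Type*} [TopologicalSpace N]
    [ChartedSpace EN N] {M : Type*} [TopologicalSpace M] [ChartedSpace EM M]
    (J : N → M) (x : M) : Prop :=
  ∀ y : N, J y = x → Function.Surjective (diff EN EM J y)

/-- The isotropy Lie algebra `𝔩_x = ker(pr₁|_L)_x`, viewed inside `T_x^* M`. -/
noncomputable def isotropy (L : GenSubspace EM M) (x : M) : Submodule ℝ (Cotangent EM x) :=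
  (L x).comap (LinearMap.inr ℝ (TangentSpace 𝓘(ℝ, EM) x) (Cotangent EM x))

end Maps

section Quotient

variable {EN : Type*} [NormedAddCommGroup EN] [NormedSpace ℝ EN]
  {N : Type*} [TopologicalSpace N] [ChartedSpace EN N]
  {EM : Type*} [NormedAddCommGroup EM] [NormedSpace ℝ EM]
  {M : Type*} [TopologicalSpace M] [ChartedSpace EM M]
  (EC : Type*) [NormedAddCommGroup EC] [NormedSpace ℝ EC]

/-- The inclusion `ι : J⁻¹(x) → N`. -/
abbrev incl (J : N → M) (x : M) : (J ⁻¹' {x}) → N := Subtype.val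

/-- The element `α` of the cotangent space at `x`, at a point `c` of `J⁻¹(x)`: the equality
`J c = x` turns it into an element of the cotangent space at `J c`. -/
def covectorAt {J : N → M} {x : M} (α : Cotangent EM x) (c : J ⁻¹' {x}) :
    Cotangent EM (J (incl J x c)) :=
  Eq.recOn (motive := fun z _ => Cotangent EM z) (Eq.symm (show J (incl J x c) = x from c.2)) α

/-- `V` is the infinitesimal generator on `C = J⁻¹(x)` of `α ∈ 𝔩_x`: its value at `c` is the
vector `Y` with `dJ(Y) = 0` and `(Y, dJ^* α) ∈ L_N`. -/
def IsGenerator (J : N → M) (LN : GenSubspace EN N) {x : M} [ChartedSpace EC (J ⁻¹' {x})]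
    (α : Cotangent EM x) (V : VField EC (J ⁻¹' {x})) : Prop :=
  ∀ c : J ⁻¹' {x},
    diff EN EM J (incl J x c) (diff EC EN (incl J x) c (V c)) = 0 ∧
      (diff EC EN (incl J x) c (V c),
        (covectorAt α c).comp (diff EN EM J (incl J x c))) ∈ LN (incl J x c)

/-- `c'` is reached from `c` along an integral curve of the generator of an element of `𝔩_x`. -/
def OrbitStep (J : N → M) (LN : GenSubspace EN N) (LM : GenSubspace EM M) (x : M)
    [ChartedSpace EC (J ⁻¹' {x})] (c c' : J ⁻¹' {x}) : Prop :=
  ∃ α ∈ isotropy LM x, ∃ V : VField EC (J ⁻¹' {x}), IsGenerator EC J LN α V ∧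
    ∃ γ : ℝ → (J ⁻¹' {x}), IsMIntegralCurveOn (I := 𝓘(ℝ, EC)) γ V (Set.Icc 0 1) ∧
      γ 0 = c ∧ γ 1 = c'

/-- The partition of `C = J⁻¹(x)` into orbits of the infinitesimal action of `𝔩_x`: two points lie
in the same orbit if they are joined by finitely many integral curves of generators. -/
def orbitSetoid (J : N → M) (LN : GenSubspace EN N) (LM : GenSubspace EM M) (x : M)
    [ChartedSpace EC (J ⁻¹' {x})] : Setoid (J ⁻¹' {x}) :=
  Relation.EqvGen.setoid (OrbitStep EC J LN LM x)

/-- The orbit space `C / 𝔩_x`, with the quotient topology. -/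
abbrev OrbitSpace (J : N → M) (LN : GenSubspace EN N) (LM : GenSubspace EM M) (x : M)
    [ChartedSpace EC (J ⁻¹' {x})] : Type _ :=
  Quotient (orbitSetoid EC J LN LM x)

/-- The projection `C → C / 𝔩_x`. -/
abbrev orbitProj (J : N → M) (LN : GenSubspace EN N) (LM : GenSubspace EM M) (x : M)
    [ChartedSpace EC (J ⁻¹' {x})] : (J ⁻¹' {x}) → OrbitSpace EC J LN LM x :=
  Quotient.mk (orbitSetoid EC J LN LM x)

end Quotient

end DiracReduction

/-! Write `L = ι^*L_N`. At each point `L` is Lagrangian by linear algebra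
(`IsLagrangian.of_pullback`), so the real question is whether it is smooth. It is smooth as soon as
the part of `L_N` conormal to `C`, that is the set of `ξ` with `(0, dJ^* ξ) ∈ L_N`, has constant
dimension. Since `J` is forward Dirac and nondegenerate, every element of `𝔩_x` has exactly one
generating vector at each `c`, and the conormal part consists of the elements whose vector at `c` is
zero. Rank-nullity (`finrank_conormal_add_finrank_span`) turns the question into the constancy of
the rank of the span of the generators.

That span is `ker dp` (`span_eq_ker_of_orbits`). The generators are tangent to the fibres of `p`,
because `p` is constant along their integral curves. They are in involution (`lieBr_generators`),
and a linear differential equation shows that their rank is constant along integral curves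
(`finrank_span_eq_of_integralCurve`), hence on each fibre, which is a single orbit. If this rank
were smaller than the dimension of the fibre, Frobenius would cut the fibre into leaves of positive
codimension. By second countability an orbit meets a foliated box in countably many plaques
(`exists_countable_plaque_saturation`), whereas the fibre fills the box, which has uncountably many
(`exists_foliatedBox`).

With constant rank, sections of `L` extend locally to sections of `L_N`, and closure under the
bracket is inherited from `L_N`. The twist disappears because `dJ` kills vectors tangent to `C`.
Moreover `L ∩ TC = ker dp`.

The rest is reduction along the kernel. For a covector `α` on the quotient, `p^*α` vanishes on `L ∩
TC`, so some `(Y, p^*α)` lies in `L`, and `dp(Y)` depends on `α` only; set `π(α, β) = β(dp Y)`. For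
functions `f`, `g` on the quotient, the Courant bracket of the sections lifting `df` and `dg` has
1-form part `d{f, g}`. Isotropy against `(W, 0)` with `W ∈ ker dp` shows that `{f, g}` is constant
on fibres, so `π` descends (`IsReducible.exists_bracket`). The vector part of the same bracket is
`[X_f, X_g]`, which gives the Jacobi identity (`IsReducible.isPoisson`). Uniqueness holds pointwise:
a forward or backward Dirac projection forces the graph of the bivector to contain every `(dp Y,
α)`. -/

open scoped Manifold ContDiff

namespace DiracReduction

/-! ### Lagrangian subspaces of `V ⊕ V^*`. -/

section Lagrangian

variable {V : Type*} [AddCommGroup V] [Module ℝ V] [TopologicalSpace V] [IsTopologicalAddGroup V]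
  [ContinuousSMul ℝ V] [T2Space V] [FiniteDimensional ℝ V]
  {W : Type*} [AddCommGroup W] [Module ℝ W] [TopologicalSpace W] [IsTopologicalAddGroup W]
  [ContinuousSMul ℝ W] [T2Space W] [FiniteDimensional ℝ W]

instance finiteDimensional_dual : FiniteDimensional ℝ (V →L[ℝ] ℝ) :=
  LinearEquiv.finiteDimensional (LinearMap.toContinuousLinearMap (E := V) (F' := ℝ))

lemma finrank_dual : Module.finrank ℝ (V →L[ℝ] ℝ) = Module.finrank ℝ V := by
  rw [← (LinearMap.toContinuousLinearMap (𝕜 := ℝ) (E := V) (F' := ℝ)).finrank_eq]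
  exact Subspace.dual_finrank_eq

/-- The symmetric pairing on `V ⊕ V^*`. -/
noncomputable def pairing (V : Type*) [AddCommGroup V] [Module ℝ V] [TopologicalSpace V]
    [IsTopologicalAddGroup V] [ContinuousSMul ℝ V] :
    LinearMap.BilinForm ℝ (V × (V →L[ℝ] ℝ)) :=
  LinearMap.mk₂ ℝ (fun e e' => e'.2 e.1 + e.2 e'.1)
    (by intro a b c; simp; ring) (by intro c a b; simp; ring)
    (by intro a b c; simp; ring) (by intro c a b; simp; ring)

omit [T2Space V] [FiniteDimensional ℝ V] in
lemma pairing_apply (e e' : V × (V →L[ℝ] ℝ)) : pairing V e e' = e'.2 e.1 + e.2 e'.1 := rfl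

lemma exists_dual_vanishing {S : Submodule ℝ V} {v : V} (hv : v ∉ S) :
    ∃ f : V →L[ℝ] ℝ, f v ≠ 0 ∧ ∀ s ∈ S, f s = 0 := by
  obtain ⟨f, hf, hS⟩ := Submodule.exists_le_ker_of_notMem hv
  exact ⟨LinearMap.toContinuousLinearMap f, hf, fun s hs => hS hs⟩

/-- Reflexivity: evaluation is injective because functionals separate points, and the dimensions
agree. -/
lemma exists_eval_eq (f : (V →L[ℝ] ℝ) →ₗ[ℝ] ℝ) : ∃ v : V, ∀ β : V →L[ℝ] ℝ, f β = β v := by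
  let φ : V →ₗ[ℝ] ((V →L[ℝ] ℝ) →ₗ[ℝ] ℝ) :=
    LinearMap.mk₂ ℝ (fun v β => β v) (by intros; simp) (by intros; simp) (by intros; simp)
      (by intros; simp)
  have hinj : Function.Injective φ := by
    rw [injective_iff_map_eq_zero]
    intro v hv
    by_contra h
    obtain ⟨g, hg, -⟩ := exists_dual_vanishing (S := (⊥ : Submodule ℝ V)) (v := v) (by simpa using h)
    exact hg (LinearMap.congr_fun hv g)
  have hsurj : Function.Surjective φ := by
    refine (LinearMap.injective_iff_surjective_of_finrank_eq_finrank ?_).1 hinj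
    rw [show Module.finrank ℝ ((V →L[ℝ] ℝ) →ₗ[ℝ] ℝ) = Module.finrank ℝ (V →L[ℝ] ℝ) from
      Subspace.dual_finrank_eq, finrank_dual]
  obtain ⟨v, hv⟩ := hsurj f
  exact ⟨v, fun β => by rw [← hv]; rfl⟩

/-- The pairing identifies `V ⊕ V^*` with its own dual, so a functional that separates `e` from `S`
is the pairing with some vector. -/
lemma exists_pairing_separating {S : Submodule ℝ (V × (V →L[ℝ] ℝ))} {e : V × (V →L[ℝ] ℝ)}
    (he : e ∉ S) : ∃ e', pairing V e e' ≠ 0 ∧ ∀ s ∈ S, pairing V s e' = 0 := by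
  obtain ⟨f, hf, hS⟩ := Submodule.exists_le_ker_of_notMem he
  obtain ⟨Z, hZ⟩ := exists_eval_eq (f ∘ₗ LinearMap.inr ℝ V (V →L[ℝ] ℝ))
  have key : ∀ s, pairing V s (Z, LinearMap.toContinuousLinearMap
      (f ∘ₗ LinearMap.inl ℝ V (V →L[ℝ] ℝ))) = f s := by
    intro s
    have h2 := hZ s.2
    simp only [LinearMap.comp_apply, LinearMap.inr_apply] at h2
    simp only [pairing_apply, LinearMap.coe_toContinuousLinearMap', LinearMap.comp_apply,
      LinearMap.inl_apply, ← h2]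
    rw [← map_add]
    simp
  exact ⟨_, by rw [key]; exact hf, fun s hs => by rw [key]; exact hS hs⟩

lemma pairing_nondegenerate : (pairing V).Nondegenerate := by
  have hsymm : ∀ a b, pairing V a b = pairing V b a := by
    intro a b
    simp only [pairing_apply]
    ring
  have h : ∀ e, (∀ e', pairing V e e' = 0) → e = 0 := by
    intro e he
    by_contra hne
    obtain ⟨e', h1, -⟩ := exists_pairing_separating
      (S := (⊥ : Submodule ℝ (V × (V →L[ℝ] ℝ)))) (e := e) (by simpa using hne)
    exact h1 (he e')
  exact ⟨h, fun e he => h e fun e' => by rw [hsymm]; exact he e'⟩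

lemma finrank_pairing_orthogonal (L : Submodule ℝ (V × (V →L[ℝ] ℝ))) :
    Module.finrank ℝ ((pairing V).orthogonal L) + Module.finrank ℝ L
      = 2 * Module.finrank ℝ V := by
  have h := LinearMap.BilinForm.finrank_orthogonal (pairing_nondegenerate (V := V)) L
  have h2 : Module.finrank ℝ (V × (V →L[ℝ] ℝ)) = 2 * Module.finrank ℝ V := by
    rw [Module.finrank_prod, finrank_dual]
    ring
  have h3 := Submodule.finrank_le L
  omega

/-- A Lagrangian subspace of `V ⊕ V^*`: isotropic of dimension `dim V`. -/
structure IsLagrangian (L : Submodule ℝ (V × (V →L[ℝ] ℝ))) : Prop where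
  isotropic : ∀ e ∈ L, ∀ e' ∈ L, e'.2 e.1 + e.2 e'.1 = 0
  rank : Module.finrank ℝ L = Module.finrank ℝ V

namespace IsLagrangian

variable {L : Submodule ℝ (V × (V →L[ℝ] ℝ))}

/-- Isotropy gives `L ≤ L^⊥`, and both sides have dimension `dim V`. -/
lemma mem_of_forall (hL : IsLagrangian L) {e : V × (V →L[ℝ] ℝ)}
    (he : ∀ l ∈ L, e.2 l.1 + l.2 e.1 = 0) : e ∈ L := by
  have hle : L ≤ (pairing V).orthogonal L := fun l hl => by
    rw [LinearMap.BilinForm.mem_orthogonal_iff]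
    exact fun l' hl' => hL.isotropic l' hl' l hl
  have heq : L = (pairing V).orthogonal L := by
    refine Submodule.eq_of_le_of_finrank_eq hle ?_
    have := finrank_pairing_orthogonal L
    have := hL.rank
    omega
  rw [heq, LinearMap.BilinForm.mem_orthogonal_iff]
  exact fun l hl => he l hl

lemma of_mem_iff (h : ∀ e, e ∈ L ↔ ∀ l ∈ L, e.2 l.1 + l.2 e.1 = 0) : IsLagrangian L := by
  have heq : L = (pairing V).orthogonal L := by
    ext e
    rw [LinearMap.BilinForm.mem_orthogonal_iff]
    exact h e
  refine ⟨fun e he e' he' => (h e').1 he' e he, ?_⟩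
  have := finrank_pairing_orthogonal L
  rw [← heq] at this
  omega

/-- The projection of `L` to `V^*` is the annihilator of `L ∩ V`. A vector `Z` that annihilates the
projection makes `(Z, 0)` orthogonal to `L`, hence an element of `L`. -/
lemma exists_fst (hL : IsLagrangian L) {ξ : V →L[ℝ] ℝ}
    (h : ∀ Y, (Y, (0 : V →L[ℝ] ℝ)) ∈ L → ξ Y = 0) : ∃ Y, (Y, ξ) ∈ L := by
  by_contra hne
  have hξ : ξ ∉ L.map (LinearMap.snd ℝ V (V →L[ℝ] ℝ)) := by
    rintro ⟨⟨Y, η⟩, hY, rfl⟩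
    exact hne ⟨Y, hY⟩
  obtain ⟨f, hf, hS⟩ := Submodule.exists_le_ker_of_notMem hξ
  obtain ⟨Z, hZ⟩ := exists_eval_eq f
  rw [hZ] at hf
  refine hf (h Z (hL.mem_of_forall fun l hl => ?_))
  have : f l.2 = 0 := hS ⟨l, hl, rfl⟩
  simpa [← hZ] using this

/-- The pull-back of a Lagrangian subspace under an injective linear map is Lagrangian. -/
lemma of_pullback (hL : IsLagrangian L) {j : W →L[ℝ] V} (hj : Function.Injective j)
    {L' : Submodule ℝ (W × (W →L[ℝ] ℝ))}
    (hL' : ∀ e, e ∈ L' ↔ ∃ α : V →L[ℝ] ℝ, e.2 = α.comp j ∧ (j e.1, α) ∈ L) :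
    IsLagrangian L' := by
  refine of_mem_iff fun e => ⟨fun he l hl => ?_, fun he => ?_⟩
  · obtain ⟨α, hα, h1⟩ := (hL' e).1 he
    obtain ⟨β, hβ, h2⟩ := (hL' l).1 hl
    simpa [hα, hβ] using hL.isotropic _ h2 _ h1
  · obtain ⟨q, hq⟩ := LinearMap.exists_leftInverse_of_injective (j : W →ₗ[ℝ] V)
      (LinearMap.ker_eq_bot.2 hj)
    have hq' : ∀ w, q (j w) = w := fun w => LinearMap.congr_fun hq w
    let η : V →L[ℝ] ℝ := e.2.comp (LinearMap.toContinuousLinearMap q)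
    have hη : ∀ w, η (j w) = e.2 w := fun w => by simp [η, hq']
    -- `A = {0} ⊕ Ann(im j)`; adding it to `L` forgets the values of covectors off the image of `j`.
    -- Since `A^⊥ = im j ⊕ V^*`, an element orthogonal to `L ⊔ A` lies in `L` and has its vector
    -- part in `im j`, so that `he` applies to it.
    let A : Submodule ℝ (V × (V →L[ℝ] ℝ)) :=
      { carrier := {s | s.1 = 0 ∧ ∀ w, s.2 (j w) = 0}
        add_mem' := by
          rintro a b ⟨h1, h2⟩ ⟨h3, h4⟩
          exact ⟨by simp [h1, h3], fun w => by simp [h2, h4]⟩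
        zero_mem' := by simp
        smul_mem' := by
          rintro c a ⟨h1, h2⟩
          exact ⟨by simp [h1], fun w => by simp [h2]⟩ }
    have hmem : (j e.1, η) ∈ L ⊔ A := by
      by_contra hne
      obtain ⟨⟨Z, γ⟩, hne, hS⟩ := exists_pairing_separating hne
      have hZL : (Z, γ) ∈ L := hL.mem_of_forall fun l hl =>
        hS l (Submodule.mem_sup_left hl)
      have hZ : Z ∈ LinearMap.range (j : W →ₗ[ℝ] V) := by
        by_contra hZ
        obtain ⟨κ, hκ, hκ0⟩ := exists_dual_vanishing hZ
        have := hS (0, κ) (Submodule.mem_sup_right ⟨rfl, fun w => hκ0 _ ⟨w, rfl⟩⟩)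
        simp [pairing_apply] at this
        exact hκ this
      obtain ⟨Z', rfl⟩ := hZ
      refine hne ?_
      have := he (Z', γ.comp j) ((hL' _).2 ⟨γ, rfl, hZL⟩)
      simp only [pairing_apply]
      simp only [ContinuousLinearMap.comp_apply, ContinuousLinearMap.coe_coe] at this ⊢
      rw [hη]
      linarith
    obtain ⟨l, hl, a, ha, hla⟩ := Submodule.mem_sup.1 hmem
    refine (hL' e).2 ⟨l.2, ?_, ?_⟩
    · ext w
      have := congrArg (fun s => s.2 (j w)) hla
      simp only [Prod.snd_add, _root_.add_apply, ha.2 w, hη] at this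
      simp [← this]
    · have := congrArg Prod.fst hla
      simp only [Prod.fst_add, ha.1, add_zero] at this
      rw [← this]
      exact hl

end IsLagrangian

end Lagrangian

/-! ### Orbits meet countably many plaques. -/

section Topology

/-- If the sets `O y` are "foliated boxes" with plaques the fibres of `τ y`, and the plaques of two
boxes agree locally, then every point lies in a set which is a union of countably many plaques and
is invariant under curves that locally stay in plaques. -/
theorem exists_countable_plaque_saturation {X T : Type*} [TopologicalSpace X]
    [SecondCountableTopology X] (O : X → Set X) (hO : ∀ y, O y ∈ nhds y)
    (hOo : ∀ y, IsOpen (O y)) (τ : X → X → T)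
    (hτ : ∀ i j z, z ∈ O i → z ∈ O j → ∃ N ∈ nhds z, ∀ a ∈ N, ∀ b ∈ N, τ i a = τ i b → τ j a = τ j b)
    (y : X) :
    ∃ S : Set X, y ∈ S ∧ (∀ i, (τ i '' (S ∩ O i)).Countable) ∧
      ∀ γ : ℝ → X, ContinuousOn γ (Set.Icc 0 1) →
        (∀ t₀ ∈ Set.Icc (0 : ℝ) 1, ∀ i, γ t₀ ∈ O i →
          ∀ᶠ t in nhdsWithin t₀ (Set.Icc 0 1), τ i (γ t) = τ i (γ t₀)) →
        (γ 0 ∈ S ↔ γ 1 ∈ S) := by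
  obtain ⟨s, hs, hcov⟩ := TopologicalSpace.countable_cover_nhds hO
  have hcov' : ∀ z, ∃ i ∈ s, z ∈ O i := fun z => by
    have : z ∈ ⋃ x ∈ s, O x := by rw [hcov]; trivial
    simpa using this
  -- One plaque of `O i` meets only countably many plaques of `O j`: by the Lindelöf property the
  -- overlap is covered by countably many sets `N x`, and within each of them a plaque of `O i` lies
  -- in a single plaque of `O j`.
  have hadj : ∀ i j t, (τ j '' {z | z ∈ O i ∧ z ∈ O j ∧ τ i z = t}).Countable := by
    intro i j t
    choose! N hN hNτ using hτ i j
    obtain ⟨c, hcs, hc, hcover⟩ := TopologicalSpace.countable_cover_nhdsWithin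
      (f := N) (s := O i ∩ O j) fun x hx => mem_nhdsWithin_of_mem_nhds (hN x hx.1 hx.2)
    refine (hc.biUnion (t := fun x _ => τ j '' {z | z ∈ N x ∧ τ i z = t}) fun x hx =>
      Set.Subsingleton.countable ?_).mono ?_
    · rintro _ ⟨a, ⟨ha, hat⟩, rfl⟩ _ ⟨b, ⟨hb, hbt⟩, rfl⟩
      exact hNτ x (hcs hx).1 (hcs hx).2 a ha b hb (hat.trans hbt.symm)
    · rintro _ ⟨z, ⟨h1, h2, h3⟩, rfl⟩
      obtain ⟨x, hx, hz⟩ := Set.mem_iUnion₂.1 (hcover ⟨h1, h2⟩)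
      exact Set.mem_iUnion₂.2 ⟨x, hx, z, ⟨hz, h3⟩, rfl⟩
  obtain ⟨i₀, hi₀, hy⟩ := hcov' y
  -- A pair `(i, t)` stands for the plaque of `O i` on which `τ i = t`. Starting from the plaque of
  -- `y`, the plaques reached by finite chains of overlapping plaques, in the boxes of the countable
  -- cover, form the countable set `RR`; `S` is their union.
  let step : X × T → Set (X × T) := fun P =>
    ⋃ j ∈ s, (fun t => (j, t)) '' (τ j '' {z | z ∈ O P.1 ∧ z ∈ O j ∧ τ P.1 z = P.2})
  have hstep : ∀ P, (step P).Countable := fun P =>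
    hs.biUnion fun j _ => (hadj _ _ _).image _
  let R : ℕ → Set (X × T) := fun n => Nat.rec {(i₀, τ i₀ y)} (fun _ A => ⋃ P ∈ A, step P) n
  have hR : ∀ n, (R n).Countable := by
    intro n
    induction n with
    | zero => exact Set.countable_singleton _
    | succ n ih => exact ih.biUnion fun P _ => hstep P
  let RR : Set (X × T) := ⋃ n, R n
  have hRR : RR.Countable := Set.countable_iUnion hR
  have hclosed : ∀ i j z, z ∈ O i → z ∈ O j → j ∈ s → (i, τ i z) ∈ RR → (j, τ j z) ∈ RR := by
    intro i j z hi hj hjs h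
    obtain ⟨n, hn⟩ := Set.mem_iUnion.1 h
    refine Set.mem_iUnion.2 ⟨n + 1, Set.mem_iUnion₂.2 ⟨_, hn, Set.mem_iUnion₂.2 ⟨j, hjs, ?_⟩⟩⟩
    exact ⟨_, ⟨z, ⟨hi, hj, rfl⟩, rfl⟩, rfl⟩
  let S : Set X := {z | ∃ i ∈ s, z ∈ O i ∧ (i, τ i z) ∈ RR}
  refine ⟨S, ⟨i₀, hi₀, hy, Set.mem_iUnion.2 ⟨0, rfl⟩⟩, fun j => ?_, fun γ hγ hloc => ?_⟩
  · refine (hRR.biUnion (t := fun P _ => τ j '' {z | z ∈ O P.1 ∧ z ∈ O j ∧ τ P.1 z = P.2})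
      fun P _ => hadj _ _ _).mono ?_
    rintro _ ⟨z, ⟨⟨i, -, hzi, hR⟩, hzj⟩, rfl⟩
    exact Set.mem_iUnion₂.2 ⟨_, hR, z, ⟨hzi, hzj, rfl⟩, rfl⟩
  -- Membership in `S` is locally constant along the curve, and the interval is connected.
  · have := isPreconnected_Icc.induction₂ (s := Set.Icc (0 : ℝ) 1)
      (fun a b => γ a ∈ S ↔ γ b ∈ S) ?_ (fun x y z _ _ _ => Iff.trans) (fun x y _ _ => Iff.symm)
      (x := 0) (y := 1) (by simp) (by simp)
    · exact this
    · intro t₀ ht₀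
      obtain ⟨i, his, hi⟩ := hcov' (γ t₀)
      filter_upwards [hloc t₀ ht₀ i hi, (hγ t₀ ht₀).eventually ((hOo i).mem_nhds hi)] with t h1 h2
      constructor
      · rintro ⟨j, hj, hzj, hR⟩
        refine ⟨i, his, h2, ?_⟩
        rw [h1]
        exact hclosed j i _ hzj hi his hR
      · rintro ⟨j, hj, hzj, hR⟩
        refine ⟨i, his, hi, ?_⟩
        rw [← h1]
        exact hclosed j i _ hzj h2 his hR

end Topology

end DiracReduction

namespace DiracReduction

/-! ### Frobenius theorem for total differential systems, by transport along straight lines. -/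

section Frobenius

open Set Metric Filter Topology
open scoped NNReal

variable {E R : Type*} [NormedAddCommGroup E] [NormedSpace ℝ E] [CompleteSpace E]
  [NormedAddCommGroup R] [NormedSpace ℝ R]

/-- A total differential system `dz = A(z) dx`, `x = π z`, which is completely integrable on the
ball of radius `ρ` about `z₀`, together with uniform bounds by `K`. -/
structure IntegrableBall (π : E →L[ℝ] R) (A : E → R →L[ℝ] E) (z₀ : E) (ρ : ℝ) (K : ℝ≥0) :
    Prop where
  pos : 0 < ρ
  one_le : 1 ≤ K
  diff : ∀ z ∈ ball z₀ ρ, DifferentiableAt ℝ A z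
  bound : ∀ z ∈ ball z₀ ρ, ‖A z‖ ≤ K
  lip : ∀ z ∈ ball z₀ ρ, ∀ z' ∈ ball z₀ ρ, ‖A z' - A z‖ ≤ K * ‖z' - z‖
  taylor : ∀ z ∈ ball z₀ ρ, ∀ z' ∈ ball z₀ ρ,
    ‖A z' - A z - fderiv ℝ A z (z' - z)‖ ≤ K * ‖z' - z‖ ^ 2
  dbound : ∀ z ∈ ball z₀ ρ, ‖fderiv ℝ A z‖ ≤ K
  sec : ∀ z ∈ ball z₀ ρ, ∀ η, π (A z η) = η
  symm : ∀ z ∈ ball z₀ ρ, ∀ ξ η, fderiv ℝ A z (A z ξ) η = fderiv ℝ A z (A z η) ξ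

-- A `C^2` map and its derivative are locally Lipschitz, and the second fact yields the quadratic
-- Taylor remainder by the mean value inequality. `K` is a sum of all the local constants, so that
-- it dominates each of them.
omit [CompleteSpace E] in
lemma exists_integrableBall {π : E →L[ℝ] R} {A : E → R →L[ℝ] E} {z₀ : E}
    (hA : ContDiffAt ℝ 2 A z₀) (hsec : ∀ᶠ z in 𝓝 z₀, ∀ η, π (A z η) = η)
    (hsymm : ∀ᶠ z in 𝓝 z₀, ∀ ξ η, fderiv ℝ A z (A z ξ) η = fderiv ℝ A z (A z η) ξ)
    {U : Set E} (hU : U ∈ 𝓝 z₀) :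
    ∃ ρ K, IntegrableBall π A z₀ ρ K ∧ ball z₀ ρ ⊆ U := by
  have hdA : ContDiffAt ℝ 1 (fderiv ℝ A) z₀ := hA.fderiv_right (by norm_num)
  obtain ⟨K₁, t₁, ht₁, hK₁⟩ := (hA.of_le (by norm_num) : ContDiffAt ℝ 1 A z₀).exists_lipschitzOnWith
  obtain ⟨K₂, t₂, ht₂, hK₂⟩ := hdA.exists_lipschitzOnWith
  have hb₁ : ∀ᶠ z in 𝓝 z₀, ‖A z‖₊ ≤ ‖A z₀‖₊ + 1 :=
    (hA.continuousAt.nnnorm.eventually (gt_mem_nhds (lt_add_one _))).mono fun _ h => h.le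
  have hb₂ : ∀ᶠ z in 𝓝 z₀, ‖fderiv ℝ A z‖₊ ≤ ‖fderiv ℝ A z₀‖₊ + 1 :=
    (hdA.continuousAt.nnnorm.eventually (gt_mem_nhds (lt_add_one _))).mono fun _ h => h.le
  have hd : ∀ᶠ z in 𝓝 z₀, DifferentiableAt ℝ A z :=
    (hA.eventually (by norm_num)).mono fun z h => h.differentiableAt (by norm_num)
  obtain ⟨ρ, hρ, hball⟩ := Metric.eventually_nhds_iff_ball.1
    (hsec.and <| hsymm.and <| hb₁.and <| hb₂.and <| hd.and <| (show ∀ᶠ z in 𝓝 z₀, z ∈ t₁ from ht₁).and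
      <| (show ∀ᶠ z in 𝓝 z₀, z ∈ t₂ from ht₂).and (show ∀ᶠ z in 𝓝 z₀, z ∈ U from hU))
  set K : ℝ≥0 := 1 + K₁ + K₂ + (‖A z₀‖₊ + 1) + (‖fderiv ℝ A z₀‖₊ + 1) with hK
  have k1 : K₁ ≤ K := by
    rw [hK, ← NNReal.coe_le_coe]; push_cast; linarith [K₂.2, norm_nonneg (A z₀), norm_nonneg (fderiv ℝ A z₀)]
  have k2 : K₂ ≤ K := by
    rw [hK, ← NNReal.coe_le_coe]; push_cast; linarith [K₁.2, norm_nonneg (A z₀), norm_nonneg (fderiv ℝ A z₀)]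
  have k3 : ‖A z₀‖₊ + 1 ≤ K := by
    rw [hK, ← NNReal.coe_le_coe]; push_cast; linarith [K₁.2, K₂.2, norm_nonneg (fderiv ℝ A z₀)]
  have k4 : ‖fderiv ℝ A z₀‖₊ + 1 ≤ K := by
    rw [hK, ← NNReal.coe_le_coe]; push_cast; linarith [K₁.2, K₂.2, norm_nonneg (A z₀)]
  have k0 : 1 ≤ K := by
    rw [hK, ← NNReal.coe_le_coe]; push_cast
    linarith [K₁.2, K₂.2, norm_nonneg (A z₀), norm_nonneg (fderiv ℝ A z₀)]
  refine ⟨ρ, K, ⟨hρ, k0, fun z hz => (hball z hz).2.2.2.2.1,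
    fun z hz => NNReal.coe_le_coe.2 ((hball z hz).2.2.1.trans k3), fun z hz z' hz' => ?_,
    fun z hz z' hz' => ?_, fun z hz => NNReal.coe_le_coe.2 ((hball z hz).2.2.2.1.trans k4),
    fun z hz => (hball z hz).1, fun z hz => (hball z hz).2.1⟩,
    fun z hz => (hball z hz).2.2.2.2.2.2.2⟩
  · have := hK₁.dist_le_mul z' (hball z' hz').2.2.2.2.2.1 z (hball z hz).2.2.2.2.2.1
    rw [dist_eq_norm, dist_eq_norm] at this
    exact this.trans (mul_le_mul_of_nonneg_right (NNReal.coe_le_coe.2 k1) (norm_nonneg _))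
  · have hseg : segment ℝ z z' ⊆ ball z₀ ρ := (convex_ball z₀ ρ).segment_subset hz hz'
    have := (convex_segment (𝕜 := ℝ) z z').norm_image_sub_le_of_norm_fderiv_le'
      (f := A) (φ := fderiv ℝ A z) (C := K * ‖z' - z‖) (x := z) (y := z')
      (fun w hw => (hball w (hseg hw)).2.2.2.2.1) (fun w hw => ?_) (left_mem_segment ℝ z z')
      (right_mem_segment ℝ z z')
    · rw [pow_two, ← mul_assoc]; exact this
    · have h1 := hK₂.dist_le_mul w (hball w (hseg hw)).2.2.2.2.2.2.1 z (hball z hz).2.2.2.2.2.2.1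
      rw [dist_eq_norm, dist_eq_norm] at h1
      refine h1.trans (mul_le_mul (NNReal.coe_le_coe.2 k2) ?_ (norm_nonneg _) K.2)
      exact norm_sub_le_of_mem_segment hw

namespace IntegrableBall

variable {π : E →L[ℝ] R} {A : E → R →L[ℝ] E} {z₀ : E} {ρ : ℝ} {K : ℝ≥0}

/-- The speed is at most `K * ‖ξ‖` and the ball of that radius about `z` lies in the domain, so the
solution exists up to time 1. -/
lemma exists_curve (h : IntegrableBall π A z₀ ρ K) {z : E} {ξ : R}
    (hz : dist z z₀ + K * ‖ξ‖ < ρ) :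
    ∃ w : ℝ → E, w 0 = z ∧ ∀ t ∈ Icc (0 : ℝ) 1,
      HasDerivWithinAt w (A (w t) ξ) (Icc 0 1) t ∧ dist (w t) z ≤ K * ‖ξ‖ := by
  have hsub : closedBall z (K * ‖ξ‖) ⊆ ball z₀ ρ := fun y hy => by
    rw [mem_ball]; rw [mem_closedBall] at hy
    linarith [dist_triangle y z z₀]
  have hpl : IsPicardLindelof (fun _ w => A w ξ) (tmin := 0) (tmax := 1) ⟨0, by simp⟩ z
      (K * ‖ξ‖₊) 0 (K * ‖ξ‖₊) (K * ‖ξ‖₊) := by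
    refine ⟨fun t _ => LipschitzOnWith.of_dist_le_mul fun x hx y hy => ?_, fun x _ =>
      continuousOn_const, fun t _ x hx => ?_, by simp⟩
    · rw [dist_eq_norm, dist_eq_norm, ← _root_.sub_apply]
      refine ((A x - A y).le_opNorm ξ).trans ?_
      have := h.lip y (hsub hy) x (hsub hx)
      push_cast
      nlinarith [norm_nonneg ξ]
    · refine ((A x).le_opNorm ξ).trans ?_
      have := h.bound x (hsub hx)
      push_cast
      exact mul_le_mul_of_nonneg_right this (norm_nonneg _)
  -- The fixed point of the Picard operator is taken itself, since it carries the information that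
  -- the curve stays in the closed ball of radius `K * ‖ξ‖`.
  obtain ⟨α, hα⟩ := ODE.FunSpace.exists_isFixedPt_next hpl (mem_closedBall_self (by simp))
  refine ⟨α.compProj, ?_, fun t ht => ⟨?_, α.compProj_mem_closedBall hpl.mul_max_le⟩⟩
  · have : α.compProj ((⟨0, by simp⟩ : Icc (0 : ℝ) 1) : ℝ) = z := by
      rw [ODE.FunSpace.compProj_val, ← hα, ODE.FunSpace.next_apply₀]
    exact this
  · apply ODE.hasDerivWithinAt_picard_Icc (⟨0, by simp⟩ : Icc (0 : ℝ) 1).2 hpl.continuousOn_uncurry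
      α.continuous_compProj.continuousOn (fun _ ht' ↦ α.compProj_mem_closedBall hpl.mul_max_le)
      z ht |>.congr_of_mem _ ht
    intro t' ht'
    nth_rw 1 [← hα]
    rw [ODE.FunSpace.compProj_of_mem ht', ODE.FunSpace.next_apply]

omit [CompleteSpace E] in
/-- The curve from `z` that is tangent to the system and lies over a segment in `R`. -/
lemma proj_curve (h : IntegrableBall π A z₀ ρ K) {w : ℝ → E} {ξ : R}
    (hw : ∀ t ∈ Icc (0 : ℝ) 1, HasDerivWithinAt w (A (w t) ξ) (Icc 0 1) t)
    (hmem : ∀ t ∈ Icc (0 : ℝ) 1, w t ∈ ball z₀ ρ) {t : ℝ} (ht : t ∈ Icc (0 : ℝ) 1) :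
    π (w t) = π (w 0) + t • ξ := by
  have hd : ∀ s ∈ Icc (0 : ℝ) 1, HasDerivWithinAt (fun s => π (w s) - s • ξ) 0 (Icc 0 1) s := by
    intro s hs
    have h1 := π.hasFDerivAt.comp_hasDerivWithinAt s (hw s hs)
    have h2 := ((hasDerivWithinAt_id s (Icc (0 : ℝ) 1)).smul_const ξ)
    have h3 := h1.sub h2
    rw [h.sec _ (hmem s hs)] at h3
    rw [one_smul, sub_self] at h3
    exact h3
  have := constant_of_has_deriv_right_zero (fun s hs => (hd s hs).continuousWithinAt)
    (fun s hs => (hd s (Ico_subset_Icc_self hs)).mono_of_mem_nhdsWithin (Icc_mem_nhdsGE_of_mem hs)) t ht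
  simp only [zero_smul, sub_zero] at this
  rw [← this]
  abel

/-- Transporting points along the system to the fibre of `π` through `z₀` gives a first integral
`τ`, which varies at most quadratically along the system. -/
theorem exists_plaqueMap (h : IntegrableBall π A z₀ ρ K) :
    ∃ ε > 0, ε ≤ ρ ∧ ∃ τ : E → E, ∃ C : ℝ, 0 ≤ C ∧
      (∀ z ∈ ball z₀ ε, ∀ z' ∈ ball z₀ ε,
        ‖τ z' - τ z‖ ≤ C * (‖z' - z - A z (π (z' - z))‖ + ‖π (z' - z)‖ ^ 2)) ∧
      (∀ z ∈ ball z₀ ε, π z = π z₀ → τ z = z) ∧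
      (∀ z ∈ ball z₀ ε, ∀ z' ∈ ball z₀ ε, π z = π z' → τ z = τ z' → z = z') := by
  have hρ := h.pos
  have hK1 : (1 : ℝ) ≤ K := by exact_mod_cast h.one_le
  -- `ε` is so small that transported curves stay within `ρ / 4` of `z₀`, that the correction `A δ`
  -- below has norm at most `ρ / 8`, and that the directions of transport have norm at most 1.
  obtain ⟨ε, hε, e1, e2, e3⟩ : ∃ ε > 0, ε ≤ ρ / 8 ∧ K * (‖π‖ * (2 * ε)) ≤ ρ / 8 ∧ ‖π‖ * ε ≤ 1 := by
    have hP : 0 ≤ ‖π‖ := norm_nonneg _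
    have hpos : (0 : ℝ) < 1 + ‖π‖ := by linarith
    have hKP : (0 : ℝ) < K * (1 + ‖π‖) := by positivity
    refine ⟨min (ρ / 8) (min (ρ / 16 / (K * (1 + ‖π‖))) (1 / (1 + ‖π‖))), ?_, min_le_left _ _, ?_, ?_⟩
    · refine lt_min (by positivity) (lt_min (by positivity) (by positivity))
    · have h1 : min (ρ / 8) (min (ρ / 16 / (K * (1 + ‖π‖))) (1 / (1 + ‖π‖))) ≤
        ρ / 16 / (K * (1 + ‖π‖)) := (min_le_right _ _).trans (min_le_left _ _)
      set m := min (ρ / 8) (min (ρ / 16 / (K * (1 + ‖π‖))) (1 / (1 + ‖π‖)))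
      have hm : 0 ≤ m := (lt_min (by positivity) (lt_min (by positivity) (by positivity))).le
      rw [le_div_iff₀ hKP] at h1
      nlinarith [mul_nonneg (zero_le_one.trans hK1) hm]
    · have h1 : min (ρ / 8) (min (ρ / 16 / (K * (1 + ‖π‖))) (1 / (1 + ‖π‖))) ≤ 1 / (1 + ‖π‖) :=
        (min_le_right _ _).trans (min_le_right _ _)
      set m := min (ρ / 8) (min (ρ / 16 / (K * (1 + ‖π‖))) (1 / (1 + ‖π‖)))
      have hm : 0 ≤ m := (lt_min (by positivity) (lt_min (by positivity) (by positivity))).le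
      rw [le_div_iff₀ hpos] at h1
      nlinarith
  have hξ : ∀ z ∈ ball z₀ ε, ‖π z₀ - π z‖ ≤ ‖π‖ * ε := fun z hz => by
    rw [← map_sub]
    refine (π.le_opNorm _).trans (mul_le_mul_of_nonneg_left ?_ (norm_nonneg _))
    rw [← dist_eq_norm, dist_comm]
    exact (mem_ball.1 hz).le
  have hex : ∀ z, ∃ w : ℝ → E, z ∈ ball z₀ ε → (w 0 = z ∧ ∀ t ∈ Icc (0 : ℝ) 1,
      HasDerivWithinAt w (A (w t) (π z₀ - π z)) (Icc 0 1) t ∧ w t ∈ ball z₀ (ρ / 4)) := by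
    intro z
    by_cases hz : z ∈ ball z₀ ε
    · have hz' := mem_ball.1 hz
      have hb : K * ‖π z₀ - π z‖ ≤ ρ / 8 := by
        have := mul_le_mul_of_nonneg_left (hξ z hz) (zero_le_one.trans hK1)
        have h0 : 0 ≤ K * (‖π‖ * ε) := by positivity
        linarith
      obtain ⟨w, hw0, hw⟩ := h.exists_curve (z := z) (ξ := π z₀ - π z) (by linarith)
      refine ⟨w, fun _ => ⟨hw0, fun t ht => ⟨(hw t ht).1, ?_⟩⟩⟩
      rw [mem_ball]
      linarith [dist_triangle (w t) z z₀, (hw t ht).2]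
    · exact ⟨fun _ => z, fun h => absurd h hz⟩
  choose W hW using hex
  have hquart : ball z₀ (ρ / 4) ⊆ ball z₀ ρ := ball_subset_ball (by linarith)
  have hWπ : ∀ z ∈ ball z₀ ε, π (W z 1) = π z₀ := fun z hz => by
    rw [h.proj_curve (fun t ht => ((hW z hz).2 t ht).1)
      (fun t ht => hquart ((hW z hz).2 t ht).2) (t := 1) (by simp), (hW z hz).1]
    simp
  have hlip : ∀ ξ : R, LipschitzOnWith (K * ‖ξ‖₊) (fun w => A w ξ) (ball z₀ ρ) := fun ξ =>
    LipschitzOnWith.of_dist_le_mul fun x hx y hy => by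
      rw [dist_eq_norm, dist_eq_norm, ← _root_.sub_apply]
      refine ((A x - A y).le_opNorm ξ).trans ?_
      have := h.lip y hy x hx
      push_cast
      nlinarith [norm_nonneg ξ]
  -- `τ z` is the endpoint of the transport of `z`. The constant is the Gronwall factor `exp K`
  -- times the bound `2 K ^ 3` for the defect of the comparison curve `g`.
  refine ⟨ε, hε, by linarith, fun z => W z 1, Real.exp K * (2 * K ^ 3), by positivity,
    fun z hz z' hz' => ?_, fun z hz hπ => ?_, fun z hz z' hz' hπ hτ => ?_⟩
  · obtain ⟨w0, hw⟩ := hW z hz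
    obtain ⟨w0', hw'⟩ := hW z' hz'
    set ξ := π z₀ - π z with hξdef
    set ξ' := π z₀ - π z' with hξ'def
    set w := W z
    set w' := W z'
    set δ := π (z' - z) with hδdef
    have hδ : ξ = ξ' + δ := by rw [hδdef, hξdef, hξ'def, map_sub]; abel
    have hδn : ‖δ‖ ≤ ‖π‖ * (2 * ε) := by
      have : δ = ξ - ξ' := by rw [hδ]; abel
      rw [this]
      linarith [norm_sub_le ξ ξ', hξ z hz, hξ z' hz']
    have hKδ : K * ‖δ‖ ≤ ρ / 8 :=
      (mul_le_mul_of_nonneg_left hδn (zero_le_one.trans hK1)).trans e2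
    have hξ'1 : ‖ξ'‖ ≤ 1 := (hξ z' hz').trans e3
    -- The comparison curve starts at `z + A z δ`, the first-order prediction of `z'`, and ends at
    -- `w 1 = τ z`. By the integrability condition the terms of first order in `δ` cancel in `g' -
    -- A(g) ξ'`, which leaves a defect of order `‖δ‖ ^ 2`. Gronwall's inequality then compares `g`
    -- with the transport `w'` of `z'`.
    let g : ℝ → E := fun t => w t + (1 - t) • A (w t) δ
    let g' : ℝ → E := fun t => A (w t) ξ + ((1 - t) • fderiv ℝ A (w t) (A (w t) ξ) δ - A (w t) δ)
    have hgw : ∀ t ∈ Icc (0 : ℝ) 1, ‖(1 - t) • A (w t) δ‖ ≤ K * ‖δ‖ := fun t ht => by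
      rw [norm_smul, Real.norm_eq_abs, abs_of_nonneg (by linarith [ht.2])]
      have h1 := ((A (w t)).le_opNorm δ).trans
        (mul_le_mul_of_nonneg_right (h.bound _ (hquart (hw t ht).2)) (norm_nonneg δ))
      have h2 : (1 - t) * ‖A (w t) δ‖ ≤ 1 * ‖A (w t) δ‖ :=
        mul_le_mul_of_nonneg_right (by linarith [ht.1]) (norm_nonneg _)
      linarith
    have hgmem : ∀ t ∈ Icc (0 : ℝ) 1, g t ∈ ball z₀ ρ := fun t ht => by
      rw [mem_ball]
      have h1 : dist (g t) (w t) ≤ K * ‖δ‖ := by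
        rw [dist_eq_norm, show g t - w t = (1 - t) • A (w t) δ by simp [g]]
        exact hgw t ht
      have h2 := mem_ball.1 (hw t ht).2
      linarith [dist_triangle (g t) (w t) z₀]
    have hg : ∀ t ∈ Icc (0 : ℝ) 1, HasDerivWithinAt g (g' t) (Icc 0 1) t := fun t ht => by
      have h1 := (h.diff _ (hquart (hw t ht).2)).hasFDerivAt.comp_hasDerivWithinAt t (hw t ht).1
      have h2 := h1.clm_apply (hasDerivWithinAt_const t (Icc (0 : ℝ) 1) δ)
      have h3 := ((hasDerivWithinAt_id t (Icc (0 : ℝ) 1)).const_sub 1).smul h2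
      refine ((hw t ht).1.add h3).congr_deriv ?_
      simp only [g', map_zero, add_zero, Function.comp_apply, neg_smul, one_smul, id]
      abel
    have hbound : ∀ t ∈ Icc (0 : ℝ) 1, dist (g' t) (A (g t) ξ') ≤ 2 * K ^ 3 * ‖δ‖ ^ 2 :=
        fun t ht => by
      have hwt := hquart (hw t ht).2
      have hT := h.taylor _ hwt _ (hgmem t ht)
      have hgt : g t - w t = (1 - t) • A (w t) δ := by simp [g]
      rw [hgt] at hT
      set r := A (g t) - A (w t) - fderiv ℝ A (w t) ((1 - t) • A (w t) δ) with hr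
      have hrn : ‖r‖ ≤ K ^ 3 * ‖δ‖ ^ 2 := by
        refine hT.trans ?_
        have := pow_le_pow_left₀ (norm_nonneg _) (hgw t ht) 2
        calc (K : ℝ) * ‖(1 - t) • A (w t) δ‖ ^ 2 ≤ K * (K * ‖δ‖) ^ 2 :=
              mul_le_mul_of_nonneg_left this (zero_le_one.trans hK1)
          _ = K ^ 3 * ‖δ‖ ^ 2 := by ring
      have hAg : A (g t) ξ' = A (w t) ξ' + (1 - t) • fderiv ℝ A (w t) (A (w t) δ) ξ' + r ξ' := by
        have : A (g t) = A (w t) + fderiv ℝ A (w t) ((1 - t) • A (w t) δ) + r := by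
          rw [hr]; abel
        rw [this, map_smul]
        simp
      have heq : g' t - A (g t) ξ' = (1 - t) • fderiv ℝ A (w t) (A (w t) δ) δ - r ξ' := by
        simp only [g', hAg, h.symm _ hwt ξ δ]
        rw [hδ, map_add, map_add, smul_add]
        abel
      rw [dist_eq_norm, heq]
      refine (norm_sub_le _ _).trans ?_
      have h1 : ‖(1 - t) • fderiv ℝ A (w t) (A (w t) δ) δ‖ ≤ K ^ 3 * ‖δ‖ ^ 2 := by
        rw [norm_smul, Real.norm_eq_abs, abs_of_nonneg (by linarith [ht.2])]
        have a1 := (fderiv ℝ A (w t) (A (w t) δ)).le_opNorm δ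
        have a2 := (fderiv ℝ A (w t)).le_opNorm (A (w t) δ)
        have a3 := (A (w t)).le_opNorm δ
        have b1 := h.dbound _ hwt
        have b2 := h.bound _ hwt
        calc (1 - t) * ‖fderiv ℝ A (w t) (A (w t) δ) δ‖
            ≤ 1 * ‖fderiv ℝ A (w t) (A (w t) δ) δ‖ :=
              mul_le_mul_of_nonneg_right (by linarith [ht.1]) (norm_nonneg _)
          _ ≤ K * (K * ‖δ‖) * ‖δ‖ := by
              rw [one_mul]
              refine a1.trans (mul_le_mul_of_nonneg_right (a2.trans ?_) (norm_nonneg _))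
              exact mul_le_mul b1 (a3.trans (mul_le_mul_of_nonneg_right b2 (norm_nonneg _)))
                (norm_nonneg _) K.2
          _ = K ^ 2 * ‖δ‖ ^ 2 := by ring
          _ ≤ K ^ 3 * ‖δ‖ ^ 2 :=
              mul_le_mul_of_nonneg_right (pow_le_pow_right₀ hK1 (by norm_num)) (by positivity)
      have h2 : ‖r ξ'‖ ≤ K ^ 3 * ‖δ‖ ^ 2 := by
        refine (r.le_opNorm ξ').trans ?_
        calc ‖r‖ * ‖ξ'‖ ≤ ‖r‖ * 1 := mul_le_mul_of_nonneg_left hξ'1 (norm_nonneg _)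
          _ ≤ _ := by rw [mul_one]; exact hrn
      linarith
    have hlip' : LipschitzOnWith K (fun w => A w ξ') (ball z₀ ρ) := (hlip ξ').weaken (by
      have : ‖ξ'‖₊ ≤ 1 := by exact_mod_cast hξ'1
      calc K * ‖ξ'‖₊ ≤ K * 1 := by gcongr
        _ = K := mul_one K)
    have hgron := dist_le_of_approx_trajectories_ODE_of_mem (v := fun _ w => A w ξ')
      (s := fun _ => ball z₀ ρ) (K := K) (f := w') (g := g) (f' := fun t => A (w' t) ξ') (g' := g')
      (a := 0) (b := 1) (εf := 0) (εg := 2 * K ^ 3 * ‖δ‖ ^ 2)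
      (δ := ‖z' - z - A z δ‖) (fun _ _ => hlip')
      (fun t ht => (hw' t ht).1.continuousWithinAt)
      (fun t ht => (hw' t (Ico_subset_Icc_self ht)).1.mono_of_mem_nhdsWithin
        (Icc_mem_nhdsGE_of_mem ht)) (fun t _ => by simp)
      (fun t ht => hquart (hw' t (Ico_subset_Icc_self ht)).2)
      (fun t ht => (hg t ht).continuousWithinAt)
      (fun t ht => (hg t (Ico_subset_Icc_self ht)).mono_of_mem_nhdsWithin
        (Icc_mem_nhdsGE_of_mem ht)) (fun t ht => hbound t (Ico_subset_Icc_self ht))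
      (fun t ht => hgmem t (Ico_subset_Icc_self ht))
      (by simp only [g, w0, w0', dist_eq_norm]
          rw [sub_zero, one_smul, sub_add_eq_sub_sub]) 1 (by simp)
    have hg1 : g 1 = w 1 := by simp [g]
    rw [hg1, dist_eq_norm, gronwallBound_of_K_ne_0 (by positivity)] at hgron
    refine hgron.trans ?_
    simp only [zero_add, sub_zero, mul_one]
    have hexp : 1 ≤ Real.exp K := Real.one_le_exp K.2
    have hd : 0 ≤ ‖z' - z - A z δ‖ := norm_nonneg _
    have c1 : 2 * (K : ℝ) ^ 3 * ‖δ‖ ^ 2 / K * (Real.exp K - 1) ≤ 2 * K ^ 3 * ‖δ‖ ^ 2 * Real.exp K :=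
      mul_le_mul (div_le_self (by positivity) hK1) (by linarith) (by linarith) (by positivity)
    have c2 : ‖z' - z - A z δ‖ * Real.exp K ≤ Real.exp K * (2 * K ^ 3) * ‖z' - z - A z δ‖ := by
      have : (1 : ℝ) ≤ 2 * K ^ 3 := by linarith [one_le_pow₀ (n := 3) hK1]
      calc ‖z' - z - A z δ‖ * Real.exp K = Real.exp K * 1 * ‖z' - z - A z δ‖ := by ring
        _ ≤ _ := by gcongr
    rw [mul_add]
    linarith
  · obtain ⟨w0, hw⟩ := hW z hz
    have h0 : ∀ t ∈ Icc (0 : ℝ) 1, HasDerivWithinAt (W z) 0 (Icc 0 1) t := fun t ht => by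
      have := (hw t ht).1
      rwa [hπ, sub_self, map_zero] at this
    have := constant_of_has_deriv_right_zero (fun s hs => (h0 s hs).continuousWithinAt)
      (fun s hs => (h0 s (Ico_subset_Icc_self hs)).mono_of_mem_nhdsWithin
        (Icc_mem_nhdsGE_of_mem hs)) 1 (by simp)
    exact this.trans w0
  -- As `π z = π z'`, both curves solve the same equation; they agree at time 1, hence at time 0.
  · obtain ⟨w0, hw⟩ := hW z hz
    obtain ⟨w0', hw'⟩ := hW z' hz'
    have hcurve : ∀ y ∈ ball z₀ ε, ∀ ξ, π z₀ - π y = ξ → ∀ t ∈ Ioc (0 : ℝ) 1,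
        HasDerivWithinAt (W y) (A (W y t) ξ) (Iic t) t := by
      rintro y hy _ rfl t ht
      exact ((hW y hy).2 t (Ioc_subset_Icc_self ht)).1.mono_of_mem_nhdsWithin
        (Icc_mem_nhdsLE_of_mem ht)
    have := ODE_solution_unique_of_mem_Icc_left (v := fun _ w => A w (π z₀ - π z))
      (s := fun _ => ball z₀ ρ) (fun _ _ => hlip _)
      (fun t ht => (hw t ht).1.continuousWithinAt) (hcurve z hz _ rfl)
      (fun t ht => hquart (hw t (Ioc_subset_Icc_self ht)).2)
      (fun t ht => (hw' t ht).1.continuousWithinAt) (hcurve z' hz' _ (by rw [hπ]))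
      (fun t ht => hquart (hw' t (Ioc_subset_Icc_self ht)).2) hτ
    rw [← w0, ← w0', this (by simp)]

end IntegrableBall

end Frobenius

end DiracReduction

namespace DiracReduction

/-! ### Foliated boxes of an involutive frame of constant rank. -/

section FoliatedBox

open Set Metric Filter Topology
open scoped NNReal

variable {E R G : Type*} [NormedAddCommGroup E] [NormedSpace ℝ E] [FiniteDimensional ℝ E]
  [NormedAddCommGroup R] [NormedSpace ℝ R] [FiniteDimensional ℝ R]
  [NormedAddCommGroup G] [NormedSpace ℝ G] [FiniteDimensional ℝ G]

-- `τ` need not be differentiable. Along a curve tangent to the system, both error terms in its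
-- estimate are `o(s - t)`: the linear one because `A π` fixes the velocity, the quadratic one
-- because `γ` is differentiable at `t`.
omit [FiniteDimensional ℝ E] [FiniteDimensional ℝ R] in
lemma hasDerivWithinAt_plaqueMap {π : E →L[ℝ] R} {A : E → R →L[ℝ] E} {O : Set E} (hO : IsOpen O)
    {τ : E → E} {C : ℝ} (hC : 0 ≤ C)
    (hτ : ∀ z ∈ O, ∀ z' ∈ O,
        ‖τ z' - τ z‖ ≤ C * (‖z' - z - A z (π (z' - z))‖ + ‖π (z' - z)‖ ^ 2))
    {γ : ℝ → E} {S : Set ℝ} {t : ℝ} {v : E} (hγ : HasDerivWithinAt γ v S t)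
    (ht : γ t ∈ O) (hv : A (γ t) (π v) = v) : HasDerivWithinAt (τ ∘ γ) 0 S t := by
  rw [hasDerivWithinAt_iff_isLittleO] at hγ ⊢
  set err : ℝ → E := fun s => γ s - γ t - (s - t) • v with herr
  have hcont : ContinuousWithinAt γ S t :=
    (hasDerivWithinAt_iff_isLittleO.2 hγ).continuousWithinAt
  have hmem : ∀ᶠ s in 𝓝[S] t, γ s ∈ O := hcont.eventually (hO.mem_nhds ht)
  have hO1 : (fun s => γ s - γ t) =O[𝓝[S] t] fun s => s - t := by
    have h1 : (fun s => (s - t) • v) =O[𝓝[S] t] fun s => s - t :=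
      Asymptotics.isBigO_of_le' (c := ‖v‖) _ fun s => by rw [norm_smul, mul_comm]
    have := hγ.isBigO.add h1
    simpa [herr] using this
  have hlim : Tendsto (fun s : ℝ => s - t) (𝓝[S] t) (𝓝 0) := by
    have : Tendsto (fun s : ℝ => s - t) (𝓝 t) (𝓝 (t - t)) := tendsto_id.sub_const t
    rw [sub_self] at this
    exact this.mono_left nhdsWithin_le_nhds
  have hsq : (fun s => ‖π (γ s - γ t)‖ ^ 2) =o[𝓝[S] t] fun s => s - t := by
    have h1 : (fun s => ‖π (γ s - γ t)‖) =O[𝓝[S] t] fun s => s - t :=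
      ((π.isBigO_comp _ _).trans hO1).norm_left
    have h2 : (fun s => s - t) =o[𝓝[S] t] fun _ => (1 : ℝ) := by
      rw [Asymptotics.isLittleO_one_iff]; exact hlim
    have h3 := h1.mul_isLittleO (h1.trans_isLittleO h2)
    simpa [pow_two] using h3
  have hlin : (fun s => ‖γ s - γ t - A (γ t) (π (γ s - γ t))‖) =o[𝓝[S] t] fun s => s - t := by
    have : ∀ s, γ s - γ t - A (γ t) (π (γ s - γ t))
        = (ContinuousLinearMap.id ℝ E - (A (γ t)).comp π) (err s) := fun s => by
      have h0 : A (γ t) (π ((s - t) • v)) = (s - t) • v := by rw [map_smul, map_smul, hv]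
      simp only [herr, _root_.sub_apply, ContinuousLinearMap.id_apply,
        ContinuousLinearMap.comp_apply]
      rw [map_sub π (γ s - γ t), map_sub (A (γ t)), h0]
      abel
    simp_rw [this]
    exact ((ContinuousLinearMap.isBigO_comp _ _ _).trans_isLittleO hγ).norm_left
  refine Asymptotics.IsBigO.trans_isLittleO (Asymptotics.IsBigO.of_bound C ?_) (hlin.add hsq)
  filter_upwards [hmem] with s hs
  simp only [Function.comp_apply, smul_zero, sub_zero]
  refine (hτ _ ht _ hs).trans (mul_le_mul_of_nonneg_left (le_abs_self _) hC)

/-- A smooth frame of an involutive distribution of constant rank can be normalised to a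
completely integrable total differential system. -/
lemma exists_integrable_system {V : E → G →L[ℝ] E} {z₀ : E} {r : ℕ}
    (hV : ContDiffAt ℝ 2 V z₀)
    (hrank : ∀ᶠ z in 𝓝 z₀, Module.finrank ℝ (LinearMap.range (V z : G →ₗ[ℝ] E)) = r)
    (hinv : ∀ᶠ z in 𝓝 z₀, ∀ a b, ∃ c,
      fderiv ℝ V z (V z a) b - fderiv ℝ V z (V z b) a = V z c) :
    ∃ (X : Submodule ℝ E) (π : E →L[ℝ] X) (A : E → X →L[ℝ] E), Module.finrank ℝ X = r ∧
      ContDiffAt ℝ 2 A z₀ ∧ (∀ᶠ z in 𝓝 z₀, ∀ η, π (A z η) = η) ∧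
      (∀ᶠ z in 𝓝 z₀, ∀ ξ η, fderiv ℝ A z (A z ξ) η = fderiv ℝ A z (A z η) ξ) ∧
      ∀ᶠ z in 𝓝 z₀, LinearMap.range (A z : X →ₗ[ℝ] E) = LinearMap.range (V z : G →ₗ[ℝ] E) := by
  let X : Submodule ℝ E := LinearMap.range (V z₀ : G →ₗ[ℝ] E)
  obtain ⟨σ, hσ⟩ := LinearMap.exists_rightInverse_of_surjective
    (V z₀ : G →ₗ[ℝ] E).rangeRestrict (LinearMap.range_rangeRestrict _)
  obtain ⟨p, hp⟩ := LinearMap.exists_leftInverse_of_injective X.subtype X.ker_subtype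
  let σ' : X →L[ℝ] G := LinearMap.toContinuousLinearMap σ
  let π : E →L[ℝ] X := LinearMap.toContinuousLinearMap p
  -- `B` is the identity at `z₀`, hence invertible nearby, and `A = V σ' B⁻¹` is the frame of the
  -- same distribution normalised by `π A = id`. Constant rank ensures that it spans the whole
  -- distribution.
  let B : E → X →L[ℝ] X := fun z => π.comp ((V z).comp σ')
  have hB0 : B z₀ = ContinuousLinearMap.id ℝ X := by
    ext x
    have h1 : V z₀ (σ x) = x := congrArg Subtype.val (LinearMap.congr_fun hσ x)
    have h2 : p x = x := LinearMap.congr_fun hp x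
    change ((p (V z₀ (σ x)) : X) : E) = x
    rw [h1, h2]
  have hX : Module.finrank ℝ X = r := hrank.self_of_nhds
  have hBc : ContDiffAt ℝ 2 B z₀ := contDiffAt_const.clm_comp (hV.clm_comp contDiffAt_const)
  let I : E → X →L[ℝ] X := fun z => (B z).inverse
  have hI : ContDiffAt ℝ 2 I z₀ := by
    refine ContDiffAt.comp z₀ (g := ContinuousLinearMap.inverse) ?_ hBc
    rw [hB0]
    exact contDiffAt_map_inverse (ContinuousLinearEquiv.refl ℝ X)
  have hBI : ∀ᶠ z in 𝓝 z₀, (B z).comp (I z) = ContinuousLinearMap.id ℝ X := by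
    have h1 : ∀ᶠ z in 𝓝 z₀, B z ∈ range ((↑) : (X ≃L[ℝ] X) → X →L[ℝ] X) := by
      refine hBc.continuousAt.eventually ?_
      rw [hB0]
      exact (ContinuousLinearEquiv.refl ℝ X).nhds
    filter_upwards [h1] with z hz
    obtain ⟨e, he⟩ := hz
    simp only [I, ← he, ContinuousLinearMap.inverse_equiv]
    exact e.coe_comp_coe_symm
  let H : E → X →L[ℝ] G := fun z => σ'.comp (I z)
  have hH : ContDiffAt ℝ 2 H z₀ := contDiffAt_const.clm_comp hI
  let A : E → X →L[ℝ] E := fun z => (V z).comp (H z)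
  have hA : ContDiffAt ℝ 2 A z₀ := hV.clm_comp hH
  have hsec : ∀ᶠ z in 𝓝 z₀, ∀ η, π (A z η) = η := by
    filter_upwards [hBI] with z hz η
    exact DFunLike.congr_fun hz η
  have hrange : ∀ᶠ z in 𝓝 z₀,
      LinearMap.range (A z : X →ₗ[ℝ] E) = LinearMap.range (V z : G →ₗ[ℝ] E) := by
    filter_upwards [hsec, hrank] with z hz hr
    refine Submodule.eq_of_le_of_finrank_eq ?_ ?_
    · rintro _ ⟨η, rfl⟩
      exact ⟨H z η, rfl⟩
    · rw [hr, LinearMap.finrank_range_of_inj, hX]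
      intro a b hab
      rw [← hz a, ← hz b]
      exact congrArg π hab
  refine ⟨X, π, A, hX, hA, hsec, ?_, hrange⟩
  have hVd := (hV.eventually (by norm_num)).mono fun z h => h.differentiableAt (by norm_num)
  have hHd := (hH.eventually (by norm_num)).mono fun z h => h.differentiableAt (by norm_num)
  have hAd := (hA.eventually (by norm_num)).mono fun z h => h.differentiableAt (by norm_num)
  filter_upwards [hVd, hHd, hAd, hsec.eventually_nhds, hrange, hinv] with z hVz hHz hAz hsz hrz hiz ξ η
  have hdA : ∀ u ζ, fderiv ℝ A z u ζ = fderiv ℝ V z u (H z ζ) + V z (fderiv ℝ H z u ζ) := by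
    intro u ζ
    have := (hVz.hasFDerivAt.clm_comp hHz.hasFDerivAt).fderiv
    rw [show fderiv ℝ A z = _ from this]
    exact add_comm (V z (fderiv ℝ H z u ζ)) (fderiv ℝ V z u (H z ζ))
  -- Differentiating `π A = id` shows that `π` kills the derivative of `A`. By involutivity the
  -- antisymmetrised derivative lies in the range of `A`, where `π` is injective, so it vanishes.
  have hπ : ∀ u ζ, π (fderiv ℝ A z u ζ) = 0 := by
    intro u ζ
    have h1 : HasFDerivAt (fun y => π.comp (A y)) _ z :=
      (hasFDerivAt_const π z).clm_comp hAz.hasFDerivAt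
    have h2 : HasFDerivAt (fun y => π.comp (A y)) (0 : E →L[ℝ] X →L[ℝ] X) z := by
      refine (hasFDerivAt_const (ContinuousLinearMap.id ℝ X) z).congr_of_eventuallyEq ?_
      filter_upwards [hsz] with y hy
      ext η
      simp [hy]
    have h3 := DFunLike.congr_fun (DFunLike.congr_fun (h1.unique h2) u) ζ
    simpa using h3
  obtain ⟨c, hc⟩ := hiz (H z ξ) (H z η)
  have hmem : fderiv ℝ A z (A z ξ) η - fderiv ℝ A z (A z η) ξ
      ∈ LinearMap.range (A z : X →ₗ[ℝ] E) := by
    rw [hrz]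
    refine ⟨c + (fderiv ℝ H z (A z ξ) η - fderiv ℝ H z (A z η) ξ), ?_⟩
    simp only [ContinuousLinearMap.coe_coe, map_add, map_sub, ← hc, hdA]
    simp only [A, ContinuousLinearMap.comp_apply]
    abel
  obtain ⟨ζ, hζ⟩ := hmem
  have h0 : ζ = 0 := by
    rw [← hsz.self_of_nhds ζ, show A z ζ = _ from hζ, map_sub, hπ, hπ, sub_zero]
  rw [h0, map_zero] at hζ
  exact (sub_eq_zero.1 hζ.symm)

/-- Foliated boxes of an involutive distribution of constant rank spanned by a smooth frame:
the fibres of `τ` are the plaques. -/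
theorem exists_foliatedBox {V : E → G →L[ℝ] E} {z₀ : E} {r : ℕ}
    (hV : ContDiffAt ℝ 2 V z₀)
    (hrank : ∀ᶠ z in 𝓝 z₀, Module.finrank ℝ (LinearMap.range (V z : G →ₗ[ℝ] E)) = r)
    (hinv : ∀ᶠ z in 𝓝 z₀, ∀ a b, ∃ c,
      fderiv ℝ V z (V z a) b - fderiv ℝ V z (V z b) a = V z c)
    {U : Set E} (hU : U ∈ 𝓝 z₀) :
    ∃ (O : Set E) (τ : E → E), IsOpen O ∧ z₀ ∈ O ∧ O ⊆ U ∧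
      (∀ (γ : ℝ → E) (S : Set ℝ) (t : ℝ) (a : G), γ t ∈ O →
        HasDerivWithinAt γ (V (γ t) a) S t → HasDerivWithinAt (τ ∘ γ) 0 S t) ∧
      (∀ z₁ ∈ O, ∀ O' ∈ 𝓝 z₁, ∃ N ∈ 𝓝 z₁, ∀ z ∈ N, ∀ z' ∈ N, τ z = τ z' →
        ∃ w : ℝ → E, w 0 = z ∧ w 1 = z' ∧ ∀ t ∈ Icc (0 : ℝ) 1, w t ∈ O' ∧
          ∃ a, HasDerivWithinAt w (V (w t) a) (Icc 0 1) t) ∧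
      (r < Module.finrank ℝ E → ¬ (τ '' O).Countable) := by
  obtain ⟨X, π, A, hX, hA, hsec, hsymm, hrange⟩ := exists_integrable_system hV hrank hinv
  obtain ⟨ρ, K, hball, hsub⟩ := exists_integrableBall hA hsec hsymm (hrange.and hU)
  obtain ⟨ε, hε, hερ, τ, C, hC, hτ, hfix, hinj⟩ := hball.exists_plaqueMap
  have hle : ball z₀ ε ⊆ ball z₀ ρ := ball_subset_ball hερ
  have hK1 : (1 : ℝ) ≤ K := by exact_mod_cast hball.one_le
  have hconst : ∀ (γ : ℝ → E) (S : Set ℝ) (t : ℝ) (v : E), γ t ∈ ball z₀ ε →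
      v ∈ LinearMap.range (A (γ t) : X →ₗ[ℝ] E) → HasDerivWithinAt γ v S t →
      HasDerivWithinAt (τ ∘ γ) 0 S t := by
    rintro γ S t v hγ ⟨η, rfl⟩ hd
    refine hasDerivWithinAt_plaqueMap isOpen_ball hC hτ hd hγ ?_
    rw [ContinuousLinearMap.coe_coe, hball.sec _ (hle hγ)]
  refine ⟨ball z₀ ε, τ, isOpen_ball, mem_ball_self hε, fun z hz => (hsub (hle hz)).2,
    fun γ S t a hγ hd => hconst γ S t _ hγ ?_ hd, fun z₁ hz₁ O' hO' => ?_, fun hr hcount => ?_⟩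
  · rw [(hsub (hle hγ)).1]
    exact ⟨a, rfl⟩
  · obtain ⟨s, hs, hsO⟩ := Metric.mem_nhds_iff.1 (inter_mem hO' (isOpen_ball.mem_nhds hz₁))
    have hpos : 0 < 1 + 2 * (K * ‖π‖) := by positivity
    -- With this radius, the lift from `z` of the segment between `π z` and `π z'` stays within `s /
    -- 2` of `z₁`.
    set δ := s / (1 + 2 * (K * ‖π‖)) / 2 with hδ
    have hδ0 : 0 < δ := by positivity
    have hδs : (1 + 2 * (K * ‖π‖)) * δ < s := by
      have : (1 + 2 * (K * ‖π‖)) * δ = s / 2 := by rw [hδ]; field_simp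
      linarith
    have hmono : δ ≤ (1 + 2 * (K * ‖π‖)) * δ := by
      nlinarith [mul_nonneg (mul_nonneg (zero_le_one.trans hK1) (norm_nonneg π)) hδ0.le]
    have hN : ball z₁ δ ⊆ ball z₀ ε := fun z hz =>
      (hsO (ball_subset_ball (hmono.trans hδs.le) hz)).2
    refine ⟨ball z₁ δ, ball_mem_nhds _ hδ0, fun z hz z' hz' hzz' => ?_⟩
    have hξ : K * ‖π z' - π z‖ ≤ 2 * (K * ‖π‖) * δ := by
      have h1 : ‖z' - z‖ ≤ 2 * δ := by
        rw [← dist_eq_norm]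
        linarith [dist_triangle_right z' z z₁, mem_ball.1 hz, mem_ball.1 hz']
      have h2 : ‖π z' - π z‖ ≤ ‖π‖ * (2 * δ) := by
        rw [← map_sub]
        exact (π.le_opNorm _).trans (mul_le_mul_of_nonneg_left h1 (norm_nonneg _))
      calc (K : ℝ) * ‖π z' - π z‖ ≤ K * (‖π‖ * (2 * δ)) := by gcongr
        _ = _ := by ring
    have hstay : ∀ y, dist y z ≤ K * ‖π z' - π z‖ → y ∈ ball z₁ s := fun y hy => by
      rw [mem_ball]
      have := mem_ball.1 hz
      linarith [dist_triangle y z z₁]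
    have hin : ∀ y, dist y z ≤ K * ‖π z' - π z‖ → y ∈ ball z₀ ρ := fun y hy =>
      hle (hsO (hstay y hy)).2
    have hcl : closedBall z (K * ‖π z' - π z‖) ⊆ ball z₀ ε := fun y hy =>
      (hsO (hstay y (mem_closedBall.1 hy))).2
    -- The lift of the segment from `π z` to `π z'` starting at `z`. `τ` is constant on it, so its
    -- endpoint has the same values of `τ` and `π` as `z'`, and therefore equals `z'`.
    obtain ⟨w, hw0, hw⟩ : ∃ w : ℝ → E, w 0 = z ∧ ∀ t ∈ Icc (0 : ℝ) 1,
        HasDerivWithinAt w (A (w t) (π z' - π z)) (Icc 0 1) t ∧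
          dist (w t) z ≤ K * ‖π z' - π z‖ := by
      have hb : IntegrableBall π A z₁ s K := by
        have hs' : ball z₁ s ⊆ ball z₀ ρ := fun y hy => hle (hsO hy).2
        exact ⟨hs, hball.one_le, fun z hz => hball.diff z (hs' hz),
          fun z hz => hball.bound z (hs' hz),
          fun z hz z' hz' => hball.lip z (hs' hz) z' (hs' hz'),
          fun z hz z' hz' => hball.taylor z (hs' hz) z' (hs' hz'),
          fun z hz => hball.dbound z (hs' hz), fun z hz => hball.sec z (hs' hz),
          fun z hz => hball.symm z (hs' hz)⟩
      exact hb.exists_curve (by linarith [mem_ball.1 hz])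
    have hwρ : ∀ t ∈ Icc (0 : ℝ) 1, w t ∈ ball z₀ ρ := fun t ht => hin _ (hw t ht).2
    have hwε : ∀ t ∈ Icc (0 : ℝ) 1, w t ∈ ball z₀ ε := fun t ht => (hsO (hstay _ (hw t ht).2)).2
    have hd0 : ∀ t ∈ Icc (0 : ℝ) 1, HasDerivWithinAt (τ ∘ w) 0 (Icc 0 1) t := fun t ht =>
      hconst w _ t _ (hwε t ht) ⟨_, rfl⟩ (hw t ht).1
    have hτ1 : τ (w 1) = τ (w 0) :=
      constant_of_has_deriv_right_zero (f := τ ∘ w) (fun s hs => (hd0 s hs).continuousWithinAt)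
        (fun s hs => (hd0 s (Ico_subset_Icc_self hs)).mono_of_mem_nhdsWithin
          (Icc_mem_nhdsGE_of_mem hs)) 1 (by simp)
    have hπ1 : π (w 1) = π z' := by
      rw [hball.proj_curve (fun t ht => (hw t ht).1) hwρ (t := 1) (by simp), hw0]
      simp
    refine ⟨w, hw0, hinj _ (hwε 1 (by simp)) _ (hN hz') hπ1 (by rw [hτ1, hw0, hzz']),
      fun t ht => ⟨(hsO (hstay _ (hw t ht).2)).1, ?_⟩⟩
    have hmem : A (w t) (π z' - π z) ∈ LinearMap.range (V (w t) : G →ₗ[ℝ] E) := by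
      rw [← (hsub (hwρ t ht)).1]
      exact ⟨_, rfl⟩
    obtain ⟨a, ha⟩ := hmem
    refine ⟨a, ?_⟩
    rw [show V (w t) a = _ from ha]
    exact (hw t ht).1
  -- `τ` is the identity on the slice `π = π z₀` near `z₀`. When the rank is not full this slice
  -- contains a segment, which is uncountable.
  · have hker : LinearMap.ker (π : E →ₗ[ℝ] X) ≠ ⊥ := by
      intro hbot
      have := LinearMap.finrank_le_finrank_of_injective (LinearMap.ker_eq_bot.1 hbot)
      omega
    obtain ⟨k, hk, hk0⟩ := Submodule.exists_mem_ne_zero_of_ne_bot hker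
    have hkn : 0 < ‖k‖ := norm_pos_iff.2 hk0
    have hsubset : (fun s : ℝ => z₀ + s • k) '' Ioo 0 (ε / ‖k‖) ⊆ τ '' ball z₀ ε := by
      rintro _ ⟨s, ⟨hs0, hs1⟩, rfl⟩
      have hmem : z₀ + s • k ∈ ball z₀ ε := by
        rw [mem_ball, dist_eq_norm, add_sub_cancel_left, norm_smul, Real.norm_eq_abs,
          abs_of_pos hs0]
        rwa [lt_div_iff₀ hkn] at hs1
      exact ⟨_, hmem, hfix _ hmem (by rw [map_add, map_smul, show π k = 0 from hk]; simp)⟩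
    have hc : (Ioo (0 : ℝ) (ε / ‖k‖)).Countable := by
      refine countable_of_injective_of_countable_image (fun a _ b _ hab => ?_)
        (hcount.mono hsubset)
      have : (a - b) • k = 0 := by
        rw [sub_smul, sub_eq_zero]
        exact add_left_cancel hab
      exact sub_eq_zero.1 ((smul_eq_zero.1 this).resolve_right hk0)
    rw [← Cardinal.le_aleph0_iff_set_countable, Cardinal.mk_Ioo_real (by positivity)] at hc
    exact absurd hc (not_le.2 Cardinal.aleph0_lt_continuum)

end FoliatedBox

end DiracReduction

namespace DiracReduction

/-! ### Smooth fields and forms tested by functions; extension by bump functions. -/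

section Smoothness

variable {E : Type*} [NormedAddCommGroup E] [NormedSpace ℝ E]
  {M : Type*} [TopologicalSpace M] [ChartedSpace E M]
  {F : Type*} [NormedAddCommGroup F] [NormedSpace ℝ F]

instance finiteDimensional_tangentSpace [FiniteDimensional ℝ E] (p : M) :
    FiniteDimensional ℝ (TangentSpace 𝓘(ℝ, E) p) :=
  inferInstanceAs (FiniteDimensional ℝ E)

instance t2Space_tangentSpace (p : M) : T2Space (TangentSpace 𝓘(ℝ, E) p) :=
  inferInstanceAs (T2Space E)

variable [IsManifold 𝓘(ℝ, E) ∞ M]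

/-- A vector field is smooth at a point. -/
def SmoothVFAt (X : VField E M) (p : M) : Prop :=
  ContMDiffAt 𝓘(ℝ, E) (𝓘(ℝ, E)).tangent ∞ (fun q => (⟨q, X q⟩ : TangentBundle 𝓘(ℝ, E) M)) p

/-- A 1-form is smooth at a point. -/
def SmoothOneFormAt (α : ∀ p : M, Cotangent E p) (p : M) : Prop :=
  ContMDiffAt 𝓘(ℝ, E) (𝓘(ℝ, E).prod 𝓘(ℝ, E →L[ℝ] ℝ)) ∞
    (fun p => Bundle.TotalSpace.mk' (E →L[ℝ] ℝ)
      (E := fun q : M => TangentSpace 𝓘(ℝ, E) q →L[ℝ] Bundle.Trivial M ℝ q) p (α p)) p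

lemma SmoothVFAt.mvfderiv_apply {X : VField E M} {p : M} (hX : SmoothVFAt X p) {g : M → F}
    (hg : ContMDiffAt 𝓘(ℝ, E) 𝓘(ℝ, F) ∞ g p) :
    ContMDiffAt 𝓘(ℝ, E) 𝓘(ℝ, F) ∞ (fun q => mvfderiv 𝓘(ℝ, E) g q (X q)) p := by
  have h1 := hg.mfderiv_const (m := ∞) (by simp)
  have h2 := ContMDiffAt.clm_apply_of_inCoordinates (E₂ := TangentSpace 𝓘(ℝ, F)) (b₁ := id)
    (b₂ := g) (v := X) (ϕ := fun q => mfderiv 𝓘(ℝ, E) 𝓘(ℝ, F) g q) (m₀ := p) h1 hX hg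
  have h3 := (contMDiff_snd_tangentBundle_modelSpace F 𝓘(ℝ, F) (n := ∞)).contMDiffAt.comp p h2
  exact h3

/-- The trivialization of the tangent bundle at `p` is the differential of the chart at `p`;
smoothness in the bundle becomes smoothness of a vector-valued function. -/
lemma smoothVFAt_iff {X : VField E M} {p : M} :
    SmoothVFAt X p ↔ ContMDiffAt 𝓘(ℝ, E) 𝓘(ℝ, E) ∞
      (fun q => mvfderiv 𝓘(ℝ, E) (extChartAt 𝓘(ℝ, E) p) q (X q)) p := by
  rw [SmoothVFAt, Bundle.contMDiffAt_section]
  refine Filter.EventuallyEq.contMDiffAt_iff ?_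
  filter_upwards [(chartAt E p).open_source.mem_nhds (mem_chart_source E p)] with q hq
  have := TangentBundle.continuousLinearMapAt_trivializationAt (I := 𝓘(ℝ, E)) hq
  rw [← Bundle.Trivialization.continuousLinearMapAt_apply_of_mem (R := ℝ) _
    (by simpa using hq), this]
  rfl

end Smoothness

end DiracReduction

namespace DiracReduction

section Smoothness

open Filter Topology

variable {E : Type*} [NormedAddCommGroup E] [NormedSpace ℝ E]
  {M : Type*} [TopologicalSpace M] [ChartedSpace E M]
  {F : Type*} [NormedAddCommGroup F] [NormedSpace ℝ F]

lemma mvfderiv_comp_apply' {E' : Type*} [NormedAddCommGroup E'] [NormedSpace ℝ E']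
    {M' : Type*} [TopologicalSpace M'] [ChartedSpace E' M'] {f : M' → M} {g : M → F} (x : M')
    (hg : MDifferentiableAt 𝓘(ℝ, E) 𝓘(ℝ, F) g (f x))
    (hf : MDifferentiableAt 𝓘(ℝ, E') 𝓘(ℝ, E) f x) (v : TangentSpace 𝓘(ℝ, E') x) :
    mvfderiv 𝓘(ℝ, E') (g ∘ f) x v
      = mvfderiv 𝓘(ℝ, E) g (f x) (mfderiv 𝓘(ℝ, E') 𝓘(ℝ, E) f x v) :=
  mfderiv_comp_apply x hg hf v

lemma mvfderiv_congr {f g : M → F} {p : M} (h : f =ᶠ[𝓝 p] g) (v : TangentSpace 𝓘(ℝ, E) p) :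
    mvfderiv 𝓘(ℝ, E) f p v = mvfderiv 𝓘(ℝ, E) g p v := by
  unfold mvfderiv
  have := h.mfderiv_eq (I := 𝓘(ℝ, E)) (I' := 𝓘(ℝ, F))
  exact congrArg (fun L : E →L[ℝ] F => L v) this

lemma mvfderiv_vectorSpace {g : E → F} (z v : E) :
    mvfderiv 𝓘(ℝ, E) g z v = fderiv ℝ g z v := by
  have := mfderiv_eq_fderiv (𝕜 := ℝ) (f := g) (x := z)
  exact congrArg (fun L : E →L[ℝ] F => L v) this

lemma mvfderiv_clm_comp {F' : Type*} [NormedAddCommGroup F'] [NormedSpace ℝ F'] (L : F →L[ℝ] F')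
    {g : M → F} {p : M} (hg : MDifferentiableAt 𝓘(ℝ, E) 𝓘(ℝ, F) g p)
    (v : TangentSpace 𝓘(ℝ, E) p) :
    mvfderiv 𝓘(ℝ, E) (fun q => L (g q)) p v = L (mvfderiv 𝓘(ℝ, E) g p v) := by
  have h := mvfderiv_comp_apply' (E' := E) (M' := M) (f := g) (g := L) p
    L.differentiableAt.mdifferentiableAt hg v
  refine h.trans ?_
  have := mvfderiv_vectorSpace (g := L) (g p) (mfderiv 𝓘(ℝ, E) 𝓘(ℝ, F) g p v)
  rw [this, L.fderiv]
  rfl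

variable [IsManifold 𝓘(ℝ, E) ∞ M]

lemma SmoothVFAt.congr_of_eventuallyEq {X Y : VField E M} {p : M} (hX : SmoothVFAt X p)
    (h : ∀ᶠ q in 𝓝 p, Y q = X q) : SmoothVFAt Y p := by
  refine ContMDiffAt.congr_of_eventuallyEq hX ?_
  filter_upwards [h] with q hq
  rw [hq]

lemma mfderiv_extChartAt_injective {p q : M} (hq : q ∈ (chartAt E p).source) :
    Function.Injective (mvfderiv 𝓘(ℝ, E) (extChartAt 𝓘(ℝ, E) p) q) :=
  (isInvertible_mfderiv_extChartAt (I := 𝓘(ℝ, E)) (x := p) (y := q)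
    (by simpa using hq)).bijective.injective

lemma contMDiffAt_extChart {p q : M} (hq : q ∈ (chartAt E p).source) :
    ContMDiffAt 𝓘(ℝ, E) 𝓘(ℝ, E) ∞ (extChartAt 𝓘(ℝ, E) p) q :=
  contMDiffAt_extChartAt' hq

lemma SmoothVFAt.sum_smul {ι : Type*} [Fintype ι] {u : ι → M → ℝ} {X : ι → VField E M} {p : M}
    (hu : ∀ i, ContMDiffAt 𝓘(ℝ, E) 𝓘(ℝ) ∞ (u i) p) (hX : ∀ i, SmoothVFAt (X i) p) :
    SmoothVFAt (fun q => ∑ i, u i q • X i q) p := by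
  rw [smoothVFAt_iff]
  simp only [map_sum, map_smul]
  exact ContMDiffAt.sum fun i _ => (hu i).smul (smoothVFAt_iff.1 (hX i))

lemma SmoothVFAt.smul {u : M → ℝ} {X : VField E M} {p : M}
    (hu : ContMDiffAt 𝓘(ℝ, E) 𝓘(ℝ) ∞ u p) (hX : SmoothVFAt X p) :
    SmoothVFAt (fun q => u q • X q) p := by
  rw [smoothVFAt_iff]
  simp only [map_smul]
  exact hu.smul (smoothVFAt_iff.1 hX)

lemma smoothVF_zero : SmoothVF E (fun p : M => (0 : TangentSpace 𝓘(ℝ, E) p)) := fun p => by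
  change SmoothVFAt _ p
  rw [smoothVFAt_iff]
  simp only [map_zero]
  exact contMDiffAt_const

lemma SmoothVFAt.lieBr [CompleteSpace E] {X Y : VField E M} {p : M} (hX : SmoothVFAt X p) (hY : SmoothVFAt Y p) :
    SmoothVFAt (lieBr E X Y) p := by
  have : IsManifold 𝓘(ℝ, E) (minSmoothness ℝ 2) M := .of_le (n := ∞)
    (by simp only [minSmoothness_of_isRCLikeNormedField]; exact WithTop.coe_le_coe.2 le_top)
  have : IsManifold 𝓘(ℝ, E) (((⊤ : ℕ∞) : WithTop ℕ∞) + 1) M := ‹IsManifold 𝓘(ℝ, E) ∞ M›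
  exact ContMDiffAt.mlieBracket_vectorField (m := ⊤) (n := ⊤) hX hY
    (by simp only [minSmoothness_of_isRCLikeNormedField]; exact le_rfl)

section Bump

variable [FiniteDimensional ℝ E] [T2Space M]

lemma exists_bump {p : M} {U : Set M} (hU : U ∈ 𝓝 p) : ∃ ψ : M → ℝ,
    ContMDiff 𝓘(ℝ, E) 𝓘(ℝ) ∞ ψ ∧ tsupport ψ ⊆ U ∧ ∀ᶠ q in 𝓝 p, ψ q = 1 := by
  obtain ⟨f, -, hf⟩ := (SmoothBumpFunction.nhds_basis_tsupport (I := 𝓘(ℝ, E)) p).mem_iff.1 hU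
  exact ⟨f, f.contMDiff, hf, f.eventuallyEq_one⟩

/-- Dirac and Poisson structures are tested on global objects, so local constructions are cut off by
a bump function. -/
lemma exists_global_extension {p : M} {g : M → F}
    (hg : ∀ᶠ q in 𝓝 p, ContMDiffAt 𝓘(ℝ, E) 𝓘(ℝ, F) ∞ g q) :
    ∃ g' : M → F, ContMDiff 𝓘(ℝ, E) 𝓘(ℝ, F) ∞ g' ∧ ∀ᶠ q in 𝓝 p, g' q = g q := by
  obtain ⟨ψ, hψ, hs, h1⟩ := exists_bump (E := E) hg
  refine ⟨fun q => ψ q • g q, contMDiff_of_tsupport fun q hq => ?_, ?_⟩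
  · exact (hψ q).smul (hs (tsupport_smul_subset_left _ _ hq))
  · filter_upwards [h1] with q hq
    simp [hq]

/-- Global smooth vector fields which are constant in the chart at `p`. -/
lemma exists_coordinate_fields (p : M) : ∃ Z : E → VField E M, (∀ v, SmoothVF E (Z v)) ∧
    ∀ᶠ q in 𝓝 p, ∀ v, mvfderiv 𝓘(ℝ, E) (extChartAt 𝓘(ℝ, E) p) q (Z v q) = v := by
  obtain ⟨ψ, hψ, hs, h1⟩ := exists_bump (E := E)
    ((chartAt E p).open_source.mem_nhds (mem_chart_source E p))
  let e := trivializationAt E (TangentSpace 𝓘(ℝ, E)) p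
  have hbase : e.baseSet = (chartAt E p).source := TangentBundle.trivializationAt_baseSet p
  refine ⟨fun v q => ψ q • e.symmL ℝ q v, fun v => ?_, ?_⟩
  · refine ContMDiffOn.smul_section_of_tsupport (ψ := ψ) (s := fun q => e.symmL ℝ q v)
      hψ.contMDiffOn (chartAt E p).open_source hs fun q hq => ContMDiffAt.contMDiffWithinAt ?_
    rw [e.contMDiffAt_section_iff (by rwa [hbase])]
    refine (contMDiffAt_const (c := v)).congr_of_eventuallyEq ?_
    filter_upwards [(chartAt E p).open_source.mem_nhds hq] with y hy
    rw [← hbase] at hy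
    rw [e.symmL_apply hy, e.mk_symm hy, e.apply_symm_apply]
    simpa [e.mem_target] using hy
  · filter_upwards [h1, (chartAt E p).open_source.mem_nhds (mem_chart_source E p)] with q hq hq' v
    rw [hq, one_smul]
    have := TangentBundle.continuousLinearMapAt_trivializationAt (I := 𝓘(ℝ, E)) hq'
    have h2 := e.continuousLinearMapAt_symmL (R := ℝ) (b := q) (by rwa [hbase]) v
    have h3 := congrArg (fun L : TangentSpace 𝓘(ℝ, E) q →L[ℝ] E => L (e.symmL ℝ q v)) this
    exact h3.symm.trans h2

lemma exists_vf_eq {p : M} (v : TangentSpace 𝓘(ℝ, E) p) :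
    ∃ Z : VField E M, SmoothVF E Z ∧ Z p = v := by
  obtain ⟨Z, hZ, h⟩ := exists_coordinate_fields (E := E) p
  exact ⟨Z _, hZ _, mfderiv_extChartAt_injective (mem_chart_source E p)
    (h.self_of_nhds (mvfderiv 𝓘(ℝ, E) (extChartAt 𝓘(ℝ, E) p) p v))⟩

lemma exists_global_chart (p : M) : ∃ χ : M → E, ContMDiff 𝓘(ℝ, E) 𝓘(ℝ, E) ∞ χ ∧
    ∀ᶠ q in 𝓝 p, χ q = extChartAt 𝓘(ℝ, E) p q :=
  exists_global_extension (by
    filter_upwards [(chartAt E p).open_source.mem_nhds (mem_chart_source E p)] with q hq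
    exact contMDiffAt_extChart hq)

lemma exists_function_mvfderiv_eq {p : M} (α : Cotangent E p) :
    ∃ f : M → ℝ, ContMDiff 𝓘(ℝ, E) 𝓘(ℝ) ∞ f ∧ mvfderiv 𝓘(ℝ, E) f p = α := by
  obtain ⟨χ, hχ, h⟩ := exists_global_chart (E := E) p
  have hinv := isInvertible_mfderiv_extChartAt (I := 𝓘(ℝ, E)) (x := p) (y := p) (by simp)
  obtain ⟨A, hA⟩ := hinv
  let L : E →L[ℝ] ℝ := α.comp A.symm.toContinuousLinearMap
  refine ⟨fun q => L (χ q), L.contMDiff.comp hχ, ?_⟩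
  ext v
  rw [mvfderiv_clm_comp L ((hχ p).mdifferentiableAt (by simp)), mvfderiv_congr h]
  have : mvfderiv 𝓘(ℝ, E) (extChartAt 𝓘(ℝ, E) p) p v = A v := by
    exact congrArg (fun B => B v) hA.symm
  rw [this]
  change α (A.symm (A v)) = α v
  rw [A.symm_apply_apply]

end Bump

lemma SmoothOneFormAt.apply {α : ∀ p : M, Cotangent E p} {X : VField E M} {p : M}
    (hα : SmoothOneFormAt α p) (hX : SmoothVFAt X p) :
    ContMDiffAt 𝓘(ℝ, E) 𝓘(ℝ) ∞ (fun q => α q (X q)) p := by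
  have h := ContMDiffAt.clm_bundle_apply (F₂ := ℝ) (E₂ := Bundle.Trivial M ℝ) hα hX
  exact (Bundle.contMDiffAt_totalSpace.1 h).2

variable [FiniteDimensional ℝ E] [T2Space M]

/-- The components of `α` in the trivialization at `p` are its values on the coordinate fields,
which extend to global ones. -/
lemma smoothOneFormAt_iff {α : ∀ p : M, Cotangent E p} {p : M} :
    SmoothOneFormAt α p ↔ ∀ Z : VField E M, SmoothVF E Z →
      ContMDiffAt 𝓘(ℝ, E) 𝓘(ℝ) ∞ (fun q => α q (Z q)) p := by
  refine ⟨fun h Z hZ => h.apply (hZ p), fun h => ?_⟩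
  obtain ⟨Z, hZ, hcoord⟩ := exists_coordinate_fields (E := E) p
  rw [SmoothOneFormAt, contMDiffAt_hom_bundle]
  refine ⟨contMDiffAt_id, ?_⟩
  let b := Module.finBasis ℝ E
  have hsum : ContMDiffAt 𝓘(ℝ, E) 𝓘(ℝ, E →L[ℝ] ℝ) ∞ (fun q => ∑ i, (α q (Z (b i) q)) •
      LinearMap.toContinuousLinearMap (b.coord i)) p :=
    ContMDiffAt.sum fun i _ => (h _ (hZ (b i))).smul contMDiffAt_const
  refine hsum.congr_of_eventuallyEq ?_
  filter_upwards [hcoord, (chartAt E p).open_source.mem_nhds (mem_chart_source E p)] with q hq hq'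
  refine ContinuousLinearMap.coe_injective (b.ext fun j => ?_)
  have h3 : ∀ v : E, (trivializationAt E (TangentSpace 𝓘(ℝ, E)) p).symmL ℝ q v = Z v q := by
    intro v
    refine mfderiv_extChartAt_injective hq' ?_
    rw [hq v]
    have := TangentBundle.continuousLinearMapAt_trivializationAt (I := 𝓘(ℝ, E)) hq'
    have h2 := (trivializationAt E (TangentSpace 𝓘(ℝ, E)) p).continuousLinearMapAt_symmL (R := ℝ)
      (b := q) (by simpa using hq') v
    rw [this] at h2
    exact h2
  have h4 : ContinuousLinearMap.inCoordinates E (TangentSpace 𝓘(ℝ, E)) ℝ (Bundle.Trivial M ℝ) p q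
      p q (α q) (b j) = α q (Z (b j) q) := by
    rw [ContinuousLinearMap.inCoordinates]
    simp [h3]
  refine h4.trans ?_
  simp [Finsupp.single_apply]

end Smoothness

end DiracReduction

namespace DiracReduction

/-! ### The commutator formula for the Lie bracket. -/

section Commutator

open Filter Topology

variable {E : Type*} [NormedAddCommGroup E] [NormedSpace ℝ E]
  {M : Type*} [TopologicalSpace M] [ChartedSpace E M]
  {F : Type*} [NormedAddCommGroup F] [NormedSpace ℝ F] [IsManifold 𝓘(ℝ, E) ∞ M]

lemma contMDiffAt_extChart_symm {p : M} {z : E} (hz : z ∈ (extChartAt 𝓘(ℝ, E) p).target) :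
    ContMDiffAt 𝓘(ℝ, E) 𝓘(ℝ, E) ∞ (extChartAt 𝓘(ℝ, E) p).symm z :=
  (contMDiffOn_extChartAt_symm p).contMDiffAt ((isOpen_extChartAt_target p).mem_nhds hz)

lemma fderiv_lieBracket {g : E → F} {V W : E → E} {z : E} (hg : ContDiffAt ℝ 2 g z)
    (hV : DifferentiableAt ℝ V z) (hW : DifferentiableAt ℝ W z) :
    fderiv ℝ g z (VectorField.lieBracket ℝ V W z)
      = fderiv ℝ (fun y => fderiv ℝ g y (W y)) z (V z)
        - fderiv ℝ (fun y => fderiv ℝ g y (V y)) z (W z) := by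
  have hd : DifferentiableAt ℝ (fderiv ℝ g) z :=
    (hg.fderiv_right (m := 1) (by norm_num)).differentiableAt (by simp)
  have hs : IsSymmSndFDerivAt ℝ g z := hg.isSymmSndFDerivAt (by simp)
  rw [fderiv_clm_apply hd hW, fderiv_clm_apply hd hV, VectorField.lieBracket]
  have := hs (V z) (W z)
  simp [this]

/-- The bracket on a manifold is that of the pull-backs by the inverse chart, and the inverse of the
differential of the inverse chart is the differential of the chart. -/
lemma mvfderiv_extChart_lieBr [CompleteSpace E] (X Y : VField E M) (p : M) :
    mvfderiv 𝓘(ℝ, E) (extChartAt 𝓘(ℝ, E) p) p (lieBr E X Y p)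
      = VectorField.lieBracket ℝ
        (fun z => mvfderiv 𝓘(ℝ, E) (extChartAt 𝓘(ℝ, E) p) ((extChartAt 𝓘(ℝ, E) p).symm z)
          (X ((extChartAt 𝓘(ℝ, E) p).symm z)))
        (fun z => mvfderiv 𝓘(ℝ, E) (extChartAt 𝓘(ℝ, E) p) ((extChartAt 𝓘(ℝ, E) p).symm z)
          (Y ((extChartAt 𝓘(ℝ, E) p).symm z))) (extChartAt 𝓘(ℝ, E) p p) := by
  have key : ∀ X : VField E M,
      VectorField.mpullbackWithin 𝓘(ℝ, E) 𝓘(ℝ, E) (extChartAt 𝓘(ℝ, E) p).symm X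
        (Set.range 𝓘(ℝ, E)) =ᶠ[𝓝 (extChartAt 𝓘(ℝ, E) p p)]
      (fun z => mvfderiv 𝓘(ℝ, E) (extChartAt 𝓘(ℝ, E) p) ((extChartAt 𝓘(ℝ, E) p).symm z)
          (X ((extChartAt 𝓘(ℝ, E) p).symm z))) := by
    intro X
    filter_upwards [extChartAt_target_mem_nhds (I := 𝓘(ℝ, E)) p] with z hz
    have h1 := mfderiv_extChartAt_comp_mfderivWithin_extChartAt_symm (I := 𝓘(ℝ, E)) hz
    have hinv := isInvertible_mfderivWithin_extChartAt_symm (I := 𝓘(ℝ, E)) hz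
    obtain ⟨A, hA⟩ := hinv
    rw [VectorField.mpullbackWithin_apply, ← hA, ContinuousLinearMap.inverse_equiv]
    have h2 := congrArg (fun L : E →L[ℝ] E => L (A.symm (X ((extChartAt 𝓘(ℝ, E) p).symm z)))) h1
    rw [← hA] at h2
    refine h2.symm.trans ?_
    change mvfderiv 𝓘(ℝ, E) (extChartAt 𝓘(ℝ, E) p) ((extChartAt 𝓘(ℝ, E) p).symm z)
      (A (A.symm (X ((extChartAt 𝓘(ℝ, E) p).symm z)))) = _
    rw [A.apply_symm_apply]
  obtain ⟨A, hA⟩ := isInvertible_mfderiv_extChartAt (I := 𝓘(ℝ, E)) (x := p) (y := p) (by simp)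
  rw [← (key X).lieBracket_vectorField_eq (key Y), lieBr, ← VectorField.mlieBracketWithin_univ,
    VectorField.mlieBracketWithin_apply, ← hA, ContinuousLinearMap.inverse_equiv]
  simp only [Set.preimage_univ, Set.univ_inter, modelWithCornersSelf_coe, Set.range_id]
  set w := VectorField.lieBracketWithin ℝ _ _ _ (extChartAt 𝓘(ℝ, E) p p) with hw
  have h3 := congrArg (fun L => L (A.symm w)) hA
  exact (h3.symm.trans (A.apply_symm_apply w)).trans
    (congrFun (VectorField.lieBracketWithin_univ (𝕜 := ℝ) (E := E)) _)

lemma contDiffAt_comp_extChart_symm {g : M → F} {p : M}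
    (hg : ContMDiffAt 𝓘(ℝ, E) 𝓘(ℝ, F) ∞ g p) :
    ContDiffAt ℝ ∞ (g ∘ (extChartAt 𝓘(ℝ, E) p).symm) (extChartAt 𝓘(ℝ, E) p p) := by
  rw [← contMDiffAt_iff_contDiffAt]
  exact ContMDiffAt.comp (extChartAt 𝓘(ℝ, E) p p) (by rwa [extChartAt_to_inv p])
    (contMDiffAt_extChart_symm (mem_extChartAt_target p))

lemma mvfderiv_comp_extChart {k : E → F} {p q : M} (hq : q ∈ (chartAt E p).source)
    (hk : DifferentiableAt ℝ k (extChartAt 𝓘(ℝ, E) p q)) (v : TangentSpace 𝓘(ℝ, E) q) :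
    mvfderiv 𝓘(ℝ, E) (k ∘ extChartAt 𝓘(ℝ, E) p) q v = fderiv ℝ k (extChartAt 𝓘(ℝ, E) p q)
      (mvfderiv 𝓘(ℝ, E) (extChartAt 𝓘(ℝ, E) p) q v) := by
  rw [mvfderiv_comp_apply' (E := E) (M := E) q hk.mdifferentiableAt
    ((contMDiffAt_extChart hq).mdifferentiableAt (by simp))]
  exact mvfderiv_vectorSpace _ _

/-- In the chart at `p` this is `fderiv_lieBracket`, that is, the symmetry of the second derivative.
Vector-valued `g` are allowed so that a chart can be inserted, which determines the bracket itself.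
-/
lemma mvfderiv_lieBr [CompleteSpace E] {X Y : VField E M} {p : M} (hX : SmoothVFAt X p)
    (hY : SmoothVFAt Y p)
    {g : M → F} (hg : ∀ᶠ q in 𝓝 p, ContMDiffAt 𝓘(ℝ, E) 𝓘(ℝ, F) ∞ g q) :
    mvfderiv 𝓘(ℝ, E) g p (lieBr E X Y p)
      = mvfderiv 𝓘(ℝ, E) (fun q => mvfderiv 𝓘(ℝ, E) g q (Y q)) p (X p)
        - mvfderiv 𝓘(ℝ, E) (fun q => mvfderiv 𝓘(ℝ, E) g q (X q)) p (Y p) := by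
  set φ := extChartAt 𝓘(ℝ, E) p with hφ
  set g' : E → F := g ∘ φ.symm with hg'
  have hsrc : ∀ᶠ q in 𝓝 p, q ∈ (chartAt E p).source :=
    (chartAt E p).open_source.mem_nhds (mem_chart_source E p)
  have hgp : ContDiffAt ℝ ∞ g' (φ p) := contDiffAt_comp_extChart_symm hg.self_of_nhds
  have hcont : ContinuousAt φ p := continuousAt_extChartAt p
  have hfac : g =ᶠ[𝓝 p] g' ∘ φ := by
    filter_upwards [hsrc] with q hq
    rw [hg', Function.comp_apply, Function.comp_apply,
      show φ.symm (φ q) = q from (extChartAt 𝓘(ℝ, E) p).left_inv (by simpa using hq)]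
  have hg'ev : ∀ᶠ q in 𝓝 p, DifferentiableAt ℝ g' (φ q) := by
    have : ∀ᶠ z in 𝓝 (φ p), ContDiffAt ℝ 2 g' z :=
      (hgp.of_le (m := 2) (WithTop.coe_le_coe.2 le_top)).eventually (by simp)
    filter_upwards [hcont.eventually this] with q hq
    exact hq.differentiableAt (by simp)
  have hZ : ∀ Z : VField E M,
      (fun q => mvfderiv 𝓘(ℝ, E) g q (Z q)) =ᶠ[𝓝 p]
      (fun z => fderiv ℝ g' z (mvfderiv 𝓘(ℝ, E) φ (φ.symm z) (Z (φ.symm z)))) ∘ φ := by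
    intro Z
    filter_upwards [hfac.eventually_nhds, hsrc, hg'ev] with q hq hq' hgq
    rw [mvfderiv_congr hq, mvfderiv_comp_extChart hq' hgq]
    simp only [Function.comp_apply]
    rw [show φ.symm (φ q) = q from (extChartAt 𝓘(ℝ, E) p).left_inv (by simpa using hq')]
  have hVd : ∀ Z : VField E M, SmoothVFAt Z p → DifferentiableAt ℝ
      (fun z => mvfderiv 𝓘(ℝ, E) φ (φ.symm z) (Z (φ.symm z))) (φ p) := by
    intro Z hZ
    exact (contDiffAt_comp_extChart_symm (smoothVFAt_iff.1 hZ)).differentiableAt (by simp)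
  have hd : DifferentiableAt ℝ (fderiv ℝ g') (φ p) :=
    (hgp.fderiv_right (m := 1) (WithTop.coe_le_coe.2 le_top)).differentiableAt (by simp)
  have hZ' : ∀ Z : VField E M, SmoothVFAt Z p → ∀ v : TangentSpace 𝓘(ℝ, E) p,
      mvfderiv 𝓘(ℝ, E) (fun q => mvfderiv 𝓘(ℝ, E) g q (Z q)) p v =
      fderiv ℝ (fun z => fderiv ℝ g' z (mvfderiv 𝓘(ℝ, E) φ (φ.symm z) (Z (φ.symm z)))) (φ p)
        (mvfderiv 𝓘(ℝ, E) φ p v) := by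
    intro Z hZs v
    rw [mvfderiv_congr (hZ Z), mvfderiv_comp_extChart (mem_chart_source E p) (hd.clm_apply (hVd Z hZs))]
  rw [hZ' Y hY, hZ' X hX, mvfderiv_congr hfac,
    mvfderiv_comp_extChart (mem_chart_source E p) (hgp.differentiableAt (by simp)), mvfderiv_extChart_lieBr,
    fderiv_lieBracket (hgp.of_le (m := 2) (WithTop.coe_le_coe.2 le_top)) (hVd X hX) (hVd Y hY)]
  rw [show (extChartAt 𝓘(ℝ, E) p).symm (extChartAt 𝓘(ℝ, E) p p) = p from extChartAt_to_inv p]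

end Commutator

end DiracReduction

namespace DiracReduction

/-! ### Local retractions of immersions and local sections of submersions. -/

section LocalInverses

open Filter Topology

variable {EN : Type*} [NormedAddCommGroup EN] [NormedSpace ℝ EN]
  {N : Type*} [TopologicalSpace N] [ChartedSpace EN N]
  {EC : Type*} [NormedAddCommGroup EC] [NormedSpace ℝ EC]
  {C : Type*} [TopologicalSpace C] [ChartedSpace EC C]

/-- In adapted charts an immersion is `u ↦ (u, 0)`; the retraction drops the second component. -/
lemma exists_local_retraction {j : C → N} {c : C}
    (hj : Manifold.IsImmersionAt 𝓘(ℝ, EC) 𝓘(ℝ, EN) ∞ j c) :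
    ∃ r : N → C, (∀ᶠ y in 𝓝 (j c), ContMDiffAt 𝓘(ℝ, EN) 𝓘(ℝ, EC) ∞ r y) ∧
      ∀ᶠ q in 𝓝 c, r (j q) = q := by
  have hdom := contMDiffOn_symm_of_mem_maximalAtlas hj.domChart_mem_maximalAtlas
  have hcod := contMDiffOn_of_mem_maximalAtlas hj.codChart_mem_maximalAtlas
  set g : EN → EC := fun z => (hj.equiv.symm z).1 with hg
  have hgs : ContDiff ℝ ∞ g := contDiff_fst.comp hj.equiv.symm.contDiff
  have hw : ∀ q ∈ hj.domChart.source, g (hj.codChart (j q)) = hj.domChart q := by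
    intro q hq
    have hq' : hj.domChart q ∈ (hj.domChart.extend 𝓘(ℝ, EC)).target := by
      simpa using hj.domChart.map_source hq
    have h := hj.writtenInCharts hq'
    simp only [OpenPartialHomeomorph.extend_coe, OpenPartialHomeomorph.extend_coe_symm,
      Function.comp_apply, modelWithCornersSelf_coe, modelWithCornersSelf_coe_symm, id_eq,
      hj.domChart.left_inv hq] at h
    rw [hg]
    simp only
    rw [h, hj.equiv.symm_apply_apply]
  refine ⟨fun y => hj.domChart.symm (g (hj.codChart y)), ?_, ?_⟩
  · have hcont : ContinuousAt (fun y => g (hj.codChart y)) (j c) :=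
      hgs.continuous.continuousAt.comp (hj.codChart.continuousAt hj.mem_codChart_source)
    have h1 : ∀ᶠ y in 𝓝 (j c), g (hj.codChart y) ∈ hj.domChart.target :=
      hcont (by
        change _ ∈ 𝓝 (g (hj.codChart (j c)))
        rw [hw c hj.mem_domChart_source]
        exact hj.domChart.open_target.mem_nhds (hj.domChart.map_source hj.mem_domChart_source))
    filter_upwards [h1, hj.codChart.open_source.mem_nhds hj.mem_codChart_source] with y hy hy'
    have h2 : ContMDiffAt 𝓘(ℝ, EN) 𝓘(ℝ, EC) ∞ (fun y => g (hj.codChart y)) y :=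
      hgs.contMDiff.contMDiffAt.comp y (hcod.contMDiffAt (hj.codChart.open_source.mem_nhds hy'))
    exact (hdom.contMDiffAt (hj.domChart.open_target.mem_nhds hy)).comp y h2
  · filter_upwards [hj.domChart.open_source.mem_nhds hj.mem_domChart_source] with q hq
    rw [hw q hq, hj.domChart.left_inv hq]

/-- In adapted charts a submersion is `(u, k) ↦ u`; freezing `k` at its value at `c` gives the
section through `c`. -/
lemma exists_local_section {p : C → N} {c : C}
    (hp : Manifold.IsSubmersionAt 𝓘(ℝ, EC) 𝓘(ℝ, EN) ∞ p c) :
    ∃ s : N → C, (∀ᶠ y in 𝓝 (p c), ContMDiffAt 𝓘(ℝ, EN) 𝓘(ℝ, EC) ∞ s y) ∧ s (p c) = c ∧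
      ∀ᶠ y in 𝓝 (p c), p (s y) = y := by
  have hdom := contMDiffOn_symm_of_mem_maximalAtlas hp.domChart_mem_maximalAtlas
  have hcod := contMDiffOn_of_mem_maximalAtlas hp.codChart_mem_maximalAtlas
  have hw : ∀ z ∈ hp.domChart.target,
      hp.codChart (p (hp.domChart.symm z)) = (hp.equiv z).1 := by
    intro z hz
    have hz' : z ∈ (hp.domChart.extend 𝓘(ℝ, EC)).target := by simpa using hz
    have h := hp.writtenInCharts hz'
    simpa only [OpenPartialHomeomorph.extend_coe, OpenPartialHomeomorph.extend_coe_symm,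
      Function.comp_apply, modelWithCornersSelf_coe, modelWithCornersSelf_coe_symm, id_eq] using h
  set k := (hp.equiv (hp.domChart c)).2 with hk
  set g : EN → EC := fun z => hp.equiv.symm (z, k) with hg
  have hgs : ContDiff ℝ ∞ g := hp.equiv.symm.contDiff.comp (contDiff_id.prodMk contDiff_const)
  have hgc : g (hp.codChart (p c)) = hp.domChart c := by
    have h := hw _ (hp.domChart.map_source hp.mem_domChart_source)
    rw [hp.domChart.left_inv hp.mem_domChart_source] at h
    simp [hg, h, hk]
  have h1 : ∀ᶠ y in 𝓝 (p c), g (hp.codChart y) ∈ hp.domChart.target := by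
    have hcont : ContinuousAt (fun y => g (hp.codChart y)) (p c) :=
      hgs.continuous.continuousAt.comp (hp.codChart.continuousAt hp.mem_codChart_source)
    refine hcont ?_
    change _ ∈ 𝓝 (g (hp.codChart (p c)))
    rw [hgc]
    exact hp.domChart.open_target.mem_nhds (hp.domChart.map_source hp.mem_domChart_source)
  refine ⟨fun y => hp.domChart.symm (g (hp.codChart y)), ?_, ?_, ?_⟩
  · filter_upwards [h1, hp.codChart.open_source.mem_nhds hp.mem_codChart_source] with y hy hy'
    have h2 : ContMDiffAt 𝓘(ℝ, EN) 𝓘(ℝ, EC) ∞ (fun y => g (hp.codChart y)) y :=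
      hgs.contMDiff.contMDiffAt.comp y (hcod.contMDiffAt (hp.codChart.open_source.mem_nhds hy'))
    exact (hdom.contMDiffAt (hp.domChart.open_target.mem_nhds hy)).comp y h2
  · simp only
    rw [hgc, hp.domChart.left_inv hp.mem_domChart_source]
  · filter_upwards [h1, hp.codChart.open_source.mem_nhds hp.mem_codChart_source] with y hy hy'
    have h2 := hw _ hy
    have h3 : p (hp.domChart.symm (g (hp.codChart y))) ∈ hp.codChart.source :=
      hp.source_subset_preimage_source (hp.domChart.map_target hy)
    refine hp.codChart.injOn h3 hy' ?_
    rw [h2]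
    simp [hg]

end LocalInverses

/-! ### Smooth linear systems of constant rank. -/

section Lift

open Filter Topology

variable {E : Type*} [NormedAddCommGroup E] [NormedSpace ℝ E]
  {M : Type*} [TopologicalSpace M] [ChartedSpace E M]
  {F : Type*} [NormedAddCommGroup F] [NormedSpace ℝ F] [FiniteDimensional ℝ F]
  [FiniteDimensional ℝ E] [IsManifold 𝓘(ℝ, E) ∞ M] [T2Space M]

/-- A smooth system of linear equations of constant rank which is solvable at each point has
local smooth solutions with a prescribed value at one point. -/
lemma exists_global_lift {ι : Type*} [Fintype ι] {a : ι → M → F} {b : M → F} {p : M} {r : ℕ}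
    (ha : ∀ i, ∀ᶠ q in 𝓝 p, ContMDiffAt 𝓘(ℝ, E) 𝓘(ℝ, F) ∞ (a i) q)
    (hb : ∀ᶠ q in 𝓝 p, ContMDiffAt 𝓘(ℝ, E) 𝓘(ℝ, F) ∞ b q)
    (hr : ∀ᶠ q in 𝓝 p, Module.finrank ℝ (Submodule.span ℝ (Set.range fun i => a i q)) = r)
    (hm : ∀ᶠ q in 𝓝 p, b q ∈ Submodule.span ℝ (Set.range fun i => a i q))
    {u₀ : ι → ℝ} (hu₀ : ∑ i, u₀ i • a i p = b p) :
    ∃ u : ι → M → ℝ, (∀ i, ContMDiff 𝓘(ℝ, E) 𝓘(ℝ) ∞ (u i)) ∧ (∀ i, u i p = u₀ i) ∧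
      ∀ᶠ q in 𝓝 p, ∑ i, u i q • a i q = b q := by
  classical
  let A : M → (ι → ℝ) →L[ℝ] F := fun q =>
    ∑ i, (ContinuousLinearMap.proj i : (ι → ℝ) →L[ℝ] ℝ).smulRight (a i q)
  have hA : ∀ q v, A q v = ∑ i, v i • a i q := by
    intro q v
    simp [A]
  have hAs : ∀ᶠ q in 𝓝 p, ContMDiffAt 𝓘(ℝ, E) 𝓘(ℝ, (ι → ℝ) →L[ℝ] F) ∞ A q := by
    filter_upwards [eventually_all.2 ha] with q hq
    refine ContMDiffAt.sum fun i _ => ?_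
    have hl : ContDiff ℝ ∞ (fun f : F =>
        (ContinuousLinearMap.proj i : (ι → ℝ) →L[ℝ] ℝ).smulRight f) :=
      (ContinuousLinearMap.smulRightL ℝ (ι → ℝ) F (ContinuousLinearMap.proj i)).contDiff
    exact hl.contMDiff.contMDiffAt.comp q (hq i)
  have hrange : ∀ q, LinearMap.range (A q : (ι → ℝ) →ₗ[ℝ] F)
      = Submodule.span ℝ (Set.range fun i => a i q) := by
    intro q
    ext y
    rw [Submodule.mem_span_range_iff_exists_fun]
    simp only [LinearMap.mem_range, ContinuousLinearMap.coe_coe, hA]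
  simp only [← hrange] at hm
  -- On a complement `W` of `ker (A p)` the maps `A q` stay injective near `p`, and constant rank
  -- makes `A q` of `W` the whole range. Solutions are unique in `W`, hence smooth.
  obtain ⟨W, hW⟩ := (LinearMap.ker (A p : (ι → ℝ) →ₗ[ℝ] F)).exists_isCompl
  have hinj : LinearMap.ker ((A p : (ι → ℝ) →ₗ[ℝ] F).comp W.subtype) = ⊥ := by
    rw [eq_bot_iff]
    rintro ⟨w, hw⟩ h
    have : w ∈ LinearMap.ker (A p : (ι → ℝ) →ₗ[ℝ] F) ⊓ W := ⟨h, hw⟩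
    rw [hW.inf_eq_bot] at this
    simpa using this
  obtain ⟨P, hP⟩ := LinearMap.exists_leftInverse_of_injective _ hinj
  have hWr : Module.finrank ℝ W = r := by
    rw [← hr.self_of_nhds, ← hrange]
    have h1 := LinearMap.finrank_range_add_finrank_ker (A p : (ι → ℝ) →ₗ[ℝ] F)
    have h2 := Submodule.finrank_add_eq_of_isCompl hW
    omega
  let P' : F →L[ℝ] W := LinearMap.toContinuousLinearMap P
  let T : M → W →L[ℝ] W := fun q => P'.comp ((A q).comp W.subtypeL)
  have hT : ∀ q, ContMDiffAt 𝓘(ℝ, E) 𝓘(ℝ, (ι → ℝ) →L[ℝ] F) ∞ A q →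
      ContMDiffAt 𝓘(ℝ, E) 𝓘(ℝ, W →L[ℝ] W) ∞ T q := fun q hq =>
    contMDiffAt_const.clm_comp (hq.clm_comp contMDiffAt_const)
  have hTp : T p = (ContinuousLinearEquiv.refl ℝ W : W →L[ℝ] W) := by
    refine ContinuousLinearMap.ext fun w => ?_
    exact LinearMap.congr_fun hP w
  have hTev : ∀ᶠ q in 𝓝 p, (T q).IsInvertible := by
    have : ∀ᶠ S in 𝓝 (T p), ContinuousLinearMap.IsInvertible S := by
      rw [hTp]
      exact ContinuousLinearEquiv.nhds _
    exact (hT p hAs.self_of_nhds).continuousAt.eventually this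
  -- Only the correction to the constant `u₀` is sought in `W`; it vanishes at `p`, which secures
  -- the prescribed value there.
  let B : M → F := fun q => b q - A q u₀
  let w : M → W := fun q => (T q).inverse (P' (B q))
  have hw : ∀ᶠ q in 𝓝 p, ContMDiffAt 𝓘(ℝ, E) 𝓘(ℝ, W) ∞ w q := by
    filter_upwards [hAs, hb, hTev] with q hq hbq hTq
    have hTinv : ContMDiffAt 𝓘(ℝ, E) 𝓘(ℝ, W →L[ℝ] W) ∞ (fun q => (T q).inverse) q :=
      (hTq.contDiffAt_map_inverse (n := ∞)).contMDiffAt.comp q (hT q hq)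
    have hB : ContMDiffAt 𝓘(ℝ, E) 𝓘(ℝ, F) ∞ B q := hbq.sub (hq.clm_apply contMDiffAt_const)
    exact hTinv.clm_apply (contMDiffAt_const.clm_apply hB)
  have hBp : B p = 0 := by simp [B, hA, hu₀]
  have hu : ∀ i, ∀ᶠ q in 𝓝 p,
      ContMDiffAt 𝓘(ℝ, E) 𝓘(ℝ) ∞ (fun q => u₀ i + (w q : ι → ℝ) i) q := by
    intro i
    filter_upwards [hw] with q hq
    have h := (((ContinuousLinearMap.proj i : (ι → ℝ) →L[ℝ] ℝ).comp W.subtypeL).contMDiff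
      (n := ∞)).contMDiffAt.comp q hq
    exact contMDiffAt_const.add h
  choose u hus huw using fun i => exists_global_extension (hu i)
  refine ⟨u, hus, fun i => ?_, ?_⟩
  · rw [(huw i).self_of_nhds]
    simp [w, hBp]
  · filter_upwards [hr, hm, hTev, eventually_all.2 huw] with q hq1 hq2 hq3 hq4
    obtain ⟨S, hS⟩ := hq3
    have hinjq : Function.Injective ((A q : (ι → ℝ) →ₗ[ℝ] F).comp W.subtype) := by
      intro w₁ w₂ h
      refine S.injective ?_
      change (S : W →L[ℝ] W) w₁ = (S : W →L[ℝ] W) w₂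
      rw [hS]
      exact congrArg P' h
    have heq : LinearMap.range ((A q : (ι → ℝ) →ₗ[ℝ] F).comp W.subtype)
        = LinearMap.range (A q : (ι → ℝ) →ₗ[ℝ] F) := by
      refine Submodule.eq_of_le_of_finrank_eq (LinearMap.range_comp_le_range _ _) ?_
      rw [LinearMap.finrank_range_of_inj hinjq, hWr, hrange, hq1]
    have hBq : B q ∈ LinearMap.range ((A q : (ι → ℝ) →ₗ[ℝ] F).comp W.subtype) := by
      rw [heq]
      exact Submodule.sub_mem _ hq2 ⟨u₀, rfl⟩
    obtain ⟨w', hw'⟩ := hBq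
    have hww : w q = w' := by
      change (T q).inverse (P' (B q)) = w'
      rw [← hw', ← hS, ContinuousLinearMap.inverse_equiv]
      have : P' (((A q : (ι → ℝ) →ₗ[ℝ] F).comp W.subtype) w') = S w' := by
        change T q w' = (S : W →L[ℝ] W) w'
        rw [hS]
      rw [this]
      exact S.symm_apply_apply w'
    have h5 : A q (w' : ι → ℝ) = b q - A q u₀ := hw'
    rw [hA, hA] at h5
    simp only [hq4, hww, add_smul, Finset.sum_add_distrib, h5]
    abel

end Lift

end DiracReduction

namespace DiracReduction

/-! ### Related vector fields. -/

section Related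

open Filter Topology

variable {EN : Type*} [NormedAddCommGroup EN] [NormedSpace ℝ EN]
  {N : Type*} [TopologicalSpace N] [ChartedSpace EN N] [IsManifold 𝓘(ℝ, EN) ∞ N]
  {EC : Type*} [NormedAddCommGroup EC] [NormedSpace ℝ EC]
  {C : Type*} [TopologicalSpace C] [ChartedSpace EC C] [IsManifold 𝓘(ℝ, EC) ∞ C]
  {F : Type*} [NormedAddCommGroup F] [NormedSpace ℝ F]

/-- Both sides are compared through the chart at `j c`: the commutator formula is applied upstairs
to `χ` and downstairs to `χ ∘ j`, whose derivatives along related fields correspond. -/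
lemma mfderiv_lieBr_of_related [CompleteSpace EN] [CompleteSpace EC] {j : C → N}
    (hj : ContMDiff 𝓘(ℝ, EC) 𝓘(ℝ, EN) ∞ j) {c : C} {X' Y' : VField EC C} {X Y : VField EN N}
    (hX' : SmoothVFAt X' c) (hY' : SmoothVFAt Y' c) (hX : SmoothVFAt X (j c))
    (hY : SmoothVFAt Y (j c))
    (hXX' : ∀ᶠ q in 𝓝 c, mfderiv 𝓘(ℝ, EC) 𝓘(ℝ, EN) j q (X' q) = X (j q))
    (hYY' : ∀ᶠ q in 𝓝 c, mfderiv 𝓘(ℝ, EC) 𝓘(ℝ, EN) j q (Y' q) = Y (j q)) :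
    mfderiv 𝓘(ℝ, EC) 𝓘(ℝ, EN) j c (lieBr EC X' Y' c) = lieBr EN X Y (j c) := by
  refine mfderiv_extChartAt_injective (mem_chart_source EN (j c)) ?_
  set χ := extChartAt 𝓘(ℝ, EN) (j c) with hχ
  have hsrc : ∀ᶠ y in 𝓝 (j c), y ∈ (chartAt EN (j c)).source :=
    (chartAt EN (j c)).open_source.mem_nhds (mem_chart_source EN (j c))
  have hχs : ∀ᶠ y in 𝓝 (j c), ContMDiffAt 𝓘(ℝ, EN) 𝓘(ℝ, EN) ∞ χ y := by
    filter_upwards [hsrc] with y hy using contMDiffAt_extChart hy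
  have hjd : ∀ q, MDifferentiableAt 𝓘(ℝ, EC) 𝓘(ℝ, EN) j q := fun q =>
    (hj q).mdifferentiableAt (by simp)
  have hχj : ∀ᶠ q in 𝓝 c, ContMDiffAt 𝓘(ℝ, EC) 𝓘(ℝ, EN) ∞ (χ ∘ j) q := by
    filter_upwards [(hj c).continuousAt.eventually hχs] with q hq using hq.comp q (hj q)
  have hder : ∀ {Z' : VField EC C} {Z : VField EN N},
      (∀ᶠ q in 𝓝 c, mfderiv 𝓘(ℝ, EC) 𝓘(ℝ, EN) j q (Z' q) = Z (j q)) → ∀ᶠ q in 𝓝 c,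
      mvfderiv 𝓘(ℝ, EC) (χ ∘ j) q (Z' q) = ((fun y => mvfderiv 𝓘(ℝ, EN) χ y (Z y)) ∘ j) q := by
    intro Z' Z hZ
    filter_upwards [hZ, (hj c).continuousAt.eventually hχs] with q hq hq'
    rw [mvfderiv_comp_apply' q (hq'.mdifferentiableAt (by simp)) (hjd q), hq]
    rfl
  rw [← mvfderiv_comp_apply' c (hχs.self_of_nhds.mdifferentiableAt (by simp)) (hjd c),
    mvfderiv_lieBr hX' hY' hχj, mvfderiv_lieBr hX hY hχs, mvfderiv_congr (hder hXX'),
    mvfderiv_congr (hder hYY'),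
    mvfderiv_comp_apply' c ((hY.mvfderiv_apply hχs.self_of_nhds).mdifferentiableAt (by simp))
      (hjd c),
    mvfderiv_comp_apply' c ((hX.mvfderiv_apply hχs.self_of_nhds).mdifferentiableAt (by simp))
      (hjd c), hXX'.self_of_nhds, hYY'.self_of_nhds]

/-- A vector field on an immersed manifold is smooth if it is related to a smooth one. -/
lemma smoothVFAt_of_related {j : C → N} (hj : ContMDiff 𝓘(ℝ, EC) 𝓘(ℝ, EN) ∞ j) {c : C}
    (hc : Manifold.IsImmersionAt 𝓘(ℝ, EC) 𝓘(ℝ, EN) ∞ j c) {X' : VField EC C} {X : VField EN N}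
    (hX : SmoothVFAt X (j c))
    (hXX' : ∀ᶠ q in 𝓝 c, mfderiv 𝓘(ℝ, EC) 𝓘(ℝ, EN) j q (X' q) = X (j q)) :
    SmoothVFAt X' c := by
  obtain ⟨r, hr, hrj⟩ := exists_local_retraction hc
  rw [smoothVFAt_iff]
  set χ := extChartAt 𝓘(ℝ, EC) c with hχ
  have hrc : r (j c) = c := hrj.self_of_nhds
  -- `χ ∘ r` extends the chart of `C` to `N`, so the coordinate expression of `X'` is the
  -- restriction of the derivative of `χ ∘ r` along `X`.
  have hχr : ∀ᶠ y in 𝓝 (j c), ContMDiffAt 𝓘(ℝ, EN) 𝓘(ℝ, EC) ∞ (χ ∘ r) y := by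
    have h1 : ∀ᶠ y in 𝓝 (j c), r y ∈ (chartAt EC c).source :=
      hr.self_of_nhds.continuousAt.eventually
        ((chartAt EC c).open_source.mem_nhds (by rw [hrc]; exact mem_chart_source EC c))
    filter_upwards [h1, hr] with y hy hy'
    exact (contMDiffAt_extChart hy).comp y hy'
  refine ((hX.mvfderiv_apply hχr.self_of_nhds).comp c (hj c)).congr_of_eventuallyEq ?_
  filter_upwards [hXX', (hj c).continuousAt.eventually hχr, hrj.eventually_nhds] with q hq hq' hq''
  rw [Function.comp_apply, ← hq,
    ← mvfderiv_comp_apply' q (hq'.mdifferentiableAt (by simp)) ((hj q).mdifferentiableAt (by simp))]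
  refine mvfderiv_congr ?_ _
  filter_upwards [hq''] with y hy
  simp [hy]

omit [IsManifold 𝓘(ℝ, EN) ∞ N] in
lemma injective_mfderiv_of_leftInverse {j : C → N} {r : N → C} {c : C}
    (hj : MDifferentiableAt 𝓘(ℝ, EC) 𝓘(ℝ, EN) j c)
    (hr : MDifferentiableAt 𝓘(ℝ, EN) 𝓘(ℝ, EC) r (j c)) (hrj : ∀ᶠ q in 𝓝 c, r (j q) = q) :
    Function.Injective (mfderiv 𝓘(ℝ, EC) 𝓘(ℝ, EN) j c) := by
  rw [injective_iff_map_eq_zero]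
  intro v hv
  refine mfderiv_extChartAt_injective (mem_chart_source EC c) ?_
  have hrc : r (j c) = c := hrj.self_of_nhds
  have hχr : MDifferentiableAt 𝓘(ℝ, EN) 𝓘(ℝ, EC) (extChartAt 𝓘(ℝ, EC) c ∘ r) (j c) :=
    ((contMDiffAt_extChart (by rw [hrc]; exact mem_chart_source EC c)).mdifferentiableAt
      (by simp)).comp _ hr
  have h := mvfderiv_comp_apply' c hχr hj v
  rw [hv, map_zero] at h
  rw [map_zero, ← h]
  refine mvfderiv_congr ?_ _
  filter_upwards [hrj] with y hy
  simp [hy]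

omit [IsManifold 𝓘(ℝ, EN) ∞ N] in
lemma injective_mfderiv_of_immersion {j : C → N} {c : C}
    (hc : Manifold.IsImmersionAt 𝓘(ℝ, EC) 𝓘(ℝ, EN) ∞ j c) :
    Function.Injective (mfderiv 𝓘(ℝ, EC) 𝓘(ℝ, EN) j c) := by
  obtain ⟨r, hr, hrj⟩ := exists_local_retraction hc
  exact injective_mfderiv_of_leftInverse (hc.contMDiffAt.mdifferentiableAt (by simp))
    (hr.self_of_nhds.mdifferentiableAt (by simp)) hrj

omit [IsManifold 𝓘(ℝ, EC) ∞ C] in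
lemma exists_extension_of_immersion [FiniteDimensional ℝ EN] [T2Space N] {j : C → N} {c : C}
    (hc : Manifold.IsImmersionAt 𝓘(ℝ, EC) 𝓘(ℝ, EN) ∞ j c) {u : C → F}
    (hu : ContMDiff 𝓘(ℝ, EC) 𝓘(ℝ, F) ∞ u) :
    ∃ u' : N → F, ContMDiff 𝓘(ℝ, EN) 𝓘(ℝ, F) ∞ u' ∧ ∀ᶠ q in 𝓝 c, u' (j q) = u q := by
  obtain ⟨r, hr, hrj⟩ := exists_local_retraction hc
  obtain ⟨u', hu', h⟩ := exists_global_extension (g := u ∘ r) (p := j c) (by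
    filter_upwards [hr] with y hy
    exact (hu _).comp y hy)
  refine ⟨u', hu', ?_⟩
  filter_upwards [hc.contMDiffAt.continuousAt.eventually h, hrj] with q hq hq'
  simp [hq, hq']

end Related

/-! ### Tangent spaces of regular fibres. -/

section Fibre

open Filter Topology

lemma eventuallyEq_comp_extChart {E : Type*} [NormedAddCommGroup E] [NormedSpace ℝ E]
    {M : Type*} [TopologicalSpace M] [ChartedSpace E M] (p : M) {G : Type*} (k : M → G) :
    k =ᶠ[𝓝 p] (k ∘ (extChartAt 𝓘(ℝ, E) p).symm) ∘ extChartAt 𝓘(ℝ, E) p := by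
  filter_upwards [extChartAt_source_mem_nhds (I := 𝓘(ℝ, E)) p] with q hq
  rw [Function.comp_apply, Function.comp_apply, (extChartAt 𝓘(ℝ, E) p).left_inv hq]

variable {EN : Type*} [NormedAddCommGroup EN] [NormedSpace ℝ EN] [FiniteDimensional ℝ EN]
  {N : Type*} [TopologicalSpace N] [ChartedSpace EN N] [IsManifold 𝓘(ℝ, EN) ∞ N]
  {EC : Type*} [NormedAddCommGroup EC] [NormedSpace ℝ EC]
  {C : Type*} [TopologicalSpace C] [ChartedSpace EC C] [IsManifold 𝓘(ℝ, EC) ∞ C]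
  {EM : Type*} [NormedAddCommGroup EM] [NormedSpace ℝ EM] [FiniteDimensional ℝ EM]
  {M : Type*} [TopologicalSpace M] [ChartedSpace EM M] [IsManifold 𝓘(ℝ, EM) ∞ M]

omit [IsManifold 𝓘(ℝ, EC) ∞ C] in
/-- The tangent space of a regular fibre is the kernel of the differential. -/
lemma exists_mfderiv_eq_of_ker {j : C → N} {c : C} {J : N → M}
    (hJ : ContMDiff 𝓘(ℝ, EN) 𝓘(ℝ, EM) ∞ J)
    (hc : Manifold.IsImmersionAt 𝓘(ℝ, EC) 𝓘(ℝ, EN) ∞ j c) (hind : Topology.IsInducing j)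
    (hrange : ∀ y, J y = J (j c) → y ∈ Set.range j)
    (hsurj : Function.Surjective (mfderiv 𝓘(ℝ, EN) 𝓘(ℝ, EM) J (j c)))
    {v : TangentSpace 𝓘(ℝ, EN) (j c)} (hv : mfderiv 𝓘(ℝ, EN) 𝓘(ℝ, EM) J (j c) v = 0) :
    ∃ w, mfderiv 𝓘(ℝ, EC) 𝓘(ℝ, EN) j c w = v := by
  have := FiniteDimensional.complete ℝ EN
  have := FiniteDimensional.complete ℝ EM
  obtain ⟨r, hr, hrj⟩ := exists_local_retraction hc
  have hrc : r (j c) = c := hrj.self_of_nhds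
  set φ := extChartAt 𝓘(ℝ, EN) (j c) with hφ
  set ψ := extChartAt 𝓘(ℝ, EM) (J (j c)) with hψ
  have hψJ : ContMDiffAt 𝓘(ℝ, EN) 𝓘(ℝ, EM) ∞ (ψ ∘ J) (j c) :=
    (contMDiffAt_extChart (mem_chart_source EM _)).comp _ (hJ _)
  set f : EN → EM := (ψ ∘ J) ∘ φ.symm with hf
  have hfs : ContDiffAt ℝ ∞ f (φ (j c)) := contDiffAt_comp_extChart_symm hψJ
  have hstrict : HasStrictFDerivAt f (fderiv ℝ f (φ (j c))) (φ (j c)) :=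
    hfs.hasStrictFDerivAt (by simp)
  have hfd : ∀ w : TangentSpace 𝓘(ℝ, EN) (j c), fderiv ℝ f (φ (j c)) (mvfderiv 𝓘(ℝ, EN) φ (j c) w)
      = mvfderiv 𝓘(ℝ, EM) ψ (J (j c)) (mfderiv 𝓘(ℝ, EN) 𝓘(ℝ, EM) J (j c) w) := by
    intro w
    rw [← mvfderiv_comp_extChart (mem_chart_source EN (j c)) (hfs.differentiableAt (by simp)),
      ← mvfderiv_congr (eventuallyEq_comp_extChart (j c) (ψ ∘ J)), mvfderiv_comp_apply' (j c)
      ((contMDiffAt_extChart (mem_chart_source EM _)).mdifferentiableAt (by simp))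
      ((hJ _).mdifferentiableAt (by simp))]
  have hfsurj : (fderiv ℝ f (φ (j c))).range = ⊤ := by
    rw [LinearMap.range_eq_top]
    intro e
    have hb := (isInvertible_mfderiv_extChartAt (I := 𝓘(ℝ, EM)) (x := J (j c)) (y := J (j c))
      (by simp)).bijective.surjective
    obtain ⟨e', he'⟩ := hb e
    obtain ⟨w, hw⟩ := hsurj e'
    refine ⟨mvfderiv 𝓘(ℝ, EN) φ (j c) w, ?_⟩
    rw [ContinuousLinearMap.coe_coe, hfd, hw]
    exact he'
  set v' : (fderiv ℝ f (φ (j c))).ker := ⟨mvfderiv 𝓘(ℝ, EN) φ (j c) v, by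
    rw [LinearMap.mem_ker, ContinuousLinearMap.coe_coe, hfd, hv, map_zero]⟩ with hv'
  -- A curve in the level set of `J`, written in the chart, whose velocity at 0 is the image of `v`.
  set g : ℝ → EN := fun t =>
    hstrict.implicitFunction f (fderiv ℝ f (φ (j c))) hfsurj (f (φ (j c))) (t • v') with hg
  have hg0 : g 0 = φ (j c) := by
    rw [hg]
    simp only [zero_smul]
    exact hstrict.implicitFunction_apply_image hfsurj
  have hgd : HasDerivAt g (mvfderiv 𝓘(ℝ, EN) φ (j c) v) 0 := by
    have h1 : HasDerivAt (fun t : ℝ => t • v') v' 0 := by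
      simpa using (hasDerivAt_id (0 : ℝ)).smul_const v'
    have h2 := (hstrict.to_implicitFunction hfsurj).hasFDerivAt
    rw [show (0 : (fderiv ℝ f (φ (j c))).ker) = (0 : ℝ) • v' by simp] at h2
    exact h2.comp_hasDerivAt (0 : ℝ) h1
  have hgt : Tendsto g (𝓝 0) (𝓝 (φ (j c))) := by
    have := hgd.continuousAt.tendsto
    rwa [hg0] at this
  have hgf : ∀ᶠ t in 𝓝 (0 : ℝ), f (g t) = f (φ (j c)) := by
    have h1 : Tendsto (fun t : ℝ => (f (φ (j c)), t • v')) (𝓝 0)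
        (𝓝 (f (φ (j c)), (0 : (fderiv ℝ f (φ (j c))).ker))) := by
      refine Tendsto.prodMk_nhds tendsto_const_nhds ?_
      have : Continuous fun t : ℝ => t • v' := by fun_prop
      simpa using this.tendsto 0
    exact h1.eventually (hstrict.map_implicitFunction_eq hfsurj)
  have hφc : φ.symm (φ (j c)) = j c := extChartAt_to_inv (j c)
  have hyt : Tendsto (fun t => φ.symm (g t)) (𝓝 0) (𝓝 (j c)) := by
    have h1 : ContinuousAt φ.symm (φ (j c)) := continuousAt_extChartAt_symm (j c)
    have := h1.tendsto.comp hgt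
    rwa [hφc] at this
  have hyJ : ∀ᶠ t in 𝓝 (0 : ℝ), J (φ.symm (g t)) = J (j c) := by
    have h1 : ∀ᶠ y in 𝓝 (j c), J y ∈ ψ.source :=
      (hJ (j c)).continuousAt.eventually (extChartAt_source_mem_nhds (I := 𝓘(ℝ, EM)) (J (j c)))
    filter_upwards [hgf, hyt.eventually h1] with t ht ht'
    refine ψ.injOn ht' (mem_extChartAt_source (I := 𝓘(ℝ, EM)) (J (j c))) ?_
    rw [hf] at ht
    simpa only [Function.comp_apply, hφc] using ht
  -- `k` lifts the curve to `C` as a map of sets, with `c` as a default value off the level set. Its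
  -- continuity at 0 comes from `j` being inducing.
  obtain ⟨k, hk⟩ : ∃ k : ℝ → C, ∀ᶠ t in 𝓝 (0 : ℝ), j (k t) = φ.symm (g t) := by
    have : ∀ t, ∃ k : C, J (φ.symm (g t)) = J (j c) → j k = φ.symm (g t) := by
      intro t
      by_cases h : J (φ.symm (g t)) = J (j c)
      · obtain ⟨k, hk⟩ := hrange _ h
        exact ⟨k, fun _ => hk⟩
      · exact ⟨c, fun h' => absurd h' h⟩
    choose k hk using this
    exact ⟨k, hyJ.mono fun t ht => hk t ht⟩
  have hkt : Tendsto k (𝓝 0) (𝓝 c) := by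
    rw [hind.tendsto_nhds_iff]
    exact hyt.congr' (hk.mono fun t ht => ht.symm)
  have hφj : ContMDiffAt 𝓘(ℝ, EC) 𝓘(ℝ, EN) ∞ (φ ∘ j) c :=
    (contMDiffAt_extChart (mem_chart_source EN (j c))).comp c hc.contMDiffAt
  -- `G` is `j ∘ r` in the chart. It fixes the points of `g` near time 0, so its derivative fixes
  -- the velocity of `g`, which is thus in the image of the differential of `j`.
  set G : EN → EN := (φ ∘ j ∘ r) ∘ φ.symm with hG
  have hGs : ContDiffAt ℝ ∞ G (φ (j c)) := by
    refine contDiffAt_comp_extChart_symm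
      (ContMDiffAt.comp (g := φ ∘ j) (j c) ?_ hr.self_of_nhds)
    rw [hrc]
    exact hφj
  have hGg : G ∘ g =ᶠ[𝓝 0] g := by
    filter_upwards [hk, hkt.eventually hrj,
      hgt.eventually (extChartAt_target_mem_nhds (I := 𝓘(ℝ, EN)) (j c))] with t h1 h2 h3
    simp only [hG, Function.comp_apply]
    rw [← h1, h2, h1]
    exact φ.right_inv h3
  have hGv : fderiv ℝ G (φ (j c)) (mvfderiv 𝓘(ℝ, EN) φ (j c) v) = mvfderiv 𝓘(ℝ, EN) φ (j c) v := by
    have h1 : HasFDerivAt G (fderiv ℝ G (φ (j c))) (g 0) := by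
      rw [hg0]
      exact (hGs.differentiableAt (by simp)).hasFDerivAt
    exact ((h1.comp_hasDerivAt (0 : ℝ) hgd).congr_of_eventuallyEq hGg.symm).unique hgd
  rw [← mvfderiv_comp_extChart (mem_chart_source EN (j c)) (hGs.differentiableAt (by simp)),
    hG, ← mvfderiv_congr (eventuallyEq_comp_extChart (j c) (φ ∘ j ∘ r)),
    ← Function.comp_assoc] at hGv
  have key : ∀ c', c' = c → ∀ w : TangentSpace 𝓘(ℝ, EC) c',
      mvfderiv 𝓘(ℝ, EC) (φ ∘ j) c' w = mvfderiv 𝓘(ℝ, EN) φ (j c) v →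
      ∃ w : TangentSpace 𝓘(ℝ, EC) c,
        mvfderiv 𝓘(ℝ, EC) (φ ∘ j) c w = mvfderiv 𝓘(ℝ, EN) φ (j c) v := by
    rintro _ rfl w h
    exact ⟨w, h⟩
  rw [mvfderiv_comp_apply' (j c) (by rw [hrc]; exact hφj.mdifferentiableAt (by simp))
    (hr.self_of_nhds.mdifferentiableAt (by simp))] at hGv
  obtain ⟨w, hw⟩ := key _ hrc _ hGv
  refine ⟨w, mfderiv_extChartAt_injective (mem_chart_source EN (j c)) ?_⟩
  rw [← hw]
  exact (mvfderiv_comp_apply' c ((contMDiffAt_extChart (mem_chart_source EN _)).mdifferentiableAt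
    (by simp)) (hc.contMDiffAt.mdifferentiableAt (by simp)) w).symm

end Fibre

end DiracReduction

namespace DiracReduction

/-! ### Ranks of solutions of linear differential equations. -/

section LinearODE

open Filter Topology Set

variable {E : Type*} [NormedAddCommGroup E] [NormedSpace ℝ E]
  {G : Type*} [NormedAddCommGroup G] [NormedSpace ℝ G]

lemma linearODE_eq_zero {B : ℝ → E →L[ℝ] E} {y : ℝ → E} {a b t₀ : ℝ} (ht₀ : t₀ ∈ Icc a b)
    (hB : ContinuousOn B (Icc a b))
    (hy : ∀ t ∈ Icc a b, HasDerivWithinAt y (B t (y t)) (Icc a b) t) (h0 : y t₀ = 0) :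
    ∀ t ∈ Icc a b, y t = 0 := by
  obtain ⟨K, hK⟩ := isCompact_Icc.exists_bound_of_continuousOn hB
  have hlip : ∀ t ∈ Icc a b, LipschitzOnWith K.toNNReal (fun x => B t x) univ := fun t ht =>
    ((B t).lipschitz.weaken (by
      rw [← NNReal.coe_le_coe, coe_nnnorm]
      exact (hK t ht).trans (Real.le_coe_toNNReal K))).lipschitzOnWith
  have hcont : ContinuousOn y (Icc a b) := fun t ht => (hy t ht).continuousWithinAt
  intro t ht
  rcases le_total t₀ t with h | h
  · refine ODE_solution_unique_of_mem_Icc_right (a := t₀) (b := t) (v := fun t x => B t x)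
      (s := fun _ => univ) (g := fun _ => 0)
      (fun s hs => hlip s ⟨ht₀.1.trans hs.1, hs.2.le.trans ht.2⟩)
      (hcont.mono (Icc_subset_Icc ht₀.1 ht.2)) (fun s hs => ?_) (fun _ _ => mem_univ _)
      continuousOn_const (fun s _ => ?_) (fun _ _ => mem_univ _) h0 (right_mem_Icc.2 h)
    · exact (hy s ⟨ht₀.1.trans hs.1, hs.2.le.trans ht.2⟩).mono_of_mem_nhdsWithin
        (mem_of_superset (Icc_mem_nhdsGE (hs.2.trans_le ht.2))
          (Icc_subset_Icc_left (ht₀.1.trans hs.1)))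
    · simpa using hasDerivWithinAt_const s (Ici s) (0 : E)
  · refine ODE_solution_unique_of_mem_Icc_left (a := t) (b := t₀) (v := fun t x => B t x)
      (s := fun _ => univ) (g := fun _ => 0)
      (fun s hs => hlip s ⟨ht.1.trans hs.1.le, hs.2.trans ht₀.2⟩)
      (hcont.mono (Icc_subset_Icc ht.1 ht₀.2)) (fun s hs => ?_) (fun _ _ => mem_univ _)
      continuousOn_const (fun s _ => ?_) (fun _ _ => mem_univ _) h0 (left_mem_Icc.2 h)
    · exact (hy s ⟨ht.1.trans hs.1.le, hs.2.trans ht₀.2⟩).mono_of_mem_nhdsWithin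
        (mem_of_superset (Icc_mem_nhdsLE (ht.1.trans_lt hs.1))
          (Icc_subset_Icc_right (hs.2.trans ht₀.2)))
    · simpa using hasDerivWithinAt_const s (Iic s) (0 : E)

/-- The sign is chosen so that for `v' = B v + v Δ` the terms in `Δ` cancel in the derivative of `v
Φ`. -/
lemma exists_fundamental_solution [CompleteSpace G] {Δ : ℝ → G →L[ℝ] G} {a b t₀ : ℝ}
    (ht₀ : t₀ ∈ Icc a b) (hΔ : ContinuousOn Δ (Icc a b)) :
    ∃ a' b', Icc a' b' ⊆ Icc a b ∧ t₀ ∈ Icc a' b' ∧ Icc a' b' ∈ 𝓝[Icc a b] t₀ ∧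
      ∃ Φ : ℝ → G →L[ℝ] G, Φ t₀ = ContinuousLinearMap.id ℝ G ∧
        ∀ t ∈ Icc a' b', HasDerivWithinAt Φ (-(Δ t).comp (Φ t)) (Icc a' b') t := by
  obtain ⟨K', hK'⟩ := isCompact_Icc.exists_bound_of_continuousOn hΔ
  obtain ⟨K, hK⟩ : ∃ K : NNReal, ∀ t ∈ Icc a b, ‖Δ t‖ ≤ K :=
    ⟨K'.toNNReal, fun t ht => (hK' t ht).trans (Real.le_coe_toNNReal K')⟩
  -- In the unit ball about the identity `‖Φ‖ ≤ 2`, so the speed is at most `2 * K`, and `2 * K * ε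
  -- ≤ 1` keeps the solution in this ball.
  set ε : ℝ := 1 / (2 * K + 1) with hε
  have hε0 : 0 < ε := by positivity
  have hmem : t₀ ∈ Icc (max a (t₀ - ε)) (min b (t₀ + ε)) := by
    simp [ht₀.1, ht₀.2, hε0.le]
  have hsub : Icc (max a (t₀ - ε)) (min b (t₀ + ε)) ⊆ Icc a b :=
    Icc_subset_Icc (le_max_left _ _) (min_le_left _ _)
  refine ⟨max a (t₀ - ε), min b (t₀ + ε), hsub, hmem, ?_, ?_⟩
  · rw [← Icc_inter_Icc]
    exact inter_mem self_mem_nhdsWithin (mem_nhdsWithin_of_mem_nhds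
      (Icc_mem_nhds (by linarith) (by linarith)))
  · have hpl : IsPicardLindelof (fun t Φ => -(Δ t).comp Φ) (tmin := max a (t₀ - ε))
        (tmax := min b (t₀ + ε)) ⟨t₀, hmem⟩ (ContinuousLinearMap.id ℝ G) 1 0 (2 * K) K := by
      refine ⟨fun t ht => LipschitzOnWith.of_dist_le_mul fun x _ y _ => ?_, fun x _ => ?_,
        fun t ht x hx => ?_, ?_⟩
      · rw [dist_neg_neg, dist_eq_norm, dist_eq_norm, ← ContinuousLinearMap.comp_sub]
        exact ((Δ t).opNorm_comp_le _).trans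
          (mul_le_mul_of_nonneg_right (hK t (hsub ht)) (norm_nonneg _))
      · exact ((hΔ.mono hsub).clm_comp continuousOn_const).neg
      · have hx' : ‖x‖ ≤ 2 := by
          have h1 : ‖x - ContinuousLinearMap.id ℝ G‖ ≤ 1 := by
            simpa [dist_eq_norm] using Metric.mem_closedBall.1 hx
          have h2 : ‖ContinuousLinearMap.id ℝ G‖ ≤ 1 := ContinuousLinearMap.norm_id_le
          calc ‖x‖ = ‖(x - ContinuousLinearMap.id ℝ G) + ContinuousLinearMap.id ℝ G‖ := by
                rw [sub_add_cancel]
            _ ≤ 1 + 1 := (norm_add_le _ _).trans (add_le_add h1 h2)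
            _ = 2 := by norm_num
        rw [norm_neg]
        refine ((Δ t).opNorm_comp_le x).trans ?_
        push_cast
        have := hK t (hsub ht)
        nlinarith [norm_nonneg x, norm_nonneg (Δ t), K.2]
      · have h1 : max (min b (t₀ + ε) - t₀) (t₀ - max a (t₀ - ε)) ≤ ε := by
          refine max_le ?_ ?_
          · linarith [min_le_right b (t₀ + ε)]
          · linarith [le_max_right a (t₀ - ε)]
        have h2 : (2 * K : ℝ) * ε ≤ 1 := by
          rw [hε, mul_one_div, div_le_one (by positivity)]
          linarith
        push_cast
        rw [sub_zero]
        exact (mul_le_mul_of_nonneg_left h1 (by positivity)).trans h2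
    exact hpl.exists_eq_forall_mem_Icc_hasDerivWithinAt₀

/-- Lower semicontinuity of the rank. -/
lemma eventually_finrank_range_ge [FiniteDimensional ℝ E] {X : Type*} {l : Filter X}
    {v : X → G →L[ℝ] E} {A : G →L[ℝ] E} (hv : Tendsto v l (𝓝 A)) :
    ∀ᶠ t in l, Module.finrank ℝ (LinearMap.range (A : G →ₗ[ℝ] E))
      ≤ Module.finrank ℝ (LinearMap.range (v t : G →ₗ[ℝ] E)) := by
  let b := Module.finBasis ℝ (LinearMap.range (A : G →ₗ[ℝ] E))
  choose g hg using fun i => (b i).2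
  have hli : LinearIndependent ℝ (fun i => A (g i)) := by
    have h1 := b.linearIndependent.map' _ (LinearMap.range (A : G →ₗ[ℝ] E)).ker_subtype
    have h2 : (LinearMap.range (A : G →ₗ[ℝ] E)).subtype ∘ b = fun i => A (g i) :=
      funext fun i => (hg i).symm
    rwa [h2] at h1
  have ht : Tendsto (fun t i => v t (g i)) l (𝓝 fun i => A (g i)) := by
    rw [tendsto_pi_nhds]
    exact fun i => ((ContinuousLinearMap.apply ℝ E (g i)).continuous.tendsto A).comp hv
  filter_upwards [ht.eventually hli.eventually] with t ht
  have h2 : LinearIndependent ℝ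
      (fun i => (⟨v t (g i), ⟨g i, rfl⟩⟩ : LinearMap.range (v t : G →ₗ[ℝ] E))) :=
    LinearIndependent.of_comp (LinearMap.range (v t : G →ₗ[ℝ] E)).subtype ht
  simpa using h2.fintype_card_le_finrank

/-- If `v` solves the linear equation `v' = B v + v Δ`, then the rank of `v` is locally constant. -/
lemma eventually_finrank_range_eq [FiniteDimensional ℝ E] [FiniteDimensional ℝ G]
    {v : ℝ → G →L[ℝ] E} {B : ℝ → E →L[ℝ] E} {Δ : ℝ → G →L[ℝ] G} {a b t₀ : ℝ}
    (ht₀ : t₀ ∈ Icc a b) (hB : ContinuousOn B (Icc a b)) (hΔ : ContinuousOn Δ (Icc a b))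
    (hv : ∀ t ∈ Icc a b, HasDerivWithinAt v ((B t).comp (v t) + (v t).comp (Δ t)) (Icc a b) t) :
    ∀ᶠ t in 𝓝[Icc a b] t₀, Module.finrank ℝ (LinearMap.range (v t : G →ₗ[ℝ] E))
      = Module.finrank ℝ (LinearMap.range (v t₀ : G →ₗ[ℝ] E)) := by
  have := FiniteDimensional.complete ℝ G
  obtain ⟨a', b', hsub, hmem, hnhds, Φ, hΦ0, hΦ⟩ := exists_fundamental_solution ht₀ hΔ
  have hinv : ∀ᶠ t in 𝓝[Icc a b] t₀, (Φ t).IsInvertible := by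
    have h1 : ContinuousWithinAt Φ (Icc a b) t₀ :=
      (hΦ t₀ hmem).continuousWithinAt.mono_of_mem_nhdsWithin hnhds
    have h2 : ∀ᶠ S in 𝓝 (Φ t₀), ContinuousLinearMap.IsInvertible S := by
      rw [hΦ0]
      exact (ContinuousLinearEquiv.refl ℝ G).nhds
    exact h1.eventually h2
  filter_upwards [hinv, hnhds, eventually_finrank_range_ge (hv t₀ ht₀).continuousWithinAt]
    with t ht ht' hge
  refine le_antisymm ?_ hge
  obtain ⟨S, hS⟩ := ht
  -- For `κ` in the kernel at `t₀`, `v Φ κ` solves `y' = B y` with initial value zero. So `Φ t`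
  -- embeds the kernel at `t₀` into the kernel at `t`; the rank cannot increase, and by
  -- semicontinuity it cannot drop.
  have hker : ∀ κ ∈ LinearMap.ker (v t₀ : G →ₗ[ℝ] E), S κ ∈ LinearMap.ker (v t : G →ₗ[ℝ] E) := by
    intro κ hκ
    have hy : ∀ s ∈ Icc a' b', HasDerivWithinAt (fun s => v s (Φ s κ)) (B s (v s (Φ s κ)))
        (Icc a' b') s := by
      intro s hs
      have h1 := (hΦ s hs).clm_apply (hasDerivWithinAt_const s (Icc a' b') κ)
      have h2 := ((hv s (hsub hs)).mono hsub).clm_apply h1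
      refine h2.congr_deriv ?_
      simp
    have h3 := linearODE_eq_zero hmem (hB.mono hsub) hy (by rw [hΦ0]; exact hκ) t ht'
    rw [LinearMap.mem_ker]
    change v t ((S : G →L[ℝ] G) κ) = 0
    rw [hS]
    exact h3
  have hle : Module.finrank ℝ (LinearMap.ker (v t₀ : G →ₗ[ℝ] E))
      ≤ Module.finrank ℝ (LinearMap.ker (v t : G →ₗ[ℝ] E)) := by
    refine LinearMap.finrank_le_finrank_of_injective
      (f := LinearMap.restrict (S : G →ₗ[ℝ] G) hker) ?_
    intro x y hxy
    exact Subtype.ext (S.injective (congrArg Subtype.val hxy))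
  have h4 := LinearMap.finrank_range_add_finrank_ker (v t : G →ₗ[ℝ] E)
  have h5 := LinearMap.finrank_range_add_finrank_ker (v t₀ : G →ₗ[ℝ] E)
  omega

end LinearODE

end DiracReduction

namespace DiracReduction

/-! ### Local leaf spaces inside a fibre of a submersion. -/

section LeafChart

open Filter Topology Set

variable {E : Type*} [NormedAddCommGroup E] [NormedSpace ℝ E]
  {C : Type*} [TopologicalSpace C] [ChartedSpace E C]
  {F : Type*} [NormedAddCommGroup F] [NormedSpace ℝ F]

lemma hasDerivWithinAt_comp_curve {g : C → F} {γ : ℝ → C} {S : Set ℝ} {t : ℝ}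
    {w : TangentSpace 𝓘(ℝ, E) (γ t)}
    (hg : MDifferentiableAt 𝓘(ℝ, E) 𝓘(ℝ, F) g (γ t))
    (hγ : HasMFDerivWithinAt 𝓘(ℝ, ℝ) 𝓘(ℝ, E) γ S t ((1 : ℝ →L[ℝ] ℝ).smulRight w)) :
    HasDerivWithinAt (g ∘ γ) (mvfderiv 𝓘(ℝ, E) g (γ t) w) S t := by
  have h := (hg.hasMFDerivAt.comp_hasMFDerivWithinAt t hγ).hasFDerivWithinAt
  rw [hasDerivWithinAt_iff_hasFDerivWithinAt]
  refine h.congr_fderiv ?_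
  refine ContinuousLinearMap.ext fun x : ℝ => ?_
  exact map_smul (mfderiv 𝓘(ℝ, E) 𝓘(ℝ, F) g (γ t)) x w

lemma hasMFDerivWithinAt_comp_curve {s : F → C} {w : ℝ → F} {S : Set ℝ} {t : ℝ} {w' : F}
    (hs : MDifferentiableAt 𝓘(ℝ, F) 𝓘(ℝ, E) s (w t)) (hw : HasDerivWithinAt w w' S t) :
    HasMFDerivWithinAt 𝓘(ℝ, ℝ) 𝓘(ℝ, E) (s ∘ w) S t
      ((1 : ℝ →L[ℝ] ℝ).smulRight (mfderiv 𝓘(ℝ, F) 𝓘(ℝ, E) s (w t) w')) := by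
  have h := hs.hasMFDerivAt.comp_hasMFDerivWithinAt t hw.hasFDerivWithinAt.hasMFDerivWithinAt
  refine h.congr_mfderiv ?_
  refine ContinuousLinearMap.ext fun x : ℝ => ?_
  exact map_smul (mfderiv 𝓘(ℝ, F) 𝓘(ℝ, E) s (w t)) x w'

variable [IsManifold 𝓘(ℝ, E) ∞ C]
  {EQ : Type*} [NormedAddCommGroup EQ] [NormedSpace ℝ EQ]
  {Q : Type*} [TopologicalSpace Q] [ChartedSpace EQ Q]

/-- Adapted coordinates of a submersion: a coordinate `Φ` along the fibre and a parametrization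
`s` of the fibre. -/
lemma exists_fibre_coordinate {p : C → Q} {c : C}
    (hp : Manifold.IsSubmersionAt 𝓘(ℝ, E) 𝓘(ℝ, EQ) ∞ p c) :
    ∃ (K : Submodule ℝ E) (D : Set C) (Z : Set K) (Φ : C → K) (s : K → C), IsOpen D ∧ c ∈ D ∧
      IsOpen Z ∧ (∀ y ∈ D, ContMDiffAt 𝓘(ℝ, E) 𝓘(ℝ, K) ∞ Φ y) ∧
      (∀ z ∈ Z, ContMDiffAt 𝓘(ℝ, K) 𝓘(ℝ, E) ∞ s z) ∧
      (∀ y ∈ D, p y = p c → Φ y ∈ Z ∧ s (Φ y) = y) ∧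
      (∀ z ∈ Z, s z ∈ D ∧ p (s z) = p c ∧ Φ (s z) = z) ∧
      (∀ y ∈ D, p y = p c → ∀ w : TangentSpace 𝓘(ℝ, E) y, mfderiv 𝓘(ℝ, E) 𝓘(ℝ, EQ) p y w = 0 →
        mvfderiv 𝓘(ℝ, E) Φ y w = 0 → w = 0) := by
  have hds := contMDiffOn_symm_of_mem_maximalAtlas hp.domChart_mem_maximalAtlas
  have hd := contMDiffOn_of_mem_maximalAtlas hp.domChart_mem_maximalAtlas
  have hcd := contMDiffOn_of_mem_maximalAtlas hp.codChart_mem_maximalAtlas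
  set D := hp.domChart with hD
  have hdy : ∀ y ∈ D.source, ContMDiffAt 𝓘(ℝ, E) 𝓘(ℝ, E) ∞ D y := fun y hy =>
    hd.contMDiffAt (D.open_source.mem_nhds hy)
  have hcdy : ∀ y ∈ D.source, ContMDiffAt 𝓘(ℝ, EQ) 𝓘(ℝ, EQ) ∞ hp.codChart (p y) := fun y hy =>
    hcd.contMDiffAt (hp.codChart.open_source.mem_nhds (hp.source_subset_preimage_source hy))
  have hpy : ∀ y ∈ D.source, ContMDiffAt 𝓘(ℝ, E) 𝓘(ℝ, EQ) ∞ p y := fun y hy =>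
    hp.contMDiffOn.contMDiffAt (D.open_source.mem_nhds hy)
  let q : E →L[ℝ] EQ := (ContinuousLinearMap.fst ℝ EQ hp.complement).comp
    (hp.equiv : E →L[ℝ] EQ × hp.complement)
  let σ : EQ →L[ℝ] E := (hp.equiv.symm : EQ × hp.complement →L[ℝ] E).comp
    (ContinuousLinearMap.inl ℝ EQ hp.complement)
  have hqσ : ∀ u, q (σ u) = u := fun u => by simp [q, σ]
  -- `q` is the submersion in adapted charts and `σ` a linear section of it, so `π` is the
  -- projection onto the vertical directions.
  let π : E →L[ℝ] LinearMap.ker (q : E →ₗ[ℝ] EQ) :=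
    (ContinuousLinearMap.id ℝ E - σ.comp q).codRestrict _ fun v => by simp [hqσ]
  have hπ : ∀ v, (π v : E) = v - σ (q v) := fun v => rfl
  have hcod : ∀ y ∈ D.source, hp.codChart (p y) = q (D y) := by
    intro y hy
    have hy' : D y ∈ (D.extend 𝓘(ℝ, E)).target := by simpa using D.map_source hy
    have h := hp.writtenInCharts hy'
    change _ = (hp.equiv (D y)).1
    simpa only [OpenPartialHomeomorph.extend_coe, OpenPartialHomeomorph.extend_coe_symm,
      Function.comp_apply, modelWithCornersSelf_coe, modelWithCornersSelf_coe_symm, id_eq,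
      ← hD, D.left_inv hy] using h
  have hcD : c ∈ D.source := hp.mem_domChart_source
  -- The affine slice that represents the fibre through `c` in the chart.
  let A : LinearMap.ker (q : E →ₗ[ℝ] EQ) → E := fun z => σ (q (D c)) + z
  have hA : ContDiff ℝ ∞ A :=
    contDiff_const.add (LinearMap.ker (q : E →ₗ[ℝ] EQ)).subtypeL.contDiff
  have hqA : ∀ z, q (A z) = q (D c) := fun z => by
    have : q (z : E) = 0 := z.2
    simp [A, hqσ, this]
  have hπA : ∀ z, π (A z) = z := fun z => by
    refine Subtype.ext ?_
    rw [hπ, hqA]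
    simp [A]
  have hAπ : ∀ y ∈ D.source, p y = p c → A (π (D y)) = D y := by
    intro y hy hpc
    have : q (D y) = q (D c) := by rw [← hcod y hy, ← hcod c hcD, hpc]
    simp [A, hπ, this]
  refine ⟨LinearMap.ker (q : E →ₗ[ℝ] EQ), D.source, A ⁻¹' D.target, fun y => π (D y),
    fun z => D.symm (A z), D.open_source, hcD, D.open_target.preimage hA.continuous, ?_, ?_, ?_,
    ?_, ?_⟩
  · exact fun y hy => π.contMDiff.contMDiffAt.comp y (hdy y hy)
  · exact fun z hz => (hds.contMDiffAt (D.open_target.mem_nhds hz)).comp z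
      hA.contMDiff.contMDiffAt
  · intro y hy hpc
    have h := hAπ y hy hpc
    refine ⟨?_, ?_⟩
    · rw [mem_preimage, h]
      exact D.map_source hy
    · change D.symm (A (π (D y))) = y
      rw [h, D.left_inv hy]
  · intro z hz
    have h1 : D.symm (A z) ∈ D.source := D.map_target hz
    have h2 : D (D.symm (A z)) = A z := D.right_inv hz
    refine ⟨h1, ?_, by change π (D (D.symm (A z))) = z; rw [h2, hπA]⟩
    refine hp.codChart.injOn (hp.source_subset_preimage_source h1)
      (hp.source_subset_preimage_source hcD) ?_
    rw [hcod _ h1, hcod c hcD, h2, hqA]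
  · intro y hy hpc w hw hw'
    have hinj : Function.Injective (mfderiv 𝓘(ℝ, E) 𝓘(ℝ, E) D y) := by
      refine injective_mfderiv_of_leftInverse (r := D.symm) ((hdy y hy).mdifferentiableAt (by simp))
        ((hds.contMDiffAt (D.open_target.mem_nhds (D.map_source hy))).mdifferentiableAt (by simp))
        ?_
      filter_upwards [D.open_source.mem_nhds hy] with x hx using D.left_inv hx
    refine hinj ?_
    rw [map_zero]
    have hDd : MDifferentiableAt 𝓘(ℝ, E) 𝓘(ℝ, E) D y := (hdy y hy).mdifferentiableAt (by simp)
    have h1 : π (mvfderiv 𝓘(ℝ, E) D y w) = 0 := by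
      rw [← mvfderiv_clm_comp π hDd]
      exact hw'
    have h2 : q (mvfderiv 𝓘(ℝ, E) D y w) = 0 := by
      rw [← mvfderiv_clm_comp q hDd]
      have h3 : (fun x => q (D x)) =ᶠ[𝓝 y] hp.codChart ∘ p := by
        filter_upwards [D.open_source.mem_nhds hy] with x hx using (hcod x hx).symm
      rw [mvfderiv_congr h3, mvfderiv_comp_apply' y ((hcdy y hy).mdifferentiableAt (by simp))
        ((hpy y hy).mdifferentiableAt (by simp)), hw, map_zero]
    have h4 := hπ (mvfderiv 𝓘(ℝ, E) D y w)
    rw [h1, h2, map_zero, sub_zero] at h4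
    exact h4.symm

end LeafChart

end DiracReduction

namespace DiracReduction

section LeafChart

open Filter Topology Set

variable {E : Type*} [NormedAddCommGroup E] [NormedSpace ℝ E] [FiniteDimensional ℝ E]
  {C : Type*} [TopologicalSpace C] [ChartedSpace E C] [IsManifold 𝓘(ℝ, E) ∞ C]
  {EQ : Type*} [NormedAddCommGroup EQ] [NormedSpace ℝ EQ]
  {Q : Type*} [TopologicalSpace Q] [ChartedSpace EQ Q]

/-- A family of vector fields in involution which are tangent to the fibres of a submersion and
span a subspace of constant rank along a fibre has local leaf spaces in that fibre. -/
theorem exists_leafChart {ι : Type*} [Fintype ι] {V : ι → VField E C}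
    (hV : ∀ i, SmoothVF E (V i))
    (hbr : ∀ i j c, lieBr E (V i) (V j) c ∈ Submodule.span ℝ (range fun l => V l c))
    {p : C → Q} {c : C} (hps : ContMDiff 𝓘(ℝ, E) 𝓘(ℝ, EQ) ∞ p)
    (hp : Manifold.IsSubmersionAt 𝓘(ℝ, E) 𝓘(ℝ, EQ) ∞ p c)
    (htan : ∀ i y, mfderiv 𝓘(ℝ, E) 𝓘(ℝ, EQ) p y (V i y) = 0) {r : ℕ}
    (hr : ∀ y, p y = p c → Module.finrank ℝ (Submodule.span ℝ (range fun i => V i y)) = r) :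
    ∃ (O : Set C) (τ : C → E), IsOpen O ∧ c ∈ O ∧
      (∀ (γ : ℝ → C) (S : Set ℝ) (t : ℝ) (a : ι → ℝ), γ t ∈ O → p (γ t) = p c →
        HasMFDerivWithinAt 𝓘(ℝ, ℝ) 𝓘(ℝ, E) γ S t
          ((1 : ℝ →L[ℝ] ℝ).smulRight (∑ i, a i • V i (γ t))) →
        HasDerivWithinAt (τ ∘ γ) 0 S t) ∧
      (∀ y ∈ O, p y = p c → ∀ O' ∈ 𝓝 y, ∃ N ∈ 𝓝 y, ∀ a ∈ N, ∀ b ∈ N, p a = p c → p b = p c →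
        τ a = τ b → ∃ w : ℝ → C, w 0 = a ∧ w 1 = b ∧ ∀ t ∈ Icc (0 : ℝ) 1,
          w t ∈ O' ∧ p (w t) = p c ∧ ∃ α : ι → ℝ,
            HasMFDerivWithinAt 𝓘(ℝ, ℝ) 𝓘(ℝ, E) w (Icc 0 1) t
              ((1 : ℝ →L[ℝ] ℝ).smulRight (∑ i, α i • V i (w t)))) ∧
      (r < Module.finrank ℝ (LinearMap.ker (mfderiv 𝓘(ℝ, E) 𝓘(ℝ, EQ) p c).toLinearMap) →
        ¬ (τ '' {y ∈ O | p y = p c}).Countable) := by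
  have := FiniteDimensional.complete ℝ E
  obtain ⟨K, D, Z, Φ, s, hD, hcD, hZ, hΦ, hs, hsΦ, hsz, hker⟩ := exists_fibre_coordinate hp
  have hΦd : ∀ y ∈ D, MDifferentiableAt 𝓘(ℝ, E) 𝓘(ℝ, K) Φ y := fun y hy =>
    (hΦ y hy).mdifferentiableAt (by simp)
  have hsd : ∀ z ∈ Z, MDifferentiableAt 𝓘(ℝ, K) 𝓘(ℝ, E) s z := fun z hz =>
    (hs z hz).mdifferentiableAt (by simp)
  have hpd : ∀ y, MDifferentiableAt 𝓘(ℝ, E) 𝓘(ℝ, EQ) p y := fun y =>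
    (hps y).mdifferentiableAt (by simp)
  have hΦs : ∀ z ∈ Z, ∀ v : TangentSpace 𝓘(ℝ, K) z,
      mvfderiv 𝓘(ℝ, E) Φ (s z) (mfderiv 𝓘(ℝ, K) 𝓘(ℝ, E) s z v) = v := by
    intro z hz v
    have h1 := mvfderiv_comp_apply' (E := E) z (hΦd _ (hsz z hz).1) (hsd z hz) v
    have h2 : Φ ∘ s =ᶠ[𝓝 z] id := by
      filter_upwards [hZ.mem_nhds hz] with x hx using (hsz x hx).2.2
    refine h1.symm.trans ((mvfderiv_congr h2 v).trans ?_)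
    refine (mvfderiv_vectorSpace (g := (id : K → K)) z v).trans ?_
    rw [fderiv_id]
    rfl
  have hpsz : ∀ z ∈ Z, ∀ v : TangentSpace 𝓘(ℝ, K) z,
      mfderiv 𝓘(ℝ, E) 𝓘(ℝ, EQ) p (s z) (mfderiv 𝓘(ℝ, K) 𝓘(ℝ, E) s z v) = 0 := by
    intro z hz v
    have h1 := mfderiv_comp_apply (I := 𝓘(ℝ, K)) (I' := 𝓘(ℝ, E)) (I'' := 𝓘(ℝ, EQ)) z (hpd (s z))
      (hsd z hz) v
    have h2 : p ∘ s =ᶠ[𝓝 z] fun _ => p c := by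
      filter_upwards [hZ.mem_nhds hz] with x hx using (hsz x hx).2.1
    rw [← h1, h2.mfderiv_eq, mfderiv_const]
    rfl
  have hsΦd : ∀ z ∈ Z, ∀ w : TangentSpace 𝓘(ℝ, E) (s z),
      mfderiv 𝓘(ℝ, E) 𝓘(ℝ, EQ) p (s z) w = 0 →
      mfderiv 𝓘(ℝ, K) 𝓘(ℝ, E) s z (mvfderiv 𝓘(ℝ, E) Φ (s z) w) = w := by
    intro z hz w hw
    refine sub_eq_zero.1 (hker (s z) (hsz z hz).1 (hsz z hz).2.1 _ ?_ ?_)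
    · refine (map_sub _ _ _).trans ?_
      rw [hw]
      exact (sub_zero _).trans (hpsz z hz _)
    · exact (map_sub _ _ _).trans (sub_eq_zero.2 (hΦs z hz _))
  have htan' : ∀ (y : C) (a : ι → ℝ), mfderiv 𝓘(ℝ, E) 𝓘(ℝ, EQ) p y (∑ i, a i • V i y) = 0 := by
    intro y a
    simp [map_sum, htan]
  set g : ι → C → K := fun i y => mvfderiv 𝓘(ℝ, E) Φ y (V i y) with hg
  have hgs : ∀ i, ∀ y ∈ D, ContMDiffAt 𝓘(ℝ, E) 𝓘(ℝ, K) ∞ (g i) y := fun i y hy =>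
    SmoothVFAt.mvfderiv_apply (hV i y) (hΦ y hy)
  -- The fields on the fibre through `c`, read in the coordinate `Φ`. As they are tangent to the
  -- fibre, the differential of `s` carries `W z a` back to `∑ i, a i • V i`.
  set W : K → (ι → ℝ) →L[ℝ] K := fun z =>
    ∑ i, (ContinuousLinearMap.proj i : (ι → ℝ) →L[ℝ] ℝ).smulRight (g i (s z)) with hW
  have hWa : ∀ z a, W z a = ∑ i, a i • g i (s z) := fun z a => by simp [hW]
  have hWa' : ∀ z a, W z a = mvfderiv 𝓘(ℝ, E) Φ (s z) (∑ i, a i • V i (s z)) := fun z a => by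
    simp [hWa, hg, map_sum]
  have hgsz : ∀ i, ∀ z ∈ Z, ContDiffAt ℝ ∞ (fun z => g i (s z)) z := fun i z hz =>
    ((hgs i _ (hsz z hz).1).comp z (hs z hz)).contDiffAt
  have hWs : ∀ z ∈ Z, ContDiffAt ℝ ∞ W z := by
    intro z hz
    refine ContDiffAt.sum fun i _ => ?_
    exact (ContinuousLinearMap.smulRightL ℝ (ι → ℝ) K (ContinuousLinearMap.proj i)).contDiff
      |>.contDiffAt.comp z (hgsz i z hz)
  have hΦc : Φ c ∈ Z ∧ s (Φ c) = c := hsΦ c hcD rfl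
  have hrange : ∀ z, LinearMap.range (W z : (ι → ℝ) →ₗ[ℝ] K) =
      (Submodule.span ℝ (range fun i => V i (s z))).map
        (mvfderiv 𝓘(ℝ, E) Φ (s z)).toLinearMap := by
    intro z
    ext x
    simp only [LinearMap.mem_range, ContinuousLinearMap.coe_coe, Submodule.mem_map,
      Submodule.mem_span_range_iff_exists_fun]
    constructor
    · rintro ⟨a, rfl⟩
      exact ⟨_, ⟨a, rfl⟩, (hWa' z a).symm⟩
    · rintro ⟨_, ⟨a, rfl⟩, rfl⟩
      exact ⟨a, hWa' z a⟩
  have hrank : ∀ z ∈ Z, Module.finrank ℝ (LinearMap.range (W z : (ι → ℝ) →ₗ[ℝ] K)) = r := by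
    intro z hz
    rw [hrange, ← hr (s z) (hsz z hz).2.1]
    rw [← LinearMap.range_domRestrict]
    refine LinearMap.finrank_range_of_inj ((injective_iff_map_eq_zero _).2 ?_)
    rintro ⟨w, hw⟩ h0
    obtain ⟨a, rfl⟩ := (Submodule.mem_span_range_iff_exists_fun ℝ).1 hw
    exact Subtype.ext (hker (s z) (hsz z hz).1 (hsz z hz).2.1 _ (htan' _ a) h0)
  have hfd : ∀ j, ∀ z ∈ Z, ∀ a : ι → ℝ, fderiv ℝ (fun z => g j (s z)) z (W z a)
      = ∑ i, a i • mvfderiv 𝓘(ℝ, E) (g j) (s z) (V i (s z)) := by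
    intro j z hz a
    have e1 := mvfderiv_comp_apply' (E := E) z ((hgs j _ (hsz z hz).1).mdifferentiableAt (by simp))
      (hsd z hz) (W z a)
    have e2 : mfderiv 𝓘(ℝ, K) 𝓘(ℝ, E) s z (W z a) = ∑ i, a i • V i (s z) := by
      rw [hWa']
      exact hsΦd z hz _ (htan' _ a)
    refine (mvfderiv_vectorSpace z (W z a)).symm.trans (e1.trans ?_)
    rw [e2]
    simp [map_sum]
  -- By the commutator formula for `Φ`, the antisymmetrised derivative of `W` is the image of a
  -- combination of brackets of the `V i`, which lie in the span.
  have hinv : ∀ z ∈ Z, ∀ a b, ∃ e, fderiv ℝ W z (W z a) b - fderiv ℝ W z (W z b) a = W z e := by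
    intro z hz a b
    have h1 : ∀ a b : ι → ℝ, fderiv ℝ W z (W z a) b
        = ∑ j, ∑ i, (b j * a i) • mvfderiv 𝓘(ℝ, E) (g j) (s z) (V i (s z)) := by
      intro a b
      have e1 : fderiv ℝ (fun z => W z b) z (W z a) = fderiv ℝ W z (W z a) b := by
        rw [fderiv_clm_apply ((hWs z hz).differentiableAt (by simp)) (differentiableAt_const b)]
        simp
      rw [← e1]
      have e2 : (fun z => W z b) = fun z => ∑ j, b j • g j (s z) := funext fun z => hWa z b
      have e3 : ∀ j ∈ Finset.univ, DifferentiableAt ℝ (fun z => b j • g j (s z)) z := fun j _ =>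
        ((hgsz j z hz).differentiableAt (by simp)).const_smul (b j)
      rw [e2, fderiv_fun_sum e3]
      simp only [_root_.sum_apply]
      refine Finset.sum_congr rfl fun j _ => ?_
      rw [fderiv_fun_const_smul ((hgsz j z hz).differentiableAt (by simp)), _root_.smul_apply,
        hfd j z hz, Finset.smul_sum]
      simp only [smul_smul]
    have h2 : fderiv ℝ W z (W z a) b - fderiv ℝ W z (W z b) a = mvfderiv 𝓘(ℝ, E) Φ (s z)
        (∑ j, ∑ i, (b j * a i) • lieBr E (V i) (V j) (s z)) := by
      rw [h1, h1 b a, Finset.sum_comm (f := fun j i => (a j * b i) • _), ← Finset.sum_sub_distrib,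
        map_sum]
      refine Finset.sum_congr rfl fun j _ => ?_
      rw [← Finset.sum_sub_distrib, map_sum]
      refine Finset.sum_congr rfl fun i _ => ?_
      rw [map_smul, mvfderiv_lieBr (hV i _) (hV j _)
        (by filter_upwards [hD.mem_nhds (hsz z hz).1] with y hy using hΦ y hy), smul_sub,
        mul_comm (a i) (b j)]
    have h3 : (∑ j, ∑ i, (b j * a i) • lieBr E (V i) (V j) (s z))
        ∈ Submodule.span ℝ (range fun i => V i (s z)) :=
      Submodule.sum_mem _ fun j _ => Submodule.sum_mem _ fun i _ =>
        Submodule.smul_mem _ _ (hbr i j (s z))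
    obtain ⟨e, he⟩ := (Submodule.mem_span_range_iff_exists_fun ℝ).1 h3
    exact ⟨e, by rw [h2, hWa', he]⟩
  have hWΦ : ∀ y ∈ D, p y = p c → ∀ a, W (Φ y) a = mvfderiv 𝓘(ℝ, E) Φ y (∑ i, a i • V i y) := by
    intro y hy hyp a
    rw [hWa, (hsΦ y hy hyp).2]
    simp [hg, map_sum]
  obtain ⟨O, τ, hO, hcO, hOZ, h1, h2, h3⟩ := exists_foliatedBox
    ((hWs _ hΦc.1).of_le (m := 2) (WithTop.coe_le_coe.2 le_top))
    (by filter_upwards [hZ.mem_nhds hΦc.1] with z hz using hrank z hz)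
    (by filter_upwards [hZ.mem_nhds hΦc.1] with z hz using hinv z hz) (hZ.mem_nhds hΦc.1)
  have hΦcont : ContinuousOn Φ D := fun y hy => (hΦ y hy).continuousAt.continuousWithinAt
  refine ⟨D ∩ Φ ⁻¹' O, fun y => (τ (Φ y) : E), hΦcont.isOpen_inter_preimage hD hO, ⟨hcD, hcO⟩,
    ?_, ?_, ?_⟩
  · rintro γ S t a ⟨hγD, hγO⟩ hγp hd
    have hd1 := hasDerivWithinAt_comp_curve (hΦd _ hγD) hd
    have hd2 := h1 (Φ ∘ γ) S t a hγO (hd1.congr_deriv (hWΦ _ hγD hγp a).symm)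
    have h := K.subtypeL.hasFDerivAt.comp_hasDerivWithinAt t hd2
    rw [map_zero] at h
    exact h
  · rintro y ⟨hyD, hyO⟩ hyp O' hO'
    have hy := hsΦ y hyD hyp
    have hO'' : O ∩ s ⁻¹' O' ∈ 𝓝 (Φ y) :=
      inter_mem (hO.mem_nhds hyO) ((hs _ hy.1).continuousAt (by rwa [hy.2]))
    obtain ⟨N, hN, hNw⟩ := h2 (Φ y) hyO _ hO''
    refine ⟨D ∩ Φ ⁻¹' N, inter_mem (hD.mem_nhds hyD) ((hΦ y hyD).continuousAt hN), ?_⟩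
    rintro a ⟨haD, haN⟩ b ⟨hbD, hbN⟩ hap hbp hab
    obtain ⟨w, hw0, hw1, hw⟩ := hNw _ haN _ hbN (Subtype.ext hab)
    refine ⟨s ∘ w, ?_, ?_, fun t ht => ?_⟩
    · rw [Function.comp_apply, hw0, (hsΦ a haD hap).2]
    · rw [Function.comp_apply, hw1, (hsΦ b hbD hbp).2]
    · obtain ⟨⟨htO, htO'⟩, α, hα⟩ := hw t ht
      have htZ : w t ∈ Z := hOZ htO
      refine ⟨htO', (hsz _ htZ).2.1, α, ?_⟩
      have h4 := hasMFDerivWithinAt_comp_curve (hsd _ htZ) hα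
      have h5 : mfderiv 𝓘(ℝ, K) 𝓘(ℝ, E) s (w t) (W (w t) α) = ∑ i, α i • V i (s (w t)) := by
        rw [hWa']
        exact hsΦd _ htZ _ (htan' _ α)
      rw [h5] at h4
      exact h4
  · intro hlt hcount
    have hle : Module.finrank ℝ (LinearMap.ker (mfderiv 𝓘(ℝ, E) 𝓘(ℝ, EQ) p c).toLinearMap)
        ≤ Module.finrank ℝ K := by
      refine LinearMap.finrank_le_finrank_of_injective
        (f := (mvfderiv 𝓘(ℝ, E) Φ c).toLinearMap.domRestrict
          (LinearMap.ker (mfderiv 𝓘(ℝ, E) 𝓘(ℝ, EQ) p c).toLinearMap))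
        ((injective_iff_map_eq_zero _).2 ?_)
      rintro ⟨w, hw⟩ h0
      exact Subtype.ext (hker c hcD rfl w hw h0)
    refine h3 (hlt.trans_le hle) ?_
    refine countable_of_injective_of_countable_image (f := ((↑) : K → E))
      Subtype.val_injective.injOn (hcount.mono ?_)
    rintro _ ⟨_, ⟨z, hz, rfl⟩, rfl⟩
    obtain ⟨e1, e2, e3⟩ := hsz z (hOZ hz)
    exact ⟨s z, ⟨⟨e1, by rwa [mem_preimage, e3]⟩, e2⟩, by
      change ((τ (Φ (s z)) : K) : E) = _
      rw [e3]⟩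

end LeafChart

end DiracReduction

namespace DiracReduction

/-! ### The rank of the span along integral curves. -/

section RankAlongCurves

open Filter Topology Set

variable {E : Type*} [NormedAddCommGroup E] [NormedSpace ℝ E]
  {C : Type*} [TopologicalSpace C] [ChartedSpace E C]

lemma mvfderiv_sum_smul {F : Type*} [NormedAddCommGroup F] [NormedSpace ℝ F] {ι : Type*}
    [Fintype ι] {g : ι → C → F} {y : C} (hg : ∀ i, MDifferentiableAt 𝓘(ℝ, E) 𝓘(ℝ, F) (g i) y)
    (a : ι → ℝ) (w : TangentSpace 𝓘(ℝ, E) y) :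
    mvfderiv 𝓘(ℝ, E) (fun q => ∑ i, a i • g i q) y w
      = ∑ i, a i • mvfderiv 𝓘(ℝ, E) (g i) y w := by
  classical
  have key : ∀ s : Finset ι, ∃ D : TangentSpace 𝓘(ℝ, E) y →L[ℝ] F,
      HasMFDerivAt 𝓘(ℝ, E) 𝓘(ℝ, F) (fun q => ∑ i ∈ s, a i • g i q) y D ∧
        D w = ∑ i ∈ s, a i • mvfderiv 𝓘(ℝ, E) (g i) y w := by
    intro s
    induction s using Finset.induction_on with
    | empty => exact ⟨0, hasMFDerivAt_const (0 : F) y, rfl⟩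
    | insert i s hi ih =>
      obtain ⟨D, h1, h2⟩ := ih
      have h3 := ((hg i).hasMFDerivAt.const_smul (a i)).add h1
      have h4 : (fun q => ∑ i ∈ insert i s, a i • g i q)
          = a i • g i + fun q => ∑ i ∈ s, a i • g i q :=
        funext fun q => Finset.sum_insert hi
      rw [h4, Finset.sum_insert hi, ← h2]
      exact ⟨_, h3, rfl⟩
  obtain ⟨D, h1, h2⟩ := key Finset.univ
  exact (DFunLike.congr_fun h1.mfderiv w).trans h2

variable [FiniteDimensional ℝ E] [IsManifold 𝓘(ℝ, E) ∞ C]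

/-- Along an integral curve of a combination of vector fields in involution with continuous
structure functions, the rank of their span is constant. -/
lemma finrank_span_eq_of_integralCurve {ι : Type*} [Fintype ι] {V : ι → VField E C}
    (hV : ∀ i, SmoothVF E (V i))
    (hbr : ∀ i j c₀, ∃ δ : ι → C → ℝ, ∀ᶠ c in 𝓝 c₀,
      (∀ l, ContinuousAt (δ l) c) ∧ lieBr E (V i) (V j) c = ∑ l, δ l c • V l c) {γ : ℝ → C} {a : ι → ℝ}
    (hγ : IsMIntegralCurveOn (I := 𝓘(ℝ, E)) γ (fun c => ∑ i, a i • V i c) (Icc 0 1)) :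
    Module.finrank ℝ (Submodule.span ℝ (range fun i => V i (γ 0)))
      = Module.finrank ℝ (Submodule.span ℝ (range fun i => V i (γ 1))) := by
  have := FiniteDimensional.complete ℝ E
  have hcont := hγ.continuousOn
  suffices hloc : ∀ t₀ ∈ Icc (0 : ℝ) 1, ∀ᶠ t in 𝓝[Icc 0 1] t₀,
      Module.finrank ℝ (Submodule.span ℝ (range fun i => V i (γ t)))
        = Module.finrank ℝ (Submodule.span ℝ (range fun i => V i (γ t₀))) by
    refine isPreconnected_Icc.constant (s := Icc (0 : ℝ) 1)
      (f := fun t => Module.finrank ℝ (Submodule.span ℝ (range fun i => V i (γ t))))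
      (fun t₀ ht₀ => ?_) (left_mem_Icc.2 zero_le_one) (right_mem_Icc.2 zero_le_one)
    exact tendsto_const_nhds.congr' (EventuallyEq.symm (hloc t₀ ht₀))
  intro t₀ ht₀
  set φ := extChartAt 𝓘(ℝ, E) (γ t₀) with hφ
  choose δ hδ using fun i j => hbr i j (γ t₀)
  -- A short time interval during which the curve stays in one chart and where the structure
  -- functions are available.
  obtain ⟨a', b', hmem, hnhds, hsrcδ, hsub⟩ : ∃ a' b', t₀ ∈ Icc a' b' ∧
      Icc a' b' ∈ 𝓝[Icc 0 1] t₀ ∧ (∀ t ∈ Icc a' b', γ t ∈ (chartAt E (γ t₀)).source ∧ ∀ i j,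
        (∀ l, ContinuousAt (δ i j l) (γ t)) ∧
          lieBr E (V i) (V j) (γ t) = ∑ l, δ i j l (γ t) • V l (γ t)) ∧
      Icc a' b' ⊆ Icc (0 : ℝ) 1 := by
    have h1 := (hcont t₀ ht₀) (inter_mem ((chartAt E (γ t₀)).open_source.mem_nhds (mem_chart_source E (γ t₀)))
      (eventually_all.2 fun i => eventually_all.2 fun j => hδ i j))
    obtain ⟨ε, hε, h2⟩ := Metric.mem_nhdsWithin_iff.1 (mem_map.1 h1)
    have hsub : Icc (max 0 (t₀ - ε / 2)) (min 1 (t₀ + ε / 2)) ⊆ Icc (0 : ℝ) 1 :=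
      Icc_subset_Icc (le_max_left _ _) (min_le_left _ _)
    refine ⟨max 0 (t₀ - ε / 2), min 1 (t₀ + ε / 2), ?_, ?_, fun t ht => ?_, hsub⟩
    · simp [ht₀.1, ht₀.2, (half_pos hε).le]
    · rw [← Icc_inter_Icc]
      exact inter_mem self_mem_nhdsWithin (mem_nhdsWithin_of_mem_nhds
        (Icc_mem_nhds (by linarith) (by linarith)))
    · refine h2 ⟨?_, hsub ht⟩
      rw [Metric.mem_ball, Real.dist_eq, abs_lt]
      have h3 := (le_max_right _ _).trans ht.1
      have h4 := ht.2.trans (min_le_right _ _)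
      constructor <;> linarith
  have hsrc := fun t ht => (hsrcδ t ht).1
  set g : ι → C → E := fun i y => mvfderiv 𝓘(ℝ, E) φ y (V i y) with hg
  have hgs : ∀ i, ∀ y ∈ (chartAt E (γ t₀)).source, ContMDiffAt 𝓘(ℝ, E) 𝓘(ℝ, E) ∞ (g i) y :=
    fun i y hy => SmoothVFAt.mvfderiv_apply (hV i y) (contMDiffAt_extChart hy)
  have hgd : ∀ i, ∀ y ∈ (chartAt E (γ t₀)).source, MDifferentiableAt 𝓘(ℝ, E) 𝓘(ℝ, E) (g i) y :=
    fun i y hy => (hgs i y hy).mdifferentiableAt (by simp)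
  have hcomm : ∀ i j, ∀ y ∈ (chartAt E (γ t₀)).source,
      lieBr E (V j) (V i) y = ∑ l, δ j i l y • V l y → mvfderiv 𝓘(ℝ, E) (g i) y (V j y)
      = mvfderiv 𝓘(ℝ, E) (g j) y (V i y) + ∑ l, δ j i l y • g l y := by
    intro i j y hy hδy
    have h := mvfderiv_lieBr (hV j y) (hV i y) (g := φ)
      (by filter_upwards [(chartAt E (γ t₀)).open_source.mem_nhds hy] with q hq
        using contMDiffAt_extChart hq)
    rw [hδy, map_sum] at h
    simp only [map_smul] at h
    rw [add_comm, ← sub_eq_iff_eq_add]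
    exact h.symm
  -- The moving field `X = ∑ j, a j • V j` in the chart; its derivative along the curve is the
  -- operator `B` of the linear equation.
  set h : E → E := fun z => ∑ j, a j • g j (φ.symm z) with hh
  have htgt : ∀ y ∈ (chartAt E (γ t₀)).source, φ y ∈ φ.target ∧ φ.symm (φ y) = y := by
    intro y hy
    have hy' : y ∈ φ.source := by rwa [hφ, extChartAt_source]
    exact ⟨φ.map_source hy', φ.left_inv hy'⟩
  have hhs : ∀ y ∈ (chartAt E (γ t₀)).source, ContDiffAt ℝ ∞ h (φ y) := by
    intro y hy
    refine ContDiffAt.sum fun j _ => ContDiffAt.const_smul _ ?_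
    rw [← contMDiffAt_iff_contDiffAt]
    exact ContMDiffAt.comp (φ y) (by rw [(htgt y hy).2]; exact hgs j y hy)
      (contMDiffAt_extChart_symm (htgt y hy).1)
  have hhB : ∀ i, ∀ y ∈ (chartAt E (γ t₀)).source,
      fderiv ℝ h (φ y) (g i y) = ∑ j, a j • mvfderiv 𝓘(ℝ, E) (g j) y (V i y) := by
    intro i y hy
    have h1 := mvfderiv_comp_extChart hy ((hhs y hy).differentiableAt (by simp)) (V i y)
    have h2 : h ∘ φ =ᶠ[𝓝 y] fun q => ∑ j, a j • g j q := by
      filter_upwards [(chartAt E (γ t₀)).open_source.mem_nhds hy] with q hq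
      simp only [hh, Function.comp_apply, (htgt q hq).2]
    refine h1.symm.trans ((mvfderiv_congr h2 _).trans ?_)
    exact mvfderiv_sum_smul (hgd · y hy) a _
  set v : ℝ → (ι → ℝ) →L[ℝ] E := fun t =>
    ∑ i, (ContinuousLinearMap.proj i : (ι → ℝ) →L[ℝ] ℝ).smulRight (g i (γ t)) with hv
  have hva : ∀ t b, v t b = ∑ i, b i • g i (γ t) := fun t b => by simp [hv]
  have hva' : ∀ t b, v t b = mvfderiv 𝓘(ℝ, E) φ (γ t) (∑ i, b i • V i (γ t)) := fun t b => by
    simp [hva, hg, map_sum]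
  have hrank : ∀ t ∈ Icc a' b', Module.finrank ℝ (LinearMap.range (v t : (ι → ℝ) →ₗ[ℝ] E))
      = Module.finrank ℝ (Submodule.span ℝ (range fun i => V i (γ t))) := by
    intro t ht
    have hrange : LinearMap.range (v t : (ι → ℝ) →ₗ[ℝ] E) =
        (Submodule.span ℝ (range fun i => V i (γ t))).map
          (mvfderiv 𝓘(ℝ, E) φ (γ t)).toLinearMap := by
      ext x
      simp only [LinearMap.mem_range, ContinuousLinearMap.coe_coe, Submodule.mem_map,
        Submodule.mem_span_range_iff_exists_fun]
      constructor
      · rintro ⟨a, rfl⟩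
        exact ⟨_, ⟨a, rfl⟩, (hva' t a).symm⟩
      · rintro ⟨_, ⟨a, rfl⟩, rfl⟩
        exact ⟨a, hva' t a⟩
    rw [hrange, ← LinearMap.range_domRestrict]
    refine LinearMap.finrank_range_of_inj fun x y hxy => ?_
    exact Subtype.ext (mfderiv_extChartAt_injective (hsrc t ht) hxy)
  -- The matrix of the bracket with the moving field: column `i` holds the coefficients of `[X, V
  -- i]` in the `V l`.
  set Δ : ℝ → (ι → ℝ) →L[ℝ] (ι → ℝ) := fun t => ContinuousLinearMap.pi fun l =>
    ∑ i, (∑ j, a j * δ j i l (γ t)) • (ContinuousLinearMap.proj i : (ι → ℝ) →L[ℝ] ℝ) with hΔ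
  have hγc : ContinuousOn γ (Icc a' b') := hcont.mono hsub
  have hΔc : ContinuousOn Δ (Icc a' b') := by
    refine continuousOn_clm_apply.2 fun b => continuousOn_pi.2 fun l => ?_
    simp only [hΔ, ContinuousLinearMap.coe_pi', _root_.sum_apply, _root_.smul_apply]
    refine continuousOn_finsetSum _ fun i _ => ContinuousOn.smul (f := fun t =>
      ∑ j, a j * δ j i l (γ t)) (g := fun _ => b i) ?_ continuousOn_const
    exact continuousOn_finsetSum _ fun j _ =>
      continuousOn_const.mul fun t ht =>
        (((hsrcδ t ht).2 j i).1 l).comp_continuousWithinAt (hγc t ht)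
  have hBc : ContinuousOn (fun t => fderiv ℝ h (φ (γ t))) (Icc a' b') := by
    intro t ht
    have h1 : ContinuousAt (fderiv ℝ h) (φ (γ t)) :=
      ((hhs _ (hsrc t ht)).fderiv_right (m := 0) (by simp)).continuousAt
    have h2 : ContinuousAt φ (γ t) := (contMDiffAt_extChart (hsrc t ht)).continuousAt
    exact (ContinuousAt.comp (g := fderiv ℝ h) h1 h2).comp_continuousWithinAt (hγc t ht)
  -- In the chart `X(V i) = V i(X) + [X, V i]`; the two terms on the right are `B v` and `v Δ`.
  have hvd : ∀ t ∈ Icc a' b', HasDerivWithinAt v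
      ((fderiv ℝ h (φ (γ t))).comp (v t) + (v t).comp (Δ t)) (Icc a' b') t := by
    intro t ht
    have h1 : ∀ i, HasDerivWithinAt (g i ∘ γ)
        (mvfderiv 𝓘(ℝ, E) (g i) (γ t) (∑ j, a j • V j (γ t))) (Icc a' b') t := fun i =>
      hasDerivWithinAt_comp_curve (hgd i _ (hsrc t ht)) ((hγ t (hsub ht)).mono hsub)
    have h2 : HasDerivWithinAt v (∑ i, (ContinuousLinearMap.proj i : (ι → ℝ) →L[ℝ] ℝ).smulRight
        (mvfderiv 𝓘(ℝ, E) (g i) (γ t) (∑ j, a j • V j (γ t)))) (Icc a' b') t :=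
      HasDerivWithinAt.fun_sum fun i _ =>
        (ContinuousLinearMap.smulRightL ℝ (ι → ℝ) E (ContinuousLinearMap.proj i)).hasFDerivAt
          |>.comp_hasDerivWithinAt t (h1 i)
    refine h2.congr_deriv (ContinuousLinearMap.ext fun b => ?_)
    have h3 : v t (Δ t b) = ∑ i, b i • ∑ j, a j • ∑ l, δ j i l (γ t) • g l (γ t) := by
      simp only [hva, hΔ, ContinuousLinearMap.coe_pi', _root_.sum_apply, _root_.smul_apply,
        ContinuousLinearMap.proj_apply, Finset.sum_smul, Finset.smul_sum, smul_smul, smul_eq_mul]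
      rw [Finset.sum_comm]
      refine Finset.sum_congr rfl fun i _ => ?_
      rw [Finset.sum_comm]
      refine Finset.sum_congr rfl fun j _ => Finset.sum_congr rfl fun l _ => ?_
      congr 1
      ring
    rw [_root_.add_apply, ContinuousLinearMap.comp_apply, ContinuousLinearMap.comp_apply, h3, hva,
      map_sum, ← Finset.sum_add_distrib, _root_.sum_apply]
    refine Finset.sum_congr rfl fun i _ => ?_
    rw [ContinuousLinearMap.smulRight_apply, ContinuousLinearMap.proj_apply, map_smul,
      hhB i _ (hsrc t ht), ← smul_add, map_sum, ← Finset.sum_add_distrib]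
    congr 1
    refine Finset.sum_congr rfl fun j _ => ?_
    rw [map_smul, hcomm i j _ (hsrc t ht) ((hsrcδ t ht).2 j i).2, smul_add]
  have hfin := eventually_finrank_range_eq hmem hBc hΔc hvd
  have hle : 𝓝[Icc 0 1] t₀ ≤ 𝓝[Icc a' b'] t₀ :=
    nhdsWithin_le_of_mem hnhds
  filter_upwards [hle hfin, hnhds] with t ht ht'
  rw [← hrank t ht', ← hrank t₀ hmem]
  exact ht

end RankAlongCurves

end DiracReduction

namespace DiracReduction

/-! ### Orbits that are fibres of a submersion. -/

section OrbitTheorem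

open Filter Topology Set

lemma eq_of_hasDerivWithinAt_zero {F : Type*} [NormedAddCommGroup F] [NormedSpace ℝ F]
    {f : ℝ → F} {S : Set ℝ} (hS : Convex ℝ S) (hf : ∀ t ∈ S, HasDerivWithinAt f 0 S t)
    {s t : ℝ} (hs : s ∈ S) (ht : t ∈ S) : f t = f s := by
  have h := hS.norm_image_sub_le_of_norm_hasDerivWithin_le hf (C := 0) (by simp) hs ht
  rw [zero_mul] at h
  exact sub_eq_zero.1 (norm_le_zero_iff.1 h)

lemma eventually_eq_of_hasDerivWithinAt_zero {F : Type*} [NormedAddCommGroup F] [NormedSpace ℝ F]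
    {f : ℝ → F} {S : Set ℝ} (hS : Convex ℝ S) {t₀ : ℝ} (ht₀ : t₀ ∈ S)
    (hf : ∀ᶠ t in 𝓝[S] t₀, HasDerivWithinAt f 0 S t) : ∀ᶠ t in 𝓝[S] t₀, f t = f t₀ := by
  obtain ⟨ε, hε, h⟩ := Metric.mem_nhdsWithin_iff.1 hf
  refine Metric.mem_nhdsWithin_iff.2 ⟨ε, hε, fun t ht => ?_⟩
  exact eq_of_hasDerivWithinAt_zero ((convex_ball t₀ ε).inter hS)
    (fun s hs => (h hs).mono inter_subset_right) ⟨Metric.mem_ball_self hε, ht₀⟩ ht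

variable {E : Type*} [NormedAddCommGroup E] [NormedSpace ℝ E]
  {C : Type*} [TopologicalSpace C] [ChartedSpace E C]

/-- `c'` is reached from `c` along an integral curve of a combination of the vector fields `V`. -/
def CurveStep {ι : Type*} [Fintype ι] (V : ι → VField E C) (c c' : C) : Prop :=
  ∃ a : ι → ℝ, ∃ γ : ℝ → C,
    IsMIntegralCurveOn (I := 𝓘(ℝ, E)) γ (fun c => ∑ i, a i • V i c) (Icc 0 1) ∧ γ 0 = c ∧ γ 1 = c'

/-- A linear change of time rescales the coefficients, so every point of an integral curve, at
positive or negative time, is reached in unit time. -/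
lemma IsMIntegralCurveOn.curveStep {ι : Type*} [Fintype ι] {V : ι → VField E C} {a : ι → ℝ}
    {γ : ℝ → C} {S : Set ℝ}
    (hγ : IsMIntegralCurveOn (I := 𝓘(ℝ, E)) γ (fun c => ∑ i, a i • V i c) S) {s : ℝ}
    (hs : ∀ t ∈ Icc (0 : ℝ) 1, t * s ∈ S) : CurveStep V (γ 0) (γ s) := by
  refine ⟨s • a, γ ∘ (· * s), ?_, by simp, by simp⟩
  have h := (hγ.comp_mul s).mono hs
  have h2 : (s • fun c => ∑ i, a i • V i c : VField E C) = fun c => ∑ i, (s • a) i • V i c := by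
    funext c
    simp [Finset.smul_sum, smul_smul]
  rw [h2] at h
  exact h

variable [FiniteDimensional ℝ E] [IsManifold 𝓘(ℝ, E) ∞ C]
  {EQ : Type*} [NormedAddCommGroup EQ] [NormedSpace ℝ EQ]
  {Q : Type*} [TopologicalSpace Q] [ChartedSpace EQ Q]

/-- `p` is constant along the integral curve of `V i` through `c`, whose velocity at `c` is `V i c`.
-/
lemma mfderiv_eq_zero_of_curveStep {ι : Type*} [Fintype ι] {V : ι → VField E C}
    (hV : ∀ i, SmoothVF E (V i)) {p : C → Q} (hp : MDifferentiable 𝓘(ℝ, E) 𝓘(ℝ, EQ) p)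
    (hstep : ∀ c c', CurveStep V c c' → p c = p c') (i : ι) (c : C) :
    mfderiv 𝓘(ℝ, E) 𝓘(ℝ, EQ) p c (V i c) = 0 := by
  classical
  have := FiniteDimensional.complete ℝ E
  obtain ⟨γ, rfl, hγ⟩ := exists_isMIntegralCurveAt_of_contMDiffAt_boundaryless (t₀ := 0)
    (I := 𝓘(ℝ, E)) (v := V i) ((hV i c).of_le (m := 1) (WithTop.coe_le_coe.2 le_top))
  have hd := hγ.hasMFDerivAt
  obtain ⟨ε, hε, hball⟩ := isMIntegralCurveAt_iff'.1 hγ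
  have h0 : (fun c => ∑ j, (Pi.single i 1 : ι → ℝ) j • V j c) = V i := by
    funext c
    simp [Pi.single_apply]
  rw [← h0] at hball
  have hconst : p ∘ γ =ᶠ[𝓝 0] fun _ => p (γ 0) := by
    filter_upwards [Metric.ball_mem_nhds (0 : ℝ) hε] with s hs
    refine (hstep _ _ (IsMIntegralCurveOn.curveStep hball fun t ht => ?_)).symm
    rw [mem_ball_zero_iff] at hs ⊢
    rw [norm_mul]
    refine lt_of_le_of_lt (mul_le_of_le_one_left (norm_nonneg _) ?_) hs
    rw [Real.norm_eq_abs, abs_le]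
    exact ⟨by linarith [ht.1], ht.2⟩
  have h1 := ((hp (γ 0)).hasMFDerivAt.comp 0 hd).congr_of_eventuallyEq hconst.symm
  have h2 := DFunLike.congr_fun (hasMFDerivAt_unique h1 (hasMFDerivAt_const (p (γ 0)) (0 : ℝ)))
    (1 : ℝ)
  refine Eq.trans ?_ h2
  exact congrArg (mfderiv 𝓘(ℝ, E) 𝓘(ℝ, EQ) p (γ 0)) (one_smul ℝ (V i (γ 0))).symm

/-- If the fibres of a submersion are the orbits of a finite family of vector fields in involution,
then the family spans the tangent spaces of the fibres. -/
theorem span_eq_ker_of_orbits [SecondCountableTopology C] {ι : Type*} [Fintype ι]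
    {V : ι → VField E C}
    (hV : ∀ i, SmoothVF E (V i))
    (hbr : ∀ i j c₀, ∃ δ : ι → C → ℝ, ∀ᶠ c in 𝓝 c₀,
      (∀ l, ContinuousAt (δ l) c) ∧ lieBr E (V i) (V j) c = ∑ l, δ l c • V l c) {p : C → Q}
    (hp : Manifold.IsSubmersion 𝓘(ℝ, E) 𝓘(ℝ, EQ) ∞ p)
    (horb : ∀ c c', p c = p c' ↔ Relation.EqvGen (CurveStep V) c c') (c₀ : C) :
    Submodule.span ℝ (range fun i => V i c₀)
      = LinearMap.ker (mfderiv 𝓘(ℝ, E) 𝓘(ℝ, EQ) p c₀).toLinearMap := by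
  have hps : ContMDiff 𝓘(ℝ, E) 𝓘(ℝ, EQ) ∞ p := hp.contMDiff
  have hstep : ∀ c c', CurveStep V c c' → p c = p c' := fun c c' h =>
    (horb c c').2 (Relation.EqvGen.rel _ _ h)
  have htan := mfderiv_eq_zero_of_curveStep hV (hps.mdifferentiable (by simp)) hstep
  have hle : Submodule.span ℝ (range fun i => V i c₀)
      ≤ LinearMap.ker (mfderiv 𝓘(ℝ, E) 𝓘(ℝ, EQ) p c₀).toLinearMap := by
    rw [Submodule.span_le]
    rintro _ ⟨i, rfl⟩
    exact htan i c₀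
  refine Submodule.eq_of_le_of_finrank_le hle ?_
  -- If the inclusion were strict, the fibre would be foliated by leaves of positive codimension,
  -- yet it is a single orbit; counting the plaques in one box gives the contradiction.
  by_contra! hlt
  have : SecondCountableTopology {y // p y = p c₀} :=
    TopologicalSpace.Subtype.secondCountableTopology {y | p y = p c₀}
  have hrk : ∀ y z, Relation.EqvGen (CurveStep V) y z →
      Module.finrank ℝ (Submodule.span ℝ (range fun i => V i y))
        = Module.finrank ℝ (Submodule.span ℝ (range fun i => V i z)) := by
    intro y z h
    induction h with
    | rel y z h =>
      obtain ⟨a, γ, hγ, rfl, rfl⟩ := h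
      exact finrank_span_eq_of_integralCurve hV hbr hγ
    | refl => rfl
    | symm _ _ _ h => exact h.symm
    | trans _ _ _ _ _ h h' => exact h.trans h'
  have hbr' : ∀ i j c, lieBr E (V i) (V j) c ∈ Submodule.span ℝ (range fun l => V l c) := by
    intro i j c
    obtain ⟨δ, hδ⟩ := hbr i j c
    rw [hδ.self_of_nhds.2]
    exact Submodule.sum_mem _ fun l _ => Submodule.smul_mem _ _ (Submodule.subset_span ⟨l, rfl⟩)
  choose O τ hO hmem h1 h2 h3 using fun y : {y // p y = p c₀} => exists_leafChart hV hbr' hps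
    (hp.isSubmersionAt y.1) htan (r := Module.finrank ℝ (Submodule.span ℝ (range fun i => V i c₀)))
    fun z hz => hrk _ _ ((horb _ _).1 (hz.trans y.2))
  obtain ⟨S, hS0, hScount, hScurve⟩ := exists_countable_plaque_saturation
    (fun y : {y // p y = p c₀} => Subtype.val ⁻¹' O y)
    (fun y => continuous_subtype_val.continuousAt ((hO y).mem_nhds (hmem y)))
    (fun y => (hO y).preimage continuous_subtype_val) (fun i z => τ i z.1)
    (by
      -- Two nearby points on one plaque of box `i` are joined by a tangent curve inside box `j`,
      -- and `τ j` is constant along it.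
      rintro i j z hzi hzj
      obtain ⟨N, hN, hNw⟩ := h2 i z.1 hzi (z.2.trans i.2.symm) (O j) ((hO j).mem_nhds hzj)
      refine ⟨Subtype.val ⁻¹' N, continuous_subtype_val.continuousAt hN, fun a ha b hb hab => ?_⟩
      obtain ⟨w, hw0, hw1, hw⟩ := hNw a.1 ha b.1 hb (a.2.trans i.2.symm) (b.2.trans i.2.symm) hab
      have h := eq_of_hasDerivWithinAt_zero (f := τ j ∘ w) (convex_Icc (0 : ℝ) 1) (fun t ht => by
        obtain ⟨hwO, hwp, α, hα⟩ := hw t ht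
        exact h1 j w _ t α hwO (hwp.trans (i.2.trans j.2.symm)) hα)
        (right_mem_Icc.2 zero_le_one) (left_mem_Icc.2 zero_le_one)
      simpa [hw0, hw1] using h) ⟨c₀, rfl⟩
  have hSall : ∀ y z, Relation.EqvGen (CurveStep V) y z →
      ((∃ h : p y = p c₀, ⟨y, h⟩ ∈ S) ↔ ∃ h : p z = p c₀, ⟨z, h⟩ ∈ S) := by
    intro y z h
    induction h with
    | rel y z h =>
      have hyz := hstep y z h
      obtain ⟨a, γ, hγ, rfl, rfl⟩ := h
      by_cases hy : p (γ 0) = p c₀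
      swap
      · simp only [← hyz, hy, IsEmpty.exists_iff]
      have hγp : ∀ t ∈ Icc (0 : ℝ) 1, p (γ t) = p c₀ := fun t ht => by
        rw [← hy]
        refine (hstep _ _ (IsMIntegralCurveOn.curveStep hγ fun s hs => ?_)).symm
        exact ⟨mul_nonneg hs.1 ht.1, mul_le_one₀ hs.2 ht.1 ht.2⟩
      classical
      -- The curve as a map into the fibre; `c₀` is a default value for times at which `γ` is not in
      -- the fibre, none of which lie in `[0, 1]`.
      set γ' : ℝ → {y // p y = p c₀} := fun t => if h : p (γ t) = p c₀ then ⟨γ t, h⟩ else ⟨c₀, rfl⟩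
        with hγ'
      have hγ't : ∀ t, ∀ ht : t ∈ Icc (0 : ℝ) 1, γ' t = ⟨γ t, hγp t ht⟩ := fun t ht =>
        dif_pos (hγp t ht)
      have h := hScurve γ' (by
        refine Topology.IsInducing.subtypeVal.continuousOn_iff.2 ?_
        exact hγ.continuousOn.congr fun t ht => by rw [Function.comp_apply, hγ't t ht])
        (by
          intro t₀ ht₀ i hi
          rw [hγ't t₀ ht₀] at hi
          have h5 : ∀ᶠ t in 𝓝[Icc 0 1] t₀, HasDerivWithinAt (τ i ∘ γ) 0 (Icc 0 1) t := by
            filter_upwards [hγ.continuousOn t₀ ht₀ ((hO i).mem_nhds hi), self_mem_nhdsWithin]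
              with t ht ht'
            exact h1 i γ _ t a ht ((hγp t ht').trans i.2.symm) (hγ t ht')
          filter_upwards [eventually_eq_of_hasDerivWithinAt_zero (convex_Icc (0 : ℝ) 1) ht₀ h5,
            self_mem_nhdsWithin] with t ht ht'
          rw [hγ't t ht', hγ't t₀ ht₀]
          exact ht)
      rw [hγ't 0 (left_mem_Icc.2 zero_le_one), hγ't 1 (right_mem_Icc.2 zero_le_one)] at h
      constructor
      · rintro ⟨_, h'⟩
        exact ⟨_, h.1 h'⟩
      · rintro ⟨_, h'⟩
        exact ⟨_, h.2 h'⟩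
    | refl => rfl
    | symm _ _ _ h => exact h.symm
    | trans _ _ _ _ _ h h' => exact h.trans h'
  -- `S` is invariant under steps and contains `c₀`, so it is the whole fibre, and the box at `c₀`
  -- would have only countably many plaques.
  refine h3 ⟨c₀, rfl⟩ hlt ((hScount ⟨c₀, rfl⟩).mono ?_)
  rintro _ ⟨y, ⟨hyO, hyp⟩, rfl⟩
  obtain ⟨_, hyS⟩ := (hSall c₀ y ((horb _ _).1 hyp.symm)).1 ⟨rfl, hS0⟩
  exact ⟨⟨y, hyp⟩, ⟨hyS, hyO⟩, rfl⟩

end OrbitTheorem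

end DiracReduction

namespace DiracReduction

/-! ### Frames of sections, and sections with prescribed image. -/

section Sections

open Filter Topology Set

lemma exists_linearIndependent_mem {V : Type*} [AddCommGroup V] [Module ℝ V]
    [FiniteDimensional ℝ V] {L : Submodule ℝ V} {d : ℕ} (h : Module.finrank ℝ L = d) :
    ∃ v : Fin d → V, LinearIndependent ℝ v ∧ ∀ i, v i ∈ L := by
  let B := Module.finBasisOfFinrankEq ℝ L h
  exact ⟨fun i => B i, B.linearIndependent.map' L.subtype L.ker_subtype, fun i => (B i).2⟩

lemma span_eq_of_linearIndependent {V : Type*} [AddCommGroup V] [Module ℝ V]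
    [FiniteDimensional ℝ V] {L : Submodule ℝ V} {d : ℕ} (h : Module.finrank ℝ L = d)
    {v : Fin d → V} (hv : LinearIndependent ℝ v) (hvL : ∀ i, v i ∈ L) :
    Submodule.span ℝ (range v) = L := by
  refine Submodule.eq_of_le_of_finrank_eq (Submodule.span_le.2 ?_) ?_
  · rintro _ ⟨i, rfl⟩
    exact hvL i
  · rw [finrank_span_eq_card hv, h, Fintype.card_fin]

variable {E : Type*} [NormedAddCommGroup E] [NormedSpace ℝ E]
  {M : Type*} [TopologicalSpace M] [ChartedSpace E M] [IsManifold 𝓘(ℝ, E) ∞ M]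

lemma SmoothOneForm.apply {α : ∀ p : M, Cotangent E p} (hα : SmoothOneForm E α) {X : VField E M}
    (hX : SmoothVF E X) : ContMDiff 𝓘(ℝ, E) 𝓘(ℝ) ∞ (fun q => α q (X q)) := fun p =>
  SmoothOneFormAt.apply (hα p) (hX p)

variable [FiniteDimensional ℝ E] [T2Space M]

lemma smoothOneForm_of_apply {α : ∀ p : M, Cotangent E p}
    (h : ∀ Z : VField E M, SmoothVF E Z → ContMDiff 𝓘(ℝ, E) 𝓘(ℝ) ∞ (fun q => α q (Z q))) :
    SmoothOneForm E α := fun p => smoothOneFormAt_iff.2 fun Z hZ => h Z hZ p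

lemma IsSectionOf.sum_smul {L : GenSubspace E M} {ι : Type*} [Fintype ι] {u : ι → M → ℝ}
    {e : ι → GenSection E M} (hu : ∀ i, ContMDiff 𝓘(ℝ, E) 𝓘(ℝ) ∞ (u i))
    (he : ∀ i, IsSectionOf E L (e i)) : IsSectionOf E L (fun q => ∑ i, u i q • e i q) := by
  refine ⟨⟨?_, smoothOneForm_of_apply fun Z hZ => ?_⟩, fun q =>
    Submodule.sum_mem _ fun i _ => Submodule.smul_mem _ _ ((he i).2 q)⟩
  · have h : (fun q => (∑ i, u i q • e i q).1 : VField E M) = fun q => ∑ i, u i q • (e i q).1 := by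
      funext q
      simp [Prod.fst_sum]
    rw [h]
    exact fun q => SmoothVFAt.sum_smul (fun i => hu i q) fun i => (he i).1.1 q
  · have h : (fun q => (∑ i, u i q • e i q).2 (Z q)) = fun q => ∑ i, u i q • (e i q).2 (Z q) := by
      funext q
      simp [Prod.snd_sum]
    rw [h]
    exact ContMDiff.sum fun i _ => (hu i).smul ((he i).1.2.apply hZ)

/-- With global objects that are coordinates near `p`, vectors and covectors at nearby points are
compared through finitely many smooth functions. -/
lemma exists_coordinate_frame (p : M) {ι : Type*} [Fintype ι] (b : Module.Basis ι ℝ E) :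
    ∃ (χ : M → E) (Z : ι → VField E M), ContMDiff 𝓘(ℝ, E) 𝓘(ℝ, E) ∞ χ ∧
      (∀ i, SmoothVF E (Z i)) ∧ ∀ᶠ q in 𝓝 p,
        Function.Injective (mvfderiv 𝓘(ℝ, E) χ q) ∧
        ∀ w : TangentSpace 𝓘(ℝ, E) q, w = ∑ i, b.coord i (mvfderiv 𝓘(ℝ, E) χ q w) • Z i q := by
  obtain ⟨χ, hχ, hχe⟩ := exists_global_chart (E := E) p
  obtain ⟨Z, hZ, hZe⟩ := exists_coordinate_fields (E := E) p
  refine ⟨χ, fun i => Z (b i), hχ, fun i => hZ _, ?_⟩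
  filter_upwards [hχe.eventually_nhds, hZe,
    (chartAt E p).open_source.mem_nhds (mem_chart_source E p)] with q h1 h2 h3
  have h4 : ∀ w, mvfderiv 𝓘(ℝ, E) χ q w = mvfderiv 𝓘(ℝ, E) (extChartAt 𝓘(ℝ, E) p) q w :=
    mvfderiv_congr h1
  have hinj : Function.Injective (mvfderiv 𝓘(ℝ, E) χ q) := fun w w' h => by
    rw [h4, h4] at h
    exact mfderiv_extChartAt_injective h3 h
  refine ⟨hinj, fun w => hinj ?_⟩
  rw [map_sum]
  have h5 : ∀ i, mvfderiv 𝓘(ℝ, E) χ q (b.coord i (mvfderiv 𝓘(ℝ, E) χ q w) • Z (b i) q)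
      = b.repr (mvfderiv 𝓘(ℝ, E) χ q w) i • b i := fun i => by
    rw [map_smul, h4 (Z (b i) q), h2]
    rfl
  rw [Finset.sum_congr rfl fun i _ => h5 i]
  exact (b.sum_repr _).symm

/-- A Dirac structure has local frames of global sections. -/
lemma exists_section_frame {L : GenSubspace E M}
    (hrank : ∀ p, Module.finrank ℝ (L p) = Module.finrank ℝ E)
    (hsmooth : ∀ p, ∀ v ∈ L p, ∃ e : GenSection E M, IsSectionOf E L e ∧ e p = v) (p : M) :
    ∃ e : Fin (Module.finrank ℝ E) → GenSection E M, (∀ i, IsSectionOf E L (e i)) ∧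
      ∀ᶠ q in 𝓝 p, LinearIndependent ℝ (fun i => e i q) ∧
        Submodule.span ℝ (range fun i => e i q) = L q := by
  obtain ⟨v, hv, hvL⟩ := exists_linearIndependent_mem (hrank p)
  choose e he hep using fun i => hsmooth p _ (hvL i)
  refine ⟨e, he, ?_⟩
  let b := Module.finBasis ℝ E
  obtain ⟨χ, Z, hχ, hZ, hfr⟩ := exists_coordinate_frame (E := E) p b
  -- `m` maps the varying fibres into one fixed space, injectively at `p`. There linear independence
  -- is an open condition, so it spreads from `p` to nearby points.
  let m : ∀ q : M, GenTangent E q →ₗ[ℝ] E × (Fin (Module.finrank ℝ E) → ℝ) := fun q =>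
    LinearMap.prodMap (mvfderiv 𝓘(ℝ, E) χ q).toLinearMap
      (LinearMap.pi fun i => (LinearMap.applyₗ (Z i q)).comp (ContinuousLinearMap.coeLM ℝ))
  have hm : ∀ q v, m q v = (mvfderiv 𝓘(ℝ, E) χ q v.1, fun i => v.2 (Z i q)) := fun q v => rfl
  have hinj : Function.Injective (m p) := by
    obtain ⟨h1, h2⟩ := hfr.self_of_nhds
    rintro ⟨X, α⟩ ⟨Y, β⟩ h
    rw [hm, hm, Prod.mk.injEq] at h
    refine Prod.ext (h1 h.1) (ContinuousLinearMap.ext fun w => ?_)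
    change α w = β w
    rw [h2 w, map_sum, map_sum]
    refine Finset.sum_congr rfl fun i _ => ?_
    rw [map_smul, map_smul]
    congr 1
    exact congrFun h.2 i
  have hcont : ContinuousAt (fun q => fun i => m q (e i q)) p := by
    refine continuousAt_pi.2 fun i => ?_
    simp only [hm]
    exact (SmoothVFAt.mvfderiv_apply ((he i).1.1 p) (hχ p)).continuousAt.prodMk
      (continuousAt_pi.2 fun k => ((he i).1.2.apply (hZ k) p).continuousAt)
  have hli : LinearIndependent ℝ (fun i => m p (e i p)) := by
    simp only [hep]
    exact hv.map' (m p) (LinearMap.ker_eq_bot.2 hinj)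
  filter_upwards [hcont.tendsto.eventually hli.eventually] with q hq
  have hq' : LinearIndependent ℝ fun i => e i q := LinearIndependent.of_comp (m q) hq
  exact ⟨hq', span_eq_of_linearIndependent (hrank q) hq' fun i => (he i).2 q⟩

variable {EC : Type*} [NormedAddCommGroup EC] [NormedSpace ℝ EC] 
  {C : Type*} [TopologicalSpace C] [ChartedSpace EC C] [IsManifold 𝓘(ℝ, EC) ∞ C]

variable [FiniteDimensional ℝ EC] [T2Space C] in
/-- Sections of a Dirac structure with prescribed image, along a map, under linear maps of constant
rank. -/
theorem exists_section_lift {L : GenSubspace E M}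
    (hrank : ∀ p, Module.finrank ℝ (L p) = Module.finrank ℝ E)
    (hsmooth : ∀ p, ∀ v ∈ L p, ∃ e : GenSection E M, IsSectionOf E L e ∧ e p = v)
    {j : C → M} {c : C} (hj : ContinuousAt j c)
    (hext : ∀ u : C → ℝ, ContMDiff 𝓘(ℝ, EC) 𝓘(ℝ) ∞ u → ∃ u' : M → ℝ,
      ContMDiff 𝓘(ℝ, E) 𝓘(ℝ) ∞ u' ∧ ∀ᶠ q in 𝓝 c, u' (j q) = u q)
    {H : Type*} [NormedAddCommGroup H] [NormedSpace ℝ H] [FiniteDimensional ℝ H]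
    (Θ : ∀ q, GenTangent E (j q) →ₗ[ℝ] H)
    (hΘ : ∀ e, SmoothSection E e →
      ∀ᶠ q in 𝓝 c, ContMDiffAt 𝓘(ℝ, EC) 𝓘(ℝ, H) ∞ (fun q => Θ q (e (j q))) q)
    {b : C → H} (hb : ∀ᶠ q in 𝓝 c, ContMDiffAt 𝓘(ℝ, EC) 𝓘(ℝ, H) ∞ b q) {r : ℕ}
    (hr : ∀ᶠ q in 𝓝 c, Module.finrank ℝ ((L (j q)).map (Θ q)) = r)
    (hm : ∀ᶠ q in 𝓝 c, b q ∈ (L (j q)).map (Θ q))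
    {v₀ : GenTangent E (j c)} (hv₀ : v₀ ∈ L (j c)) (hΘv₀ : Θ c v₀ = b c) :
    ∃ e : GenSection E M, IsSectionOf E L e ∧ e (j c) = v₀ ∧
      ∀ᶠ q in 𝓝 c, Θ q (e (j q)) = b q := by
  obtain ⟨e, he, hfr⟩ := exists_section_frame hrank hsmooth (j c)
  have hfr' := hj.eventually hfr
  have hspan : ∀ᶠ q in 𝓝 c,
      Submodule.span ℝ (range fun i => Θ q (e i (j q))) = (L (j q)).map (Θ q) := by
    filter_upwards [hfr'] with q hq
    rw [← hq.2, Submodule.map_span, ← range_comp]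
    rfl
  rw [← hfr.self_of_nhds.2] at hv₀
  obtain ⟨u₀, rfl⟩ := (Submodule.mem_span_range_iff_exists_fun ℝ).1 hv₀
  -- The coefficients in a frame of `L` are solved for on `C`, with the prescribed value at `c`, and
  -- afterwards extended to `M`.
  obtain ⟨u, hu, hu0, hue⟩ := exists_global_lift (a := fun i q => Θ q (e i (j q))) (b := b) (p := c)
    (r := r) (fun i => hΘ (e i) (he i).1) hb
    (by filter_upwards [hspan, hr] with q h1 h2 using by rw [h1, h2])
    (by filter_upwards [hspan, hm] with q h1 h2 using by rwa [h1])
    (u₀ := u₀) (by rw [← hΘv₀, map_sum]; simp)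
  choose u' hu' hu'e using fun i => hext (u i) (hu i)
  refine ⟨_, IsSectionOf.sum_smul hu' he, ?_, ?_⟩
  · refine Finset.sum_congr rfl fun i _ => ?_
    rw [(hu'e i).self_of_nhds, hu0]
  · filter_upwards [hue, eventually_all.2 hu'e] with q h1 h2
    rw [← h1, map_sum]
    refine Finset.sum_congr rfl fun i _ => ?_
    rw [map_smul, h2]

/-- A vector field on an immersed manifold extends locally. -/
lemma exists_related_vf {j : C → M} (hj : ContMDiff 𝓘(ℝ, EC) 𝓘(ℝ, E) ∞ j) {c : C}
    (hc : Manifold.IsImmersionAt 𝓘(ℝ, EC) 𝓘(ℝ, E) ∞ j c) {Z : VField EC C} (hZ : SmoothVF EC Z) :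
    ∃ Z' : VField E M, SmoothVF E Z' ∧
      ∀ᶠ q in 𝓝 c, mfderiv 𝓘(ℝ, EC) 𝓘(ℝ, E) j q (Z q) = Z' (j q) := by
  let b := Module.finBasis ℝ E
  obtain ⟨χ, W, hχ, hW, hfr⟩ := exists_coordinate_frame (E := E) (j c) b
  have hu : ∀ i, ContMDiff 𝓘(ℝ, EC) 𝓘(ℝ) ∞
      (fun q => b.coord i (mvfderiv 𝓘(ℝ, EC) (χ ∘ j) q (Z q))) := fun i q =>
    (b.coord i).toContinuousLinearMap.contMDiff.contMDiffAt.comp q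
      (SmoothVFAt.mvfderiv_apply (hZ q) ((hχ.comp hj) q))
  choose u' hu' hu'e using fun i => exists_extension_of_immersion hc (hu i)
  refine ⟨fun q => ∑ i, u' i q • W i q, fun q =>
    SmoothVFAt.sum_smul (fun i => hu' i q) fun i => hW i q, ?_⟩
  filter_upwards [eventually_all.2 hu'e, hj.continuous.continuousAt.eventually hfr] with q h1 h2
  refine (h2.2 _).trans (Finset.sum_congr rfl fun i _ => ?_)
  rw [h1, mvfderiv_comp_apply' (E := E) q ((hχ _).mdifferentiableAt (by simp))
    ((hj q).mdifferentiableAt (by simp))]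

lemma SmoothOneForm.pullback_apply {j : C → M} (hj : ContMDiff 𝓘(ℝ, EC) 𝓘(ℝ, E) ∞ j)
    (hc : ∀ c, Manifold.IsImmersionAt 𝓘(ℝ, EC) 𝓘(ℝ, E) ∞ j c) {α : ∀ p : M, Cotangent E p}
    (hα : SmoothOneForm E α) {Z : VField EC C} (hZ : SmoothVF EC Z) :
    ContMDiff 𝓘(ℝ, EC) 𝓘(ℝ) ∞
      (fun q => α (j q) (mfderiv 𝓘(ℝ, EC) 𝓘(ℝ, E) j q (Z q))) := by
  intro c
  obtain ⟨Z', hZ', h⟩ := exists_related_vf hj (hc c) hZ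
  refine ContMDiffAt.congr_of_eventuallyEq (((hα.apply hZ').comp hj) c) ?_
  filter_upwards [h] with q hq
  rw [hq]
  rfl

end Sections

end DiracReduction

namespace DiracReduction

/-! ### Rank formulas. -/

section LinearAlgebra

variable {V : Type*} [AddCommGroup V] [Module ℝ V] [FiniteDimensional ℝ V]
  {H : Type*} [AddCommGroup H] [Module ℝ H]

lemma finrank_map_add_finrank_inf_ker (f : V →ₗ[ℝ] H) (L : Submodule ℝ V) :
    Module.finrank ℝ (L.map f) + Module.finrank ℝ (L ⊓ LinearMap.ker f : Submodule ℝ V)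
      = Module.finrank ℝ L := by
  have h := LinearMap.finrank_range_add_finrank_ker (f.domRestrict L)
  rw [LinearMap.range_domRestrict] at h
  have h2 : (LinearMap.ker (f.domRestrict L)).map L.subtype = L ⊓ LinearMap.ker f := by
    ext x
    simp [and_comm]
  rw [← h2, Submodule.finrank_map_subtype_eq]
  exact h

lemma finrank_map_of_injective {V : Type*} [AddCommGroup V] [Module ℝ V] {f : V →ₗ[ℝ] H}
    (hf : Function.Injective f) (L : Submodule ℝ V) :
    Module.finrank ℝ (L.map f) = Module.finrank ℝ L :=
  (L.equivMapOfInjective f hf).finrank_eq.symm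

end LinearAlgebra

section LinearAlgebraTop

variable {V : Type*} [AddCommGroup V] [Module ℝ V] [TopologicalSpace V]
  {W : Type*} [AddCommGroup W] [Module ℝ W] [TopologicalSpace W] [IsTopologicalAddGroup W]
  [ContinuousSMul ℝ W] [T2Space W] [FiniteDimensional ℝ W]

lemma exists_factor_of_surjective {f : V →L[ℝ] W} (hf : Function.Surjective f) {β : V →L[ℝ] ℝ}
    (hβ : ∀ v, f v = 0 → β v = 0) : ∃ ξ : W →L[ℝ] ℝ, β = ξ.comp f := by
  obtain ⟨s, hs⟩ := f.toLinearMap.exists_rightInverse_of_surjective (LinearMap.range_eq_top.2 hf)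
  refine ⟨((β : V →ₗ[ℝ] ℝ).comp s).toContinuousLinearMap, ContinuousLinearMap.ext fun v => ?_⟩
  have h1 : f (s (f v)) = f v := LinearMap.congr_fun hs (f v)
  have h2 : β (v - s (f v)) = 0 := hβ _ (by rw [map_sub, h1, sub_self])
  rw [map_sub, sub_eq_zero] at h2
  exact h2

lemma finrank_add_finrank_annihilator (S : Submodule ℝ W) {A : Submodule ℝ (W →L[ℝ] ℝ)}
    (hA : ∀ ξ, ξ ∈ A ↔ ∀ w ∈ S, ξ w = 0) :
    Module.finrank ℝ S + Module.finrank ℝ A = Module.finrank ℝ W := by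
  have h1 : A.map (LinearMap.toContinuousLinearMap (𝕜 := ℝ) (E := W) (F' := ℝ)).symm.toLinearMap
      = S.dualAnnihilator := by
    ext f
    rw [Submodule.mem_dualAnnihilator]
    constructor
    · rintro ⟨ξ, hξ, rfl⟩ w hw
      exact (hA ξ).1 hξ w hw
    · intro h
      exact ⟨LinearMap.toContinuousLinearMap f, (hA _).2 h, rfl⟩
  rw [← Subspace.finrank_add_finrank_dualAnnihilator_eq S, ← h1, LinearEquiv.finrank_map_eq]

end LinearAlgebraTop

/-! ### Pull-back of a Dirac structure to a level set. -/

section PullBack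

open Filter Topology Set

variable {E : Type*} [NormedAddCommGroup E] [NormedSpace ℝ E] [FiniteDimensional ℝ E]
  {M : Type*} [TopologicalSpace M] [ChartedSpace E M] [IsManifold 𝓘(ℝ, E) ∞ M] [T2Space M]
  {EC : Type*} [NormedAddCommGroup EC] [NormedSpace ℝ EC] [FiniteDimensional ℝ EC]
  {C : Type*} [TopologicalSpace C] [ChartedSpace EC C] [IsManifold 𝓘(ℝ, EC) ∞ C]

/-- Sections of `TC ⊕ T^*C` and `TM ⊕ T^*M` which are related by `j : C → M` near `c`. -/
def RelatedAt (j : C → M) (c : C) (e' : GenSection EC C) (e : GenSection E M) : Prop :=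
  ∀ᶠ q in 𝓝 c, diff EC E j q (e' q).1 = (e (j q)).1 ∧ (e' q).2 = (e (j q)).2.comp (diff EC E j q)

/-- The Courant bracket is natural with respect to immersions. -/
lemma IsCourantBracket.related {φ : ThreeForm E M} {e₁ e₂ e₃ : GenSection E M}
    (hbr : IsCourantBracket E φ e₁ e₂ e₃) (he₁ : SmoothSection E e₁) (he₂ : SmoothSection E e₂)
    {j : C → M} (hj : ContMDiff 𝓘(ℝ, EC) 𝓘(ℝ, E) ∞ j) {c : C}
    (hc : Manifold.IsImmersionAt 𝓘(ℝ, EC) 𝓘(ℝ, E) ∞ j c) {e₁' e₂' : GenSection EC C}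
    (h₁ : RelatedAt j c e₁' e₁) (h₂ : RelatedAt j c e₂' e₂) :
    diff EC E j c (lieBr EC (fun q => (e₁' q).1) (fun q => (e₂' q).1) c) = (e₃ (j c)).1 ∧
      ∀ Z : VField EC C, SmoothVF EC Z → (e₃ (j c)).2 (diff EC E j c (Z c))
        = lieDerivOneForm EC (fun q => (e₁' q).1) (fun q => (e₂' q).2) Z c
          - extDerivOne EC (fun q => (e₁' q).2) (fun q => (e₂' q).1) Z c
          + φ (j c) ![(e₁ (j c)).1, (e₂ (j c)).1, diff EC E j c (Z c)] := by
  have := FiniteDimensional.complete ℝ E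
  have := FiniteDimensional.complete ℝ EC
  have hs₁ : SmoothVFAt (fun q => (e₁' q).1) c :=
    smoothVFAt_of_related hj hc (he₁.1 (j c)) (h₁.mono fun q hq => hq.1)
  have hs₂ : SmoothVFAt (fun q => (e₂' q).1) c :=
    smoothVFAt_of_related hj hc (he₂.1 (j c)) (h₂.mono fun q hq => hq.1)
  have hr₁ : ∀ᶠ q in 𝓝 c, mfderiv 𝓘(ℝ, EC) 𝓘(ℝ, E) j q (e₁' q).1 = (e₁ (j q)).1 :=
    h₁.mono fun q hq => hq.1
  have hr₂ : ∀ᶠ q in 𝓝 c, mfderiv 𝓘(ℝ, EC) 𝓘(ℝ, E) j q (e₂' q).1 = (e₂ (j q)).1 :=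
    h₂.mono fun q hq => hq.1
  refine ⟨?_, fun Z hZ => ?_⟩
  · rw [hbr.1]
    exact mfderiv_lieBr_of_related hj hs₁ hs₂ (he₁.1 _) (he₂.1 _) hr₁ hr₂
  obtain ⟨Z', hZ', hZr⟩ := exists_related_vf hj hc hZ
  have hjd : MDifferentiableAt 𝓘(ℝ, EC) 𝓘(ℝ, E) j c := (hj c).mdifferentiableAt (by simp)
  -- Every term of the bracket formula is a derivative of a function along a field or a covector
  -- evaluated on a Lie bracket; both are preserved by related data.
  have hdir : ∀ (X' : VField EC C) (X : VField E M) (f' : C → ℝ) (f : M → ℝ),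
      mfderiv 𝓘(ℝ, EC) 𝓘(ℝ, E) j c (X' c) = X (j c) → (∀ᶠ q in 𝓝 c, f (j q) = f' q) →
      ContMDiff 𝓘(ℝ, E) 𝓘(ℝ) ∞ f → dirDeriv E X f (j c) = dirDeriv EC X' f' c := by
    intro X' X f' f hX hf hfs
    rw [dirDeriv, ← hX, ← mvfderiv_comp_apply' (E := E) c ((hfs _).mdifferentiableAt (by simp)) hjd]
    exact mvfderiv_congr hf _
  have hZc := hZr.self_of_nhds
  rw [show diff EC E j c (Z c) = Z' (j c) from hZc, hbr.2 Z' hZ' (j c)]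
  have t1 : dirDeriv E (fun q => (e₁ q).1) (fun q => (e₂ q).2 (Z' q)) (j c)
      = dirDeriv EC (fun q => (e₁' q).1) (fun q => (e₂' q).2 (Z q)) c := by
    refine hdir _ _ _ _ hr₁.self_of_nhds ?_ (he₂.2.apply hZ')
    filter_upwards [h₂, hZr] with q hq hq'
    rw [hq.2, ← hq']
    rfl
  have t2 : (e₂ (j c)).2 (lieBr E (fun q => (e₁ q).1) Z' (j c))
      = (e₂' c).2 (lieBr EC (fun q => (e₁' q).1) Z c) := by
    rw [h₂.self_of_nhds.2, ContinuousLinearMap.comp_apply,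
      ← mfderiv_lieBr_of_related hj hs₁ (hZ c) (he₁.1 _) (hZ' _) hr₁ hZr]
  have t3 : dirDeriv E (fun q => (e₂ q).1) (fun q => (e₁ q).2 (Z' q)) (j c)
      = dirDeriv EC (fun q => (e₂' q).1) (fun q => (e₁' q).2 (Z q)) c := by
    refine hdir _ _ _ _ hr₂.self_of_nhds ?_ (he₁.2.apply hZ')
    filter_upwards [h₁, hZr] with q hq hq'
    rw [hq.2, ← hq']
    rfl
  have t4 : dirDeriv E Z' (fun q => (e₁ q).2 ((e₂ q).1)) (j c)
      = dirDeriv EC Z (fun q => (e₁' q).2 ((e₂' q).1)) c := by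
    refine hdir _ _ _ _ hZc ?_ (he₁.2.apply he₂.1)
    filter_upwards [h₁, h₂] with q hq hq'
    rw [hq.2, ← hq'.1]
    rfl
  have t5 : (e₁ (j c)).2 (lieBr E (fun q => (e₂ q).1) Z' (j c))
      = (e₁' c).2 (lieBr EC (fun q => (e₂' q).1) Z c) := by
    rw [h₁.self_of_nhds.2, ContinuousLinearMap.comp_apply,
      ← mfderiv_lieBr_of_related hj hs₂ (hZ c) (he₂.1 _) (hZ' _) hr₂ hZr]
  simp only [lieDerivOneForm, extDerivOne]
  rw [t1, t2, t3, t4, t5]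

end PullBack

end DiracReduction

namespace DiracReduction

section PullBack

open Filter Topology Set

variable {E : Type*} [NormedAddCommGroup E] [NormedSpace ℝ E]
  {M : Type*} [TopologicalSpace M] [ChartedSpace E M]
  {EC : Type*} [NormedAddCommGroup EC] [NormedSpace ℝ EC]
  {C : Type*} [TopologicalSpace C] [ChartedSpace EC C]
  {F : Type*} [NormedAddCommGroup F] [NormedSpace ℝ F]

lemma mem_pullDirac {j : C → M} {L : GenSubspace E M} {c : C} {v : GenTangent EC c} :
    v ∈ pullDirac j L c ↔ ∃ α : Cotangent E (j c),
      v.2 = α.comp (diff EC E j c) ∧ (diff EC E j c v.1, α) ∈ L (j c) := Iff.rfl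

/-- The elements of `L` which are conormal to the level sets of `G`. -/
def conormal (L : GenSubspace E M) (G : M → F) (p : M) : Submodule ℝ (F →L[ℝ] ℝ) where
  carrier := {ξ | ((0 : TangentSpace 𝓘(ℝ, E) p),
    (ξ.comp (mvfderiv 𝓘(ℝ, E) G p) : Cotangent E p)) ∈ L p}
  add_mem' := by
    intro ξ η hξ hη
    have h := (L p).add_mem hξ hη
    rw [Prod.mk_add_mk, add_zero, ← ContinuousLinearMap.add_comp] at h
    exact h
  zero_mem' := by
    have h : (((0 : TangentSpace 𝓘(ℝ, E) p), ((0 : F →L[ℝ] ℝ).comp (mvfderiv 𝓘(ℝ, E) G p) :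
        Cotangent E p)) : GenTangent E p) = 0 := by
      rw [ContinuousLinearMap.zero_comp]
      rfl
    change _ ∈ L p
    exact h ▸ (L p).zero_mem
  smul_mem' := by
    intro a ξ hξ
    have h := (L p).smul_mem a hξ
    rw [Prod.smul_mk, smul_zero, ← ContinuousLinearMap.smul_comp] at h
    exact h

lemma mem_conormal {L : GenSubspace E M} {G : M → F} {p : M} {ξ : F →L[ℝ] ℝ} :
    ξ ∈ conormal L G p ↔ ((0 : TangentSpace 𝓘(ℝ, E) p),
      (ξ.comp (mvfderiv 𝓘(ℝ, E) G p) : Cotangent E p)) ∈ L p := Iff.rfl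

variable (EC E) in
/-- `j : C → M` is an immersion onto a level set of `G`, along which `G` is a submersion. -/
structure IsLevelImmersion [IsManifold 𝓘(ℝ, E) ∞ M] [IsManifold 𝓘(ℝ, EC) ∞ C] (j : C → M)
    (G : M → F) : Prop where
  contMDiff : ContMDiff 𝓘(ℝ, EC) 𝓘(ℝ, E) ∞ j
  immersion : ∀ c, Manifold.IsImmersionAt 𝓘(ℝ, EC) 𝓘(ℝ, E) ∞ j c
  smooth : ContMDiff 𝓘(ℝ, E) 𝓘(ℝ, F) ∞ G
  surjective : ∀ c, Function.Surjective (mvfderiv 𝓘(ℝ, E) G (j c))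
  mem_ker_iff : ∀ c (Y : TangentSpace 𝓘(ℝ, E) (j c)),
    mvfderiv 𝓘(ℝ, E) G (j c) Y = 0 ↔ ∃ w, diff EC E j c w = Y

variable [IsManifold 𝓘(ℝ, E) ∞ M] [IsManifold 𝓘(ℝ, EC) ∞ C] [FiniteDimensional ℝ F]
  {φ : ThreeForm E M} {L : GenSubspace E M} {j : C → M} {G : M → F} {m : ℕ}

lemma IsLevelImmersion.exists_factor (h : IsLevelImmersion E EC j G) {c : C} {β : Cotangent E (j c)}
    (hβ : β.comp (diff EC E j c) = 0) :
    ∃ ξ : F →L[ℝ] ℝ, β = ξ.comp (mvfderiv 𝓘(ℝ, E) G (j c)) := by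
  refine exists_factor_of_surjective (h.surjective c) fun v hv => ?_
  obtain ⟨w, rfl⟩ := (h.mem_ker_iff c v).1 hv
  exact DFunLike.congr_fun hβ w

variable [FiniteDimensional ℝ E] [T2Space M] [FiniteDimensional ℝ EC] [T2Space C]

/-- If `L` meets the conormal bundle in constant rank, then a section of the pull-back of `L` is
locally related to sections of `L`. -/
lemma exists_related_section (h : IsLevelImmersion E EC j G) (hL : IsDirac E φ L)
    (hm : ∀ c, Module.finrank ℝ (conormal L G (j c)) = m) {e' : GenSection EC C}
    (he' : IsSectionOf EC (pullDirac j L) e') (c : C) :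
    ∃ e, IsSectionOf E L e ∧ RelatedAt j c e' e := by
  obtain ⟨χ, _, hχ, _, hχfr⟩ := exists_coordinate_frame (E := E) (j c) (Module.finBasis ℝ E)
  obtain ⟨_, Z, _, hZ, hfr⟩ := exists_coordinate_frame (E := EC) c (Module.finBasis ℝ EC)
  have hχfr' := h.contMDiff.continuous.continuousAt.eventually hχfr
  -- `Θ` records the vector in a chart and the restriction of the covector to `C`. Its kernel in `L`
  -- is the conormal part, so its rank on `L` is constant, and a section of the pull-back is a
  -- right-hand side that can be solved pointwise.
  let Θ : ∀ q : C, GenTangent E (j q) →ₗ[ℝ] E × (Fin (Module.finrank ℝ EC) → ℝ) := fun q =>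
    LinearMap.prodMap (mvfderiv 𝓘(ℝ, E) χ (j q)).toLinearMap
      (LinearMap.pi fun i => (LinearMap.applyₗ (diff EC E j q (Z i q))).comp
        (ContinuousLinearMap.coeLM ℝ))
  have hΘ : ∀ q v, Θ q v
      = (mvfderiv 𝓘(ℝ, E) χ (j q) v.1, fun i => v.2 (diff EC E j q (Z i q))) := fun q v => rfl
  have hfr2 : ∀ᶠ q in 𝓝 c, ∀ β β' : Cotangent EC q, (∀ i, β (Z i q) = β' (Z i q)) → β = β' := by
    filter_upwards [hfr] with q hq β β' hβ
    refine ContinuousLinearMap.ext fun w => ?_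
    rw [hq.2 w, map_sum, map_sum]
    refine Finset.sum_congr rfl fun i _ => ?_
    rw [map_smul, map_smul, hβ]
  have hker : ∀ᶠ q in 𝓝 c, Module.finrank ℝ
      (L (j q) ⊓ LinearMap.ker (Θ q) : Submodule ℝ (GenTangent E (j q))) = m := by
    filter_upwards [hχfr', hfr2] with q h1 h2
    let κ : (F →L[ℝ] ℝ) →ₗ[ℝ] GenTangent E (j q) :=
      { toFun := fun ξ => (0, ξ.comp (mvfderiv 𝓘(ℝ, E) G (j q)))
        map_add' := fun ξ η => by
          rw [ContinuousLinearMap.add_comp, Prod.mk_add_mk, add_zero]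
        map_smul' := fun a ξ => by
          rw [ContinuousLinearMap.smul_comp, RingHom.id_apply, Prod.smul_mk, smul_zero] }
    have hκ : Function.Injective κ := by
      intro ξ η hξη
      refine ContinuousLinearMap.ext fun f => ?_
      obtain ⟨v, rfl⟩ := h.surjective q f
      exact DFunLike.congr_fun (congrArg Prod.snd hξη) v
    have h3 : (L (j q) ⊓ LinearMap.ker (Θ q) : Submodule ℝ (GenTangent E (j q)))
        = (conormal L G (j q)).map κ := by
      ext ⟨X, β⟩
      constructor
      · rintro ⟨hmem, h0⟩
        have h0' : (mvfderiv 𝓘(ℝ, E) χ (j q) X, fun i => β (diff EC E j q (Z i q)))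
          = ((0 : E), (0 : Fin (Module.finrank ℝ EC) → ℝ)) := h0
        rw [Prod.mk.injEq] at h0'
        obtain rfl : X = 0 := h1.1 (h0'.1.trans (map_zero _).symm)
        obtain ⟨ξ, rfl⟩ := h.exists_factor (c := q) (β := β)
          (h2 _ _ fun i => congrFun h0'.2 i)
        exact ⟨ξ, hmem, rfl⟩
      · rintro ⟨ξ, hξ, heq⟩
        have heq' : ((0 : TangentSpace 𝓘(ℝ, E) (j q)), ξ.comp (mvfderiv 𝓘(ℝ, E) G (j q)))
          = (X, β) := heq
        rw [← heq']
        refine ⟨hξ, ?_⟩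
        change (mvfderiv 𝓘(ℝ, E) χ (j q) 0, fun i => ξ (mvfderiv 𝓘(ℝ, E) G (j q)
          (diff EC E j q (Z i q)))) = ((0 : E), (0 : Fin (Module.finrank ℝ EC) → ℝ))
        rw [map_zero, Prod.mk.injEq]
        refine ⟨rfl, funext fun i => ?_⟩
        rw [(h.mem_ker_iff q _).2 ⟨_, rfl⟩, map_zero]
        rfl
    rw [h3, finrank_map_of_injective hκ, hm]
  have hmap : ∀ q, ∃ v ∈ L (j q),
      Θ q v = (mvfderiv 𝓘(ℝ, EC) (χ ∘ j) q (e' q).1, fun i => (e' q).2 (Z i q)) := by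
    intro q
    obtain ⟨α, h1, h2⟩ := he'.2 q
    refine ⟨_, h2, ?_⟩
    rw [hΘ, h1, mvfderiv_comp_apply' (E := E) q ((hχ _).mdifferentiableAt (by simp))
      ((h.contMDiff q).mdifferentiableAt (by simp))]
    rfl
  obtain ⟨v₀, hv₀, hΘv₀⟩ := hmap c
  obtain ⟨e, he, -, hee⟩ := exists_section_lift hL.rank hL.smooth
    h.contMDiff.continuous.continuousAt
    (fun u hu => exists_extension_of_immersion (h.immersion c) hu) Θ
    (fun e he => Eventually.of_forall fun q => by
      simp only [hΘ]
      refine ContMDiffAt.prodMk_space ?_ (contMDiffAt_pi_space.2 fun i => ?_)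
      · exact (SmoothVFAt.mvfderiv_apply (he.1 _) (hχ _)).comp q (h.contMDiff q)
      · exact he.2.pullback_apply h.contMDiff h.immersion (hZ i) q)
    (b := fun q => (mvfderiv 𝓘(ℝ, EC) (χ ∘ j) q (e' q).1, fun i => (e' q).2 (Z i q)))
    (Eventually.of_forall fun q => by
      refine ContMDiffAt.prodMk_space ?_ (contMDiffAt_pi_space.2 fun i => ?_)
      · exact SmoothVFAt.mvfderiv_apply (he'.1.1 _) ((hχ.comp h.contMDiff) _)
      · exact he'.1.2.apply (hZ i) q)
    (r := Module.finrank ℝ E - m)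
    (by
      filter_upwards [hker] with q hq
      have h1 := finrank_map_add_finrank_inf_ker (Θ q) (L (j q))
      rw [hq, hL.rank] at h1
      omega)
    (Eventually.of_forall fun q => by
      obtain ⟨v, hv, hve⟩ := hmap q
      exact ⟨v, hv, hve⟩) hv₀ hΘv₀
  refine ⟨e, he, ?_⟩
  filter_upwards [hee, hχfr', hfr2] with q h1 h2 h3
  rw [hΘ, Prod.mk.injEq] at h1
  refine ⟨h2.1 ?_, h3 _ _ fun i => (congrFun h1.2 i).symm⟩
  rw [h1.1, mvfderiv_comp_apply' (E := E) q ((hχ _).mdifferentiableAt (by simp))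
      ((h.contMDiff q).mdifferentiableAt (by simp))]

end PullBack

end DiracReduction

namespace DiracReduction

section PullBack

open Filter Topology Set

variable {E : Type*} [NormedAddCommGroup E] [NormedSpace ℝ E]
  {M : Type*} [TopologicalSpace M] [ChartedSpace E M] [IsManifold 𝓘(ℝ, E) ∞ M]
  {EC : Type*} [NormedAddCommGroup EC] [NormedSpace ℝ EC]
  {C : Type*} [TopologicalSpace C] [ChartedSpace EC C] [IsManifold 𝓘(ℝ, EC) ∞ C]
  {F : Type*} [NormedAddCommGroup F] [NormedSpace ℝ F]
  {φ : ThreeForm E M} {L : GenSubspace E M} {j : C → M} {G : M → F} {m : ℕ}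

lemma IsDirac.isLagrangian (hL : IsDirac E φ L) (p : M) : IsLagrangian (L p) :=
  ⟨hL.isotropic p, hL.rank p⟩

variable [FiniteDimensional ℝ E] [FiniteDimensional ℝ EC]

lemma IsLevelImmersion.isLagrangian_pullDirac (h : IsLevelImmersion E EC j G)
    (hL : IsDirac E φ L) (c : C) : IsLagrangian ((pullDirac j L : GenSubspace EC C) c) :=
  (hL.isLagrangian (j c)).of_pullback (injective_mfderiv_of_immersion (h.immersion c))
    fun _ => mem_pullDirac

variable [T2Space M] [T2Space C] [FiniteDimensional ℝ F]

/-- A section of `L` through a lift of `v` can be chosen with vector part tangent to `C`, because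
the image of `L` under `dG` has constant rank; its restriction to `C` is then cut off. -/
lemma IsLevelImmersion.exists_section (h : IsLevelImmersion E EC j G) (hL : IsDirac E φ L)
    (hm : ∀ c, Module.finrank ℝ (conormal L G (j c)) = m) {c : C} {v : GenTangent EC c}
    (hv : v ∈ pullDirac j L c) : ∃ e, IsSectionOf EC (pullDirac j L) e ∧ e c = v := by
  obtain ⟨α, hα, hvα⟩ := hv
  let Θ : ∀ q : C, GenTangent E (j q) →ₗ[ℝ] F := fun q =>
    (mvfderiv 𝓘(ℝ, E) G (j q)).toLinearMap.comp (LinearMap.fst ℝ _ _)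
  have hrk : ∀ q, Module.finrank ℝ ((L (j q)).map (Θ q)) = Module.finrank ℝ F - m := by
    intro q
    -- `ξ` annihilates the image of `L` under `dG` exactly when `(0, ξ ∘ dG)` is orthogonal to `L`,
    -- hence when it lies in `L`.
    have h1 := finrank_add_finrank_annihilator ((L (j q)).map (Θ q))
      (A := conormal L G (j q)) fun ξ => by
        rw [mem_conormal]
        constructor
        · rintro hξ _ ⟨v, hv, rfl⟩
          have h2 := hL.isotropic (j q) _ hξ _ hv
          rwa [map_zero, zero_add] at h2
        · intro hξ
          refine (hL.isLagrangian (j q)).mem_of_forall fun l hl => ?_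
          rw [map_zero, add_zero]
          exact hξ _ ⟨l, hl, rfl⟩
    rw [hm] at h1
    omega
  obtain ⟨e, he, hec, hee⟩ := exists_section_lift hL.rank hL.smooth
    h.contMDiff.continuous.continuousAt
    (fun u hu => exists_extension_of_immersion (h.immersion c) hu) Θ
    (fun e he => Eventually.of_forall fun q =>
      (SmoothVFAt.mvfderiv_apply (he.1 _) (h.smooth _)).comp q (h.contMDiff q))
    (b := fun _ => 0) (Eventually.of_forall fun q => contMDiffAt_const)
    (Eventually.of_forall hrk) (Eventually.of_forall fun q => Submodule.zero_mem _) hvα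
    ((h.mem_ker_iff c _).2 ⟨_, rfl⟩)
  -- `W` has the default value 0 where the section is not tangent to `C`; the bump function is
  -- supported where it is tangent.
  have hW : ∀ q, ∃ w, mvfderiv 𝓘(ℝ, E) G (j q) (e (j q)).1 = 0 → diff EC E j q w = (e (j q)).1 := by
    intro q
    by_cases hq : mvfderiv 𝓘(ℝ, E) G (j q) (e (j q)).1 = 0
    · obtain ⟨w, hw⟩ := (h.mem_ker_iff q _).1 hq
      exact ⟨w, fun _ => hw⟩
    · exact ⟨0, fun h => absurd h hq⟩
  choose W hW using hW
  have hWs : ∀ᶠ q in 𝓝 c, diff EC E j q (W q) = (e (j q)).1 ∧ SmoothVFAt W q := by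
    filter_upwards [hee.eventually_nhds] with q hq
    exact ⟨hW q hq.self_of_nhds, smoothVFAt_of_related h.contMDiff (h.immersion q) (he.1.1 _)
      (hq.mono fun q' hq' => hW q' hq')⟩
  obtain ⟨ψ, hψ, hsupp, hψ1⟩ := exists_bump (E := EC) hWs
  have hψ0 : ∀ q, q ∉ tsupport ψ → ψ q = 0 := fun q hq => image_eq_zero_of_notMem_tsupport hq
  refine ⟨fun q => ψ q • (W q, (e (j q)).2.comp (diff EC E j q)), ⟨⟨fun q => ?_, ?_⟩, fun q => ?_⟩,
    ?_⟩
  · by_cases hq : q ∈ tsupport ψ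
    · exact SmoothVFAt.smul (hψ q) (hsupp hq).2
    · refine SmoothVFAt.congr_of_eventuallyEq (smoothVF_zero q) ?_
      filter_upwards [(isClosed_tsupport ψ).isOpen_compl.mem_nhds hq] with q' hq'
      rw [hψ0 q' hq', zero_smul]
      rfl
  · refine smoothOneForm_of_apply fun Z hZ => ?_
    exact hψ.smul (he.1.2.pullback_apply h.contMDiff h.immersion hZ)
  · by_cases hq : q ∈ tsupport ψ
    · refine Submodule.smul_mem _ _ (mem_pullDirac.2 ⟨(e (j q)).2, rfl, ?_⟩)
      rw [(hsupp hq).1]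
      exact he.2 (j q)
    · change ψ q • _ ∈ _
      rw [hψ0 q hq, zero_smul]
      exact Submodule.zero_mem _
  · have h1 : W c = v.1 := injective_mfderiv_of_immersion (h.immersion c)
      (hWs.self_of_nhds.1.trans (by rw [hec]))
    change ψ c • (W c, (e (j c)).2.comp (diff EC E j c)) = v
    rw [hψ1.self_of_nhds, one_smul, h1, hec, ← hα]

/-- The pull-back of a Dirac structure to a level set is a Dirac structure, provided that it meets
the conormal bundle in constant rank. -/
theorem IsLevelImmersion.isDirac_pullDirac (h : IsLevelImmersion E EC j G) (hL : IsDirac E φ L)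
    (hφ : ∀ c u v w, φ (j c) ![diff EC E j c u, diff EC E j c v, diff EC E j c w] = 0)
    (hm : ∀ c, Module.finrank ℝ (conormal L G (j c)) = m) :
    IsDirac EC (fun _ => 0) (pullDirac j L : GenSubspace EC C) where
  isotropic c := (h.isLagrangian_pullDirac hL c).isotropic
  rank c := (h.isLagrangian_pullDirac hL c).rank
  smooth c v hv := h.exists_section hL hm hv
  involutive e₁ e₂ he₁ he₂ := by
    have := FiniteDimensional.complete ℝ EC
    -- At each point the bracket is computed upstairs, from sections of `L` related to `e₁` and `e₂`
    -- nearby. The twist contributes nothing on vectors tangent to `C`.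
    have key : ∀ c, ∃ v ∈ pullDirac j L c,
        v.1 = lieBr EC (fun q => (e₁ q).1) (fun q => (e₂ q).1) c ∧
        ∀ Z : VField EC C, SmoothVF EC Z → v.2 (Z c)
          = lieDerivOneForm EC (fun q => (e₁ q).1) (fun q => (e₂ q).2) Z c
            - extDerivOne EC (fun q => (e₁ q).2) (fun q => (e₂ q).1) Z c := by
      intro c
      obtain ⟨f₁, hf₁, hr₁⟩ := exists_related_section h hL hm he₁ c
      obtain ⟨f₂, hf₂, hr₂⟩ := exists_related_section h hL hm he₂ c
      obtain ⟨f₃, hf₃, hbr⟩ := hL.involutive f₁ f₂ hf₁ hf₂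
      obtain ⟨h1, h2⟩ := hbr.related hf₁.1 hf₂.1 h.contMDiff (h.immersion c) hr₁ hr₂
      refine ⟨(lieBr EC (fun q => (e₁ q).1) (fun q => (e₂ q).1) c,
        (f₃ (j c)).2.comp (diff EC E j c)), mem_pullDirac.2 ⟨(f₃ (j c)).2, rfl, ?_⟩, rfl, ?_⟩
      · rw [h1]
        exact hf₃.2 (j c)
      · intro Z hZ
        refine (h2 Z hZ).trans ?_
        rw [← hr₁.self_of_nhds.1, ← hr₂.self_of_nhds.1, hφ, add_zero]
    choose e₃ hmem h1 h2 using key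
    -- `e₃` is chosen point by point. Its smoothness follows from the bracket formula, which
    -- involves only `e₁`, `e₂` and the test field.
    refine ⟨e₃, ⟨⟨?_, smoothOneForm_of_apply fun Z hZ => ?_⟩, hmem⟩, h1, fun Z hZ p => ?_⟩
    · rw [funext h1]
      exact fun c => SmoothVFAt.lieBr (he₁.1.1 c) (he₂.1.1 c)
    · simp only [h2 _ Z hZ, lieDerivOneForm, extDerivOne, dirDeriv]
      have hbr1 : SmoothVF EC (lieBr EC (fun q => (e₁ q).1) Z) := fun c =>
        SmoothVFAt.lieBr (he₁.1.1 c) (hZ c)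
      have hbr2 : SmoothVF EC (lieBr EC (fun q => (e₂ q).1) Z) := fun c =>
        SmoothVFAt.lieBr (he₂.1.1 c) (hZ c)
      refine ContMDiff.sub (ContMDiff.sub (fun c => ?_) (he₂.1.2.apply hbr1))
        (ContMDiff.sub (ContMDiff.sub (fun c => ?_) (fun c => ?_)) (he₁.1.2.apply hbr2))
      · exact SmoothVFAt.mvfderiv_apply (he₁.1.1 c) (he₂.1.2.apply hZ c)
      · exact SmoothVFAt.mvfderiv_apply (he₂.1.1 c) (he₁.1.2.apply hZ c)
      · exact SmoothVFAt.mvfderiv_apply (hZ c) (he₁.1.2.apply he₂.1.1 c)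
    · rw [h2 p Z hZ]
      simp

end PullBack

end DiracReduction

namespace DiracReduction

/-! ### Infinitesimal generators and the constancy of the conormal rank. -/

section Generators

open Filter Topology Set

lemma basis_coe_sum_eq_zero {W : Type*} [AddCommGroup W] [Module ℝ W] {S : Submodule ℝ W}
    {ι : Type*} [Fintype ι] (b : Module.Basis ι ℝ S) {d : ι → ℝ}
    (hd : ∑ l, d l • (b l : W) = 0) : d = 0 := by
  have h := b.linearIndependent.map' S.subtype S.ker_subtype
  exact funext (Fintype.linearIndependent_iff.1 h d hd)

lemma basis_coe_sum_repr {W : Type*} [AddCommGroup W] [Module ℝ W] {S : Submodule ℝ W}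
    {ι : Type*} [Fintype ι] (b : Module.Basis ι ℝ S) {w : W} (hw : w ∈ S) :
    ∑ l, b.repr ⟨w, hw⟩ l • (b l : W) = w := by
  have h := congrArg S.subtype (b.sum_repr ⟨w, hw⟩)
  rw [map_sum] at h
  exact h

variable {E : Type*} [NormedAddCommGroup E] [NormedSpace ℝ E] [FiniteDimensional ℝ E]
  {M : Type*} [TopologicalSpace M] [ChartedSpace E M] [IsManifold 𝓘(ℝ, E) ∞ M] [T2Space M]
  {EC : Type*} [NormedAddCommGroup EC] [NormedSpace ℝ EC] [FiniteDimensional ℝ EC]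
  {C : Type*} [TopologicalSpace C] [ChartedSpace EC C] [IsManifold 𝓘(ℝ, EC) ∞ C] [T2Space C]
  {F : Type*} [NormedAddCommGroup F] [NormedSpace ℝ F] [FiniteDimensional ℝ F]
  {φ : ThreeForm E M} {L : GenSubspace E M} {j : C → M} {G : M → F}

/-- The vector `w`, tangent to the level set, is the generator of `ξ`. -/
def IsGenAt (L : GenSubspace E M) (j : C → M) (G : M → F) (c : C) (ξ : F →L[ℝ] ℝ)
    (w : TangentSpace 𝓘(ℝ, EC) c) : Prop :=
  ((diff EC E j c w, (ξ.comp (mvfderiv 𝓘(ℝ, E) G (j c)) : Cotangent E (j c))) :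
    GenTangent E (j c)) ∈ L (j c)

omit [FiniteDimensional ℝ E] [IsManifold 𝓘(ℝ, E) ∞ M] [T2Space M] [FiniteDimensional ℝ EC]
  [IsManifold 𝓘(ℝ, EC) ∞ C] [T2Space C] [FiniteDimensional ℝ F] in
lemma IsGenAt.sum_smul {ι : Type*} [Fintype ι] {c : C} {ξ : ι → F →L[ℝ] ℝ}
    {w : ι → TangentSpace 𝓘(ℝ, EC) c} (h : ∀ i, IsGenAt L j G c (ξ i) (w i)) (a : ι → ℝ) :
    IsGenAt L j G c (∑ i, a i • ξ i) (∑ i, a i • w i) := by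
  have h1 := Submodule.sum_mem (L (j c)) (t := Finset.univ) fun i _ =>
    Submodule.smul_mem _ (a i) (h i)
  have h2 : (∑ i, a i • ((diff EC E j c (w i),
      ((ξ i).comp (mvfderiv 𝓘(ℝ, E) G (j c)) : Cotangent E (j c))) : GenTangent E (j c)))
      = (diff EC E j c (∑ i, a i • w i),
        ((∑ i, a i • ξ i).comp (mvfderiv 𝓘(ℝ, E) G (j c)) : Cotangent E (j c))) := by
    refine Prod.ext ?_ ?_
    · simp [Prod.fst_sum, map_sum]
    · refine ContinuousLinearMap.ext fun v => ?_
      simp [Prod.snd_sum]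
  rw [h2] at h1
  exact h1

/-- `L` contains no non-zero vector which is tangent to a level set. -/
def IsNondegenerateAlong (E : Type*) [NormedAddCommGroup E] [NormedSpace ℝ E] {M : Type*}
    [TopologicalSpace M] [ChartedSpace E M] {F : Type*} [NormedAddCommGroup F] [NormedSpace ℝ F]
    {C : Type*} (L : GenSubspace E M) (j : C → M) (G : M → F) : Prop :=
  ∀ (c : C) (Y : TangentSpace 𝓘(ℝ, E) (j c)), mvfderiv 𝓘(ℝ, E) G (j c) Y = 0 →
    (Y, (0 : Cotangent E (j c))) ∈ L (j c) → Y = 0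

omit [FiniteDimensional ℝ E] [T2Space M] [FiniteDimensional ℝ EC] [T2Space C]
  [FiniteDimensional ℝ F] in
lemma IsGenAt.unique (h : IsLevelImmersion E EC j G) (hnd : IsNondegenerateAlong E L j G) {c : C}
    {ξ : F →L[ℝ] ℝ} {w w' : TangentSpace 𝓘(ℝ, EC) c} (hw : IsGenAt L j G c ξ w)
    (hw' : IsGenAt L j G c ξ w') : w = w' := by
  have h1 := (L (j c)).sub_mem hw hw'
  rw [Prod.mk_sub_mk, sub_self, ← map_sub] at h1
  have h2 := hnd c _ ((h.mem_ker_iff c _).2 ⟨_, rfl⟩) h1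
  exact sub_eq_zero.1 (injective_mfderiv_of_immersion (h.immersion c) (h2.trans (map_zero _).symm))

/-- Generators are locally the restrictions of sections of `L`. -/
lemma exists_generator_section (h : IsLevelImmersion E EC j G) (hL : IsDirac E φ L)
    (hnd : IsNondegenerateAlong E L j G) {ξ : F →L[ℝ] ℝ} {V : VField EC C}
    (hV : ∀ c, IsGenAt L j G c ξ (V c)) (c : C) :
    ∃ e, IsSectionOf E L e ∧ ∀ᶠ q in 𝓝 c, diff EC E j q (V q) = (e (j q)).1 ∧
      (e (j q)).2 = ξ.comp (mvfderiv 𝓘(ℝ, E) G (j q)) := by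
  obtain ⟨_, Z, _, hZ, hfr⟩ := exists_coordinate_frame (E := E) (j c) (Module.finBasis ℝ E)
  have hfr' := h.contMDiff.continuous.continuousAt.eventually hfr
  have hfr2 : ∀ᶠ q in 𝓝 c, ∀ β β' : Cotangent E (j q),
      (∀ i, β (Z i (j q)) = β' (Z i (j q))) → β = β' := by
    filter_upwards [hfr'] with q hq β β' hβ
    refine ContinuousLinearMap.ext fun w => ?_
    rw [hq.2 w, map_sum, map_sum]
    refine Finset.sum_congr rfl fun i _ => ?_
    rw [map_smul, map_smul, hβ]
  -- `Θ` is injective on `L` by nondegeneracy, so its rank is `dim L`, and the generator is the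
  -- vector part of the solution with prescribed value `(0, ξ ∘ dG)`.
  let Θ : ∀ q : C, GenTangent E (j q) →ₗ[ℝ] F × (Fin (Module.finrank ℝ E) → ℝ) := fun q =>
    LinearMap.prodMap (mvfderiv 𝓘(ℝ, E) G (j q)).toLinearMap
      (LinearMap.pi fun i => (LinearMap.applyₗ (Z i (j q))).comp (ContinuousLinearMap.coeLM ℝ))
  have hΘ : ∀ q v, Θ q v = (mvfderiv 𝓘(ℝ, E) G (j q) v.1, fun i => v.2 (Z i (j q))) :=
    fun q v => rfl
  have hΘV : ∀ q, Θ q (diff EC E j q (V q), ξ.comp (mvfderiv 𝓘(ℝ, E) G (j q)))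
      = (0, fun i => ξ (mvfderiv 𝓘(ℝ, E) G (j q) (Z i (j q)))) := by
    intro q
    rw [hΘ, Prod.mk.injEq]
    exact ⟨(h.mem_ker_iff q _).2 ⟨_, rfl⟩, rfl⟩
  obtain ⟨e, he, -, hee⟩ := exists_section_lift hL.rank hL.smooth
    h.contMDiff.continuous.continuousAt
    (fun u hu => exists_extension_of_immersion (h.immersion c) hu) Θ
    (fun e he => Eventually.of_forall fun q => by
      simp only [hΘ]
      refine ContMDiffAt.prodMk_space ?_ (contMDiffAt_pi_space.2 fun i => ?_)
      · exact (SmoothVFAt.mvfderiv_apply (he.1 _) (h.smooth _)).comp q (h.contMDiff q)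
      · exact (he.2.apply (hZ i) (j q)).comp q (h.contMDiff q))
    (b := fun q => (0, fun i => ξ (mvfderiv 𝓘(ℝ, E) G (j q) (Z i (j q)))))
    (Eventually.of_forall fun q => by
      refine ContMDiffAt.prodMk_space contMDiffAt_const (contMDiffAt_pi_space.2 fun i => ?_)
      exact ξ.contMDiff.contMDiffAt.comp q
        ((SmoothVFAt.mvfderiv_apply (hZ i _) (h.smooth _)).comp q (h.contMDiff q)))
    (r := Module.finrank ℝ E)
    (by
      filter_upwards [hfr2] with q hq
      have h1 := finrank_map_add_finrank_inf_ker (Θ q) (L (j q))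
      have h2 : (L (j q) ⊓ LinearMap.ker (Θ q) : Submodule ℝ (GenTangent E (j q))) = ⊥ := by
        refine (Submodule.eq_bot_iff _).2 ?_
        rintro ⟨Y, β⟩ ⟨hmem, h0⟩
        have h0' : (mvfderiv 𝓘(ℝ, E) G (j q) Y, fun i => β (Z i (j q)))
          = ((0 : F), (0 : Fin (Module.finrank ℝ E) → ℝ)) := h0
        rw [Prod.mk.injEq] at h0'
        obtain rfl : β = 0 := hq _ _ fun i => congrFun h0'.2 i
        rw [hnd q Y h0'.1 hmem]
        rfl
      rw [h2, hL.rank, finrank_bot, add_zero] at h1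
      exact h1)
    (Eventually.of_forall fun q => ⟨_, hV q, hΘV q⟩) (hV c) (hΘV c)
  refine ⟨e, he, ?_⟩
  filter_upwards [hee, hfr2] with q h1 h2
  rw [hΘ, Prod.mk.injEq] at h1
  have h3 : (e (j q)).2 = ξ.comp (mvfderiv 𝓘(ℝ, E) G (j q)) := h2 _ _ fun i => congrFun h1.2 i
  refine ⟨?_, h3⟩
  obtain ⟨w, hw⟩ := (h.mem_ker_iff q _).1 h1.1
  have h4 : IsGenAt L j G q ξ w := by
    unfold IsGenAt
    rw [hw, ← h3]
    exact he.2 (j q)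
  rw [IsGenAt.unique h hnd (hV q) h4, hw]

lemma smoothVF_of_isGenAt (h : IsLevelImmersion E EC j G) (hL : IsDirac E φ L)
    (hnd : IsNondegenerateAlong E L j G) {ξ : F →L[ℝ] ℝ} {V : VField EC C}
    (hV : ∀ c, IsGenAt L j G c ξ (V c)) : SmoothVF EC V := by
  intro c
  obtain ⟨e, he, hee⟩ := exists_generator_section h hL hnd hV c
  exact smoothVFAt_of_related h.contMDiff (h.immersion c) (he.1.1 _) (hee.mono fun q hq => hq.1)

/-- The generators are in involution. -/
lemma lieBr_generators (h : IsLevelImmersion E EC j G) (hL : IsDirac E φ L)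
    (hφ : ∀ c u v w, φ (j c) ![diff EC E j c u, diff EC E j c v, diff EC E j c w] = 0)
    (hnd : IsNondegenerateAlong E L j G) {𝔩 : Submodule ℝ (F →L[ℝ] ℝ)}
    (h𝔩 : ∀ c ξ (w : TangentSpace 𝓘(ℝ, EC) c), IsGenAt L j G c ξ w → ξ ∈ 𝔩)
    {ι : Type*} [Fintype ι] (b : Module.Basis ι ℝ 𝔩) {V : ι → VField EC C}
    (hV : ∀ i c, IsGenAt L j G c (b i : F →L[ℝ] ℝ) (V i c)) (i k : ι) (c₀ : C) :
    ∃ δ : ι → C → ℝ, ∀ᶠ c in 𝓝 c₀,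
      (∀ l, ContinuousAt (δ l) c) ∧ lieBr EC (V i) (V k) c = ∑ l, δ l c • V l c := by
  have hVs : ∀ i, SmoothVF EC (V i) := fun i => smoothVF_of_isGenAt h hL hnd (hV i)
  obtain ⟨e₁, he₁, hr₁⟩ := exists_generator_section h hL hnd (hV i) c₀
  obtain ⟨e₂, he₂, hr₂⟩ := exists_generator_section h hL hnd (hV k) c₀
  obtain ⟨e₃, he₃, hbr⟩ := hL.involutive e₁ e₂ he₁ he₂
  have hrel : ∀ (i : ι) (e : GenSection E M), (∀ᶠ q in 𝓝 c₀, diff EC E j q (V i q) = (e (j q)).1 ∧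
      (e (j q)).2 = (b i : F →L[ℝ] ℝ).comp (mvfderiv 𝓘(ℝ, E) G (j q))) →
      ∀ᶠ q in 𝓝 c₀, RelatedAt j q (fun q => (V i q, 0)) e := by
    intro i e he
    filter_upwards [he.eventually_nhds] with q hq
    filter_upwards [hq] with q' hq'
    refine ⟨hq'.1, ?_⟩
    rw [hq'.2]
    refine ContinuousLinearMap.ext fun w => ?_
    have hw := (h.mem_ker_iff q' (diff EC E j q' w)).2 ⟨w, rfl⟩
    change 0 = (b i : F →L[ℝ] ℝ) (mvfderiv 𝓘(ℝ, E) G (j q') (diff EC E j q' w))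
    rw [hw, map_zero]
  -- Restricted to `C`, the sections `e₁` and `e₂` have zero 1-form part. Hence the 1-form of their
  -- bracket vanishes on `TC` and factors as `ξ ∘ dG`; the bracket of the two generators at `q` is
  -- thus the generating vector of some `ξ ∈ 𝔩`, which may depend on `q`.
  have hξ : ∀ᶠ q in 𝓝 c₀, ∃ d : ι → ℝ,
      (e₃ (j q)).2 = (∑ l, d l • (b l : F →L[ℝ] ℝ)).comp (mvfderiv 𝓘(ℝ, E) G (j q)) ∧
      diff EC E j q (lieBr EC (V i) (V k) q) = (e₃ (j q)).1 := by
    filter_upwards [hrel i e₁ hr₁, hrel k e₂ hr₂] with q h₁ h₂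
    obtain ⟨h3, h4⟩ := hbr.related he₁.1 he₂.1 h.contMDiff (h.immersion q) h₁ h₂
    have h5 : (e₃ (j q)).2.comp (diff EC E j q) = 0 := by
      refine ContinuousLinearMap.ext fun w => ?_
      obtain ⟨Z, hZ, rfl⟩ := exists_vf_eq w
      refine (h4 Z hZ).trans ?_
      rw [← h₁.self_of_nhds.1, ← h₂.self_of_nhds.1, hφ, add_zero]
      simp [lieDerivOneForm, extDerivOne, dirDeriv, mvfderiv_const]
    obtain ⟨ξ, hξ⟩ := h.exists_factor h5
    have h6 : ξ ∈ 𝔩 := by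
      refine h𝔩 q ξ (lieBr EC (V i) (V k) q) ?_
      unfold IsGenAt
      rw [← hξ]
      refine Set.mem_of_eq_of_mem ?_ (he₃.2 (j q))
      exact Prod.ext h3 rfl
    refine ⟨fun l => b.repr ⟨ξ, h6⟩ l, ?_, h3⟩
    rw [hξ, basis_coe_sum_repr]
  obtain ⟨_, Z, _, hZ, hfr⟩ := exists_coordinate_frame (E := E) (j c₀) (Module.finBasis ℝ E)
  have hfr' := h.contMDiff.continuous.continuousAt.eventually hfr
  have hfr2 : ∀ᶠ q in 𝓝 c₀, ∀ β β' : Cotangent E (j q),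
      (∀ i, β (Z i (j q)) = β' (Z i (j q))) → β = β' := by
    filter_upwards [hfr'] with q hq β β' hβ
    refine ContinuousLinearMap.ext fun w => ?_
    rw [hq.2 w, map_sum, map_sum]
    refine Finset.sum_congr rfl fun i _ => ?_
    rw [map_smul, map_smul, hβ]
  -- The covectors `b l ∘ dG` in coordinates. They are independent because `dG` is surjective, so
  -- the coefficients of the bracket can be chosen smooth.
  let a : ι → C → Fin (Module.finrank ℝ E) → ℝ := fun l q m =>
    (b l : F →L[ℝ] ℝ) (mvfderiv 𝓘(ℝ, E) G (j q) (Z m (j q)))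
  have ha : ∀ (d : ι → ℝ) q, (∑ l, d l • a l q) = fun m =>
      ((∑ l, d l • (b l : F →L[ℝ] ℝ)).comp (mvfderiv 𝓘(ℝ, E) G (j q))) (Z m (j q)) := by
    intro d q
    funext m
    simp [a]
  have hrk : ∀ᶠ q in 𝓝 c₀, Module.finrank ℝ (Submodule.span ℝ (range fun l => a l q))
      = Fintype.card ι := by
    filter_upwards [hfr2] with q hq
    refine finrank_span_eq_card (Fintype.linearIndependent_iff.2 fun d hd l => ?_)
    rw [ha] at hd
    have h1 := hq _ 0 fun m => congrFun hd m
    refine congrFun (basis_coe_sum_eq_zero b (d := d) (ContinuousLinearMap.ext fun f => ?_)) l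
    obtain ⟨v, rfl⟩ := h.surjective q f
    exact DFunLike.congr_fun h1 v
  have hmem : ∀ᶠ q in 𝓝 c₀, ∃ d : ι → ℝ, ∑ l, d l • a l q = fun m => (e₃ (j q)).2 (Z m (j q)) := by
    filter_upwards [hξ] with q hq
    obtain ⟨d, hd, -⟩ := hq
    exact ⟨d, by rw [ha, hd]⟩
  have has : ∀ l q, ContMDiffAt 𝓘(ℝ, EC) 𝓘(ℝ, Fin (Module.finrank ℝ E) → ℝ) ∞ (a l) q := by
    refine fun l q => contMDiffAt_pi_space.2 fun m => ?_
    exact (b l : F →L[ℝ] ℝ).contMDiff.contMDiffAt.comp q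
      ((SmoothVFAt.mvfderiv_apply (hZ m _) (h.smooth _)).comp q (h.contMDiff q))
  have hbs : ∀ q, ContMDiffAt 𝓘(ℝ, EC) 𝓘(ℝ, Fin (Module.finrank ℝ E) → ℝ) ∞
      (fun q m => (e₃ (j q)).2 (Z m (j q))) q := by
    refine fun q => contMDiffAt_pi_space.2 fun m => ?_
    exact (he₃.1.2.apply (hZ m) (j q)).comp q (h.contMDiff q)
  obtain ⟨u₀, hu₀⟩ := hmem.self_of_nhds
  obtain ⟨u, hu, -, hue⟩ := exists_global_lift (a := a)
    (b := fun q m => (e₃ (j q)).2 (Z m (j q))) (p := c₀)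
    (fun l => Eventually.of_forall (has l)) (Eventually.of_forall hbs) hrk
    (hmem.mono fun q hq => (Submodule.mem_span_range_iff_exists_fun ℝ).2 hq) hu₀
  refine ⟨u, ?_⟩
  filter_upwards [hue, hfr2, hξ] with q h1 h2 h3
  refine ⟨fun l => (hu l).continuous.continuousAt, ?_⟩
  obtain ⟨-, -, h3⟩ := h3
  refine IsGenAt.unique h hnd (ξ := ∑ l, u l q • (b l : F →L[ℝ] ℝ)) ?_
    (IsGenAt.sum_smul (fun l => hV l q) _)
  rw [ha] at h1
  unfold IsGenAt
  rw [h2 _ _ fun m => congrFun h1 m]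
  refine Set.mem_of_eq_of_mem ?_ (he₃.2 (j q))
  exact Prod.ext h3 rfl

end Generators

end DiracReduction

namespace DiracReduction

section Generators

open Filter Topology Set

lemma surjective_mfderiv_of_submersion {E : Type*} [NormedAddCommGroup E] [NormedSpace ℝ E]
    {C : Type*} [TopologicalSpace C] [ChartedSpace E C] [IsManifold 𝓘(ℝ, E) ∞ C]
    {EQ : Type*} [NormedAddCommGroup EQ] [NormedSpace ℝ EQ]
    {Q : Type*} [TopologicalSpace Q] [ChartedSpace EQ Q] [IsManifold 𝓘(ℝ, EQ) ∞ Q]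
    {p : C → Q} {c : C}
    (hp : Manifold.IsSubmersionAt 𝓘(ℝ, E) 𝓘(ℝ, EQ) ∞ p c) :
    Function.Surjective (mfderiv 𝓘(ℝ, E) 𝓘(ℝ, EQ) p c) := by
  obtain ⟨s, hs, hsc, hps⟩ := exists_local_section hp
  intro v
  have hd : MDifferentiableAt 𝓘(ℝ, E) 𝓘(ℝ, EQ) p (s (p c)) := by
    rw [hsc]
    exact hp.contMDiffAt.mdifferentiableAt (by simp)
  have h1 := mfderiv_comp_apply (I := 𝓘(ℝ, EQ)) (I' := 𝓘(ℝ, E)) (I'' := 𝓘(ℝ, EQ)) (p c)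
    hd (hs.self_of_nhds.mdifferentiableAt (by simp)) v
  have h2 : p ∘ s =ᶠ[𝓝 (p c)] id := hps
  rw [h2.mfderiv_eq, mfderiv_id] at h1
  rw [hsc] at h1
  exact ⟨_, h1.symm⟩

variable {E : Type*} [NormedAddCommGroup E] [NormedSpace ℝ E]
  {M : Type*} [TopologicalSpace M] [ChartedSpace E M] [IsManifold 𝓘(ℝ, E) ∞ M]
  {EC : Type*} [NormedAddCommGroup EC] [NormedSpace ℝ EC]
  {C : Type*} [TopologicalSpace C] [ChartedSpace EC C] [IsManifold 𝓘(ℝ, EC) ∞ C]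
  {F : Type*} [NormedAddCommGroup F] [NormedSpace ℝ F]
  {φ : ThreeForm E M} {L : GenSubspace E M} {j : C → M} {G : M → F}
  {𝔩 : Submodule ℝ (F →L[ℝ] ℝ)} {ι : Type*} [Fintype ι] {b : Module.Basis ι ℝ 𝔩}
  {V : ι → VField EC C}

lemma IsGenAt.eq_sum (h : IsLevelImmersion E EC j G)
    (hnd : IsNondegenerateAlong E L j G) {c : C}
    (hV : ∀ i, IsGenAt L j G c (b i : F →L[ℝ] ℝ) (V i c)) {ξ : F →L[ℝ] ℝ} (hξ : ξ ∈ 𝔩)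
    {w : TangentSpace 𝓘(ℝ, EC) c} (hw : IsGenAt L j G c ξ w) :
    w = ∑ l, b.repr ⟨ξ, hξ⟩ l • V l c := by
  refine IsGenAt.unique h hnd hw ?_
  have h1 := IsGenAt.sum_smul hV (b.repr ⟨ξ, hξ⟩)
  rwa [basis_coe_sum_repr] at h1

/-- Rank-nullity for the map that sends an element of `𝔩` to its generating vector at `c`: the
kernel is the conormal part of `L`. -/
lemma finrank_conormal_add_finrank_span (h : IsLevelImmersion E EC j G)
    (hnd : IsNondegenerateAlong E L j G) {c : C}
    (h𝔩 : ∀ ξ (w : TangentSpace 𝓘(ℝ, EC) c), IsGenAt L j G c ξ w → ξ ∈ 𝔩)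
    (hV : ∀ i, IsGenAt L j G c (b i : F →L[ℝ] ℝ) (V i c)) :
    Module.finrank ℝ (conormal L G (j c))
      + Module.finrank ℝ (Submodule.span ℝ (range fun i => V i c)) = Fintype.card ι := by
  let T := Fintype.linearCombination ℝ (fun i => V i c)
  let S := Fintype.linearCombination ℝ (fun i => (b i : F →L[ℝ] ℝ))
  have hT : ∀ a, T a = ∑ i, a i • V i c := fun a => Fintype.linearCombination_apply ..
  have hS : ∀ a, S a = ∑ i, a i • (b i : F →L[ℝ] ℝ) := fun a => Fintype.linearCombination_apply ..
  have hSinj : Function.Injective S := (injective_iff_map_eq_zero _).2 fun a ha =>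
    basis_coe_sum_eq_zero b ((hS a).symm.trans ha)
  have hzero : ∀ ξ, ξ ∈ conormal L G (j c) ↔ IsGenAt L j G c ξ (0 : TangentSpace 𝓘(ℝ, EC) c) := by
    intro ξ
    unfold IsGenAt
    rw [map_zero]
    rfl
  have hmap : conormal L G (j c) = (LinearMap.ker T).map S := by
    ext ξ
    rw [hzero]
    constructor
    · intro hξ
      have hmem := h𝔩 _ _ hξ
      refine ⟨b.repr ⟨ξ, hmem⟩, ?_, (hS _).trans (basis_coe_sum_repr b hmem)⟩
      exact (hT _).trans (IsGenAt.eq_sum h hnd hV hmem hξ).symm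
    · rintro ⟨a, ha, rfl⟩
      have h1 := IsGenAt.sum_smul hV a
      rw [← hS, ← hT] at h1
      rw [show T a = 0 from ha] at h1
      exact h1
  have h2 := LinearMap.finrank_range_add_finrank_ker T
  rw [Fintype.range_linearCombination, Module.finrank_fintype_fun_eq_card] at h2
  rw [hmap, finrank_map_of_injective hSinj, add_comm]
  exact h2

/-- A covector that restricts to zero on `C` has the form `ξ ∘ dG`, so `(Y, 0)` lies in the
pull-back exactly when `Y` is the generating vector of some `ξ`. -/
lemma mem_pullDirac_zero_iff [FiniteDimensional ℝ F] (h : IsLevelImmersion E EC j G)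
    (hnd : IsNondegenerateAlong E L j G) {c : C}
    (h𝔩 : ∀ ξ (w : TangentSpace 𝓘(ℝ, EC) c), IsGenAt L j G c ξ w → ξ ∈ 𝔩)
    (hV : ∀ i, IsGenAt L j G c (b i : F →L[ℝ] ℝ) (V i c)) (Y : TangentSpace 𝓘(ℝ, EC) c) :
    (Y, (0 : Cotangent EC c)) ∈ (pullDirac j L : GenSubspace EC C) c
      ↔ Y ∈ Submodule.span ℝ (range fun i => V i c) := by
  rw [mem_pullDirac, Submodule.mem_span_range_iff_exists_fun]
  constructor
  · rintro ⟨α, hα, hmem⟩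
    obtain ⟨ξ, rfl⟩ := h.exists_factor hα.symm
    exact ⟨_, (IsGenAt.eq_sum h hnd hV (h𝔩 ξ Y hmem) hmem).symm⟩
  · rintro ⟨a, rfl⟩
    refine ⟨_, ?_, IsGenAt.sum_smul hV a⟩
    refine ContinuousLinearMap.ext fun w => ?_
    have hw := (h.mem_ker_iff c (diff EC E j c w)).2 ⟨w, rfl⟩
    change 0 = (∑ i, a i • (b i : F →L[ℝ] ℝ)) (mvfderiv 𝓘(ℝ, E) G (j c) (diff EC E j c w))
    rw [hw, map_zero]

/-- If the fibres of a submersion are the orbits of the generators, then the pull-back of `L` is a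
Dirac structure, whose kernel is tangent to the fibres. -/
theorem isDirac_pullDirac_of_orbits [FiniteDimensional ℝ E] [T2Space M] [FiniteDimensional ℝ EC]
    [T2Space C] [SecondCountableTopology C] [FiniteDimensional ℝ F]
    {EQ : Type*} [NormedAddCommGroup EQ] [NormedSpace ℝ EQ] [FiniteDimensional ℝ EQ]
    {Q : Type*} [TopologicalSpace Q] [ChartedSpace EQ Q] [IsManifold 𝓘(ℝ, EQ) ∞ Q]
    (h : IsLevelImmersion E EC j G) (hL : IsDirac E φ L)
    (hφ : ∀ c u v w, φ (j c) ![diff EC E j c u, diff EC E j c v, diff EC E j c w] = 0)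
    (hnd : IsNondegenerateAlong E L j G)
    (h𝔩 : ∀ c ξ (w : TangentSpace 𝓘(ℝ, EC) c), IsGenAt L j G c ξ w → ξ ∈ 𝔩)
    (hV : ∀ i c, IsGenAt L j G c (b i : F →L[ℝ] ℝ) (V i c)) {p : C → Q}
    (hp : Manifold.IsSubmersion 𝓘(ℝ, EC) 𝓘(ℝ, EQ) ∞ p)
    (horb : ∀ c c', p c = p c' ↔ Relation.EqvGen (CurveStep V) c c') :
    IsDirac EC (fun _ => 0) (pullDirac j L : GenSubspace EC C) ∧
      ∀ c (Y : TangentSpace 𝓘(ℝ, EC) c), mfderiv 𝓘(ℝ, EC) 𝓘(ℝ, EQ) p c Y = 0 ↔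
        (Y, (0 : Cotangent EC c)) ∈ (pullDirac j L : GenSubspace EC C) c := by
  have hspan := span_eq_ker_of_orbits (fun i => smoothVF_of_isGenAt h hL hnd (hV i))
    (lieBr_generators h hL hφ hnd h𝔩 b hV) hp horb
  -- The conormal rank is `dim 𝔩` minus the dimension of the fibres of `p`, which the generators
  -- span.
  refine ⟨h.isDirac_pullDirac hL hφ
    (m := Fintype.card ι - (Module.finrank ℝ EC - Module.finrank ℝ EQ)) fun c => ?_, fun c Y => ?_⟩
  · have h1 := finrank_conormal_add_finrank_span h hnd (h𝔩 c) fun i => hV i c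
    have h2 := LinearMap.finrank_range_add_finrank_ker
      (mfderiv 𝓘(ℝ, EC) 𝓘(ℝ, EQ) p c).toLinearMap
    rw [LinearMap.range_eq_top.2 (surjective_mfderiv_of_submersion (hp.isSubmersionAt c)),
      finrank_top] at h2
    have h3 : Module.finrank ℝ (TangentSpace 𝓘(ℝ, EC) c) = Module.finrank ℝ EC := rfl
    have h4 : Module.finrank ℝ (TangentSpace 𝓘(ℝ, EQ) (p c)) = Module.finrank ℝ EQ := rfl
    rw [hspan] at h1
    omega
  · rw [mem_pullDirac_zero_iff h hnd (h𝔩 c) fun i => hV i c, hspan]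
    rfl

end Generators

end DiracReduction

namespace DiracReduction

/-! ### Reduction of a Dirac structure along its kernel. -/

section Reduction

open Filter Topology Set

variable {E : Type*} [NormedAddCommGroup E] [NormedSpace ℝ E] [FiniteDimensional ℝ E]
  {C : Type*} [TopologicalSpace C] [ChartedSpace E C] [IsManifold 𝓘(ℝ, E) ∞ C] [T2Space C]
  {L : GenSubspace E C}

/-- The Courant bracket of sections whose 1-forms are exact near a point. -/
lemma IsCourantBracket.of_exact {e₁ e₂ e₃ : GenSection E C}
    (hbr : IsCourantBracket E (fun _ => 0) e₁ e₂ e₃) (he₁ : SmoothSection E e₁)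
    (he₂ : SmoothSection E e₂) {k₁ k₂ : C → ℝ} (hk₁ : ContMDiff 𝓘(ℝ, E) 𝓘(ℝ) ∞ k₁)
    (hk₂ : ContMDiff 𝓘(ℝ, E) 𝓘(ℝ) ∞ k₂) {c : C}
    (h₁ : ∀ᶠ q in 𝓝 c, (e₁ q).2 = mvfderiv 𝓘(ℝ, E) k₁ q)
    (h₂ : ∀ᶠ q in 𝓝 c, (e₂ q).2 = mvfderiv 𝓘(ℝ, E) k₂ q) :
    (e₃ c).2 = mvfderiv 𝓘(ℝ, E) (fun q => mvfderiv 𝓘(ℝ, E) k₂ q (e₁ q).1) c := by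
  have := FiniteDimensional.complete ℝ E
  refine ContinuousLinearMap.ext fun w => ?_
  obtain ⟨Z, hZ, rfl⟩ := exists_vf_eq w
  rw [hbr.2 Z hZ c]
  simp only [lieDerivOneForm, extDerivOne, dirDeriv]
  have t1 := mvfderiv_congr (f := fun q => (e₂ q).2 (Z q)) (g := fun q => mvfderiv 𝓘(ℝ, E) k₂ q (Z q))
    (h₂.mono fun q hq => DFunLike.congr_fun hq (Z q)) (e₁ c).1
  have t2 := mvfderiv_congr (f := fun q => (e₁ q).2 (Z q)) (g := fun q => mvfderiv 𝓘(ℝ, E) k₁ q (Z q))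
    (h₁.mono fun q hq => DFunLike.congr_fun hq (Z q)) (e₂ c).1
  have t3 := mvfderiv_congr (f := fun q => (e₁ q).2 (e₂ q).1)
    (g := fun q => mvfderiv 𝓘(ℝ, E) k₁ q (e₂ q).1)
    (h₁.mono fun q hq => DFunLike.congr_fun hq (e₂ q).1) (Z c)
  have t4 := mvfderiv_lieBr (he₁.1 c) (hZ c) (Eventually.of_forall hk₂)
  have t5 := mvfderiv_lieBr (he₂.1 c) (hZ c) (Eventually.of_forall hk₁)
  -- With the commutator formula, `𝓛_X dk₂ = d(X k₂)` and `i_Y d(dk₁) = 0`.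
  rw [t1, t2, t3, h₁.self_of_nhds, h₂.self_of_nhds, t4, t5]
  simp

variable {EQ : Type*} [NormedAddCommGroup EQ] [NormedSpace ℝ EQ]
  {Q : Type*} [TopologicalSpace Q] [ChartedSpace EQ Q] [IsManifold 𝓘(ℝ, EQ) ∞ Q]
  {p : C → Q}

/-- Sections of a Dirac structure with prescribed exact 1-form, if the kernel of the Dirac
structure is tangent to the fibres of a submersion. -/
lemma exists_hamiltonian_section (hL : IsDirac E (fun _ => 0) L)
    (hp : Manifold.IsSubmersion 𝓘(ℝ, E) 𝓘(ℝ, EQ) ∞ p)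
    (hker : ∀ c (Y : TangentSpace 𝓘(ℝ, E) c), mfderiv 𝓘(ℝ, E) 𝓘(ℝ, EQ) p c Y = 0 ↔
      (Y, (0 : Cotangent E c)) ∈ L c) {k : C → ℝ} (hk : ContMDiff 𝓘(ℝ, E) 𝓘(ℝ) ∞ k)
    (hkker : ∀ c (Y : TangentSpace 𝓘(ℝ, E) c), mfderiv 𝓘(ℝ, E) 𝓘(ℝ, EQ) p c Y = 0 →
      mvfderiv 𝓘(ℝ, E) k c Y = 0) (c : C) :
    ∃ e, IsSectionOf E L e ∧ ∀ᶠ q in 𝓝 c, (e q).2 = mvfderiv 𝓘(ℝ, E) k q := by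
  obtain ⟨_, Z, _, hZ, hfr⟩ := exists_coordinate_frame (E := E) c (Module.finBasis ℝ E)
  have hfr2 : ∀ᶠ q in 𝓝 c, ∀ β β' : Cotangent E q, (∀ i, β (Z i q) = β' (Z i q)) → β = β' := by
    filter_upwards [hfr] with q hq β β' hβ
    refine ContinuousLinearMap.ext fun w => ?_
    rw [hq.2 w, map_sum, map_sum]
    refine Finset.sum_congr rfl fun i _ => ?_
    rw [map_smul, map_smul, hβ]
  have hex : ∀ q, ∃ Y, (Y, mvfderiv 𝓘(ℝ, E) k q) ∈ L q := fun q =>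
    (hL.isLagrangian q).exists_fst fun Y hY => hkker q Y ((hker q Y).2 hY)
  -- The projection to 1-forms. Its kernel in `L` is `ker dp`, so its rank is the dimension of the
  -- quotient.
  let Θ : ∀ q : C, GenTangent E q →ₗ[ℝ] (Fin (Module.finrank ℝ E) → ℝ) := fun q =>
    (LinearMap.pi fun i => (LinearMap.applyₗ (Z i q)).comp (ContinuousLinearMap.coeLM ℝ)).comp
      (LinearMap.snd ℝ _ _)
  have hΘ : ∀ q v, Θ q v = fun i => v.2 (Z i q) := fun q v => rfl
  choose Y hY using hex
  obtain ⟨e, he, -, hee⟩ := exists_section_lift (j := fun q : C => q) (c := c) hL.rank hL.smooth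
    continuousAt_id (fun u hu => ⟨u, hu, Eventually.of_forall fun q => rfl⟩) Θ
    (fun e he => Eventually.of_forall fun q => by
      simp only [hΘ]
      exact contMDiffAt_pi_space.2 fun i => he.2.apply (hZ i) q)
    (b := fun q i => mvfderiv 𝓘(ℝ, E) k q (Z i q))
    (Eventually.of_forall fun q => contMDiffAt_pi_space.2 fun i =>
      SmoothVFAt.mvfderiv_apply (hZ i q) (hk q))
    (r := Module.finrank ℝ EQ)
    (by
      filter_upwards [hfr2] with q hq
      have h1 := finrank_map_add_finrank_inf_ker (Θ q) (L q)
      have h2 : (L q ⊓ LinearMap.ker (Θ q) : Submodule ℝ (GenTangent E q))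
          = (LinearMap.ker (mfderiv 𝓘(ℝ, E) 𝓘(ℝ, EQ) p q).toLinearMap).map
            (LinearMap.inl ℝ _ _) := by
        ext ⟨X, β⟩
        constructor
        · rintro ⟨hmem, h0⟩
          obtain rfl : β = 0 := hq _ _ fun i => congrFun h0 i
          exact ⟨X, (hker q X).2 hmem, rfl⟩
        · rintro ⟨X', hX', heq⟩
          have heq' : (X', (0 : Cotangent E q)) = (X, β) := heq
          rw [← heq']
          exact ⟨(hker q X').1 hX', rfl⟩
      have h3 := LinearMap.finrank_range_add_finrank_ker
        (mfderiv 𝓘(ℝ, E) 𝓘(ℝ, EQ) p q).toLinearMap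
      rw [LinearMap.range_eq_top.2 (surjective_mfderiv_of_submersion (hp.isSubmersionAt q)),
        finrank_top] at h3
      have h4 : Module.finrank ℝ (TangentSpace 𝓘(ℝ, E) q) = Module.finrank ℝ E := rfl
      have h5 : Module.finrank ℝ (TangentSpace 𝓘(ℝ, EQ) (p q)) = Module.finrank ℝ EQ := rfl
      have h6 := finrank_map_of_injective (f := LinearMap.inl ℝ (TangentSpace 𝓘(ℝ, E) q)
        (Cotangent E q)) LinearMap.inl_injective
        (LinearMap.ker (mfderiv 𝓘(ℝ, E) 𝓘(ℝ, EQ) p q).toLinearMap)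
      rw [h2, h6, hL.rank] at h1
      omega)
    (Eventually.of_forall fun q => ⟨_, hY q, rfl⟩) (hY c) rfl
  refine ⟨e, he, ?_⟩
  filter_upwards [hee, hfr2] with q h1 h2
  exact h2 _ _ fun i => congrFun h1 i

end Reduction

end DiracReduction

namespace DiracReduction

section Reduction

open Filter Topology Set

variable {E : Type*} [NormedAddCommGroup E] [NormedSpace ℝ E]
  {C : Type*} [TopologicalSpace C] [ChartedSpace E C] [IsManifold 𝓘(ℝ, E) ∞ C]
  {EQ : Type*} [NormedAddCommGroup EQ] [NormedSpace ℝ EQ]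
  {Q : Type*} [TopologicalSpace Q] [ChartedSpace EQ Q]

/-- A Dirac structure whose kernel is tangent to the fibres of a surjective submersion, such that
the functions which are constant along the kernel are constant on the fibres. -/
structure IsReducible (L : GenSubspace E C) (p : C → Q) : Prop where
  isDirac : IsDirac E (fun _ => 0) L
  submersion : Manifold.IsSubmersion 𝓘(ℝ, E) 𝓘(ℝ, EQ) ∞ p
  surjective : Function.Surjective p
  ker_iff : ∀ c (Y : TangentSpace 𝓘(ℝ, E) c), mfderiv 𝓘(ℝ, E) 𝓘(ℝ, EQ) p c Y = 0 ↔
    (Y, (0 : Cotangent E c)) ∈ L c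
  basic : ∀ k : C → ℝ, ContMDiff 𝓘(ℝ, E) 𝓘(ℝ) ∞ k →
    (∀ c (Y : TangentSpace 𝓘(ℝ, E) c), mfderiv 𝓘(ℝ, E) 𝓘(ℝ, EQ) p c Y = 0 →
      mvfderiv 𝓘(ℝ, E) k c Y = 0) → ∀ c c', p c = p c' → k c = k c'

variable {L : GenSubspace E C} {p : C → Q}

/-- `Y` is a lift of the Hamiltonian vector of the covector `α` at `p c`. -/
def IsLiftAt (L : GenSubspace E C) (p : C → Q) (c : C) (α : Cotangent EQ (p c))
    (Y : TangentSpace 𝓘(ℝ, E) c) : Prop :=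
  ((Y, (α.comp (diff E EQ p c) : Cotangent E c)) : GenTangent E c) ∈ L c

namespace IsReducible

lemma contMDiff (h : IsReducible (EQ := EQ) L p) : ContMDiff 𝓘(ℝ, E) 𝓘(ℝ, EQ) ∞ p :=
  h.submersion.contMDiff

lemma mvfderiv_comp (h : IsReducible (EQ := EQ) L p) {f : Q → ℝ}
    (hf : ContMDiff 𝓘(ℝ, EQ) 𝓘(ℝ) ∞ f) (c : C) :
    mvfderiv 𝓘(ℝ, E) (f ∘ p) c = (mvfderiv 𝓘(ℝ, EQ) f (p c)).comp (diff E EQ p c) :=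
  ContinuousLinearMap.ext fun v => mvfderiv_comp_apply' (E := EQ) c
    ((hf _).mdifferentiableAt (by simp)) ((h.contMDiff c).mdifferentiableAt (by simp)) v

lemma mvfderiv_comp_eq_zero (h : IsReducible (EQ := EQ) L p) {f : Q → ℝ}
    (hf : ContMDiff 𝓘(ℝ, EQ) 𝓘(ℝ) ∞ f) (c : C) (Y : TangentSpace 𝓘(ℝ, E) c)
    (hY : mfderiv 𝓘(ℝ, E) 𝓘(ℝ, EQ) p c Y = 0) : mvfderiv 𝓘(ℝ, E) (f ∘ p) c Y = 0 := by
  rw [h.mvfderiv_comp hf]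
  change mvfderiv 𝓘(ℝ, EQ) f (p c) (mfderiv 𝓘(ℝ, E) 𝓘(ℝ, EQ) p c Y) = 0
  rw [hY, map_zero]

lemma lift_skew (h : IsReducible (EQ := EQ) L p) {c : C} {α β : Cotangent EQ (p c)}
    {X Y : TangentSpace 𝓘(ℝ, E) c} (hX : IsLiftAt L p c α X) (hY : IsLiftAt L p c β Y) :
    β (diff E EQ p c X) + α (diff E EQ p c Y) = 0 :=
  h.isDirac.isotropic c _ hX _ hY

/-- The difference of two lifts lies in `L ∩ TC`, which is `ker dp`. -/
lemma lift_unique (h : IsReducible (EQ := EQ) L p) {c : C} {α : Cotangent EQ (p c)}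
    {X Y : TangentSpace 𝓘(ℝ, E) c} (hX : IsLiftAt L p c α X) (hY : IsLiftAt L p c α Y) :
    diff E EQ p c X = diff E EQ p c Y := by
  have h1 := (L c).sub_mem hX hY
  rw [Prod.mk_sub_mk, sub_self] at h1
  have h2 := (h.ker_iff c _).2 h1
  rw [map_sub] at h2
  exact sub_eq_zero.1 h2

variable [FiniteDimensional ℝ E]

lemma exists_lift (h : IsReducible (EQ := EQ) L p) {c : C} (α : Cotangent EQ (p c)) :
    ∃ Y, IsLiftAt L p c α Y := by
  refine (h.isDirac.isLagrangian c).exists_fst fun Y hY => ?_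
  have h1 := (h.ker_iff c Y).2 hY
  change α (mfderiv 𝓘(ℝ, E) 𝓘(ℝ, EQ) p c Y) = 0
  rw [h1, map_zero]

variable [T2Space C] [IsManifold 𝓘(ℝ, EQ) ∞ Q]

/-- Local sections of `L` that lift Hamiltonian vector fields. -/
lemma exists_section (h : IsReducible (EQ := EQ) L p) {f : Q → ℝ}
    (hf : ContMDiff 𝓘(ℝ, EQ) 𝓘(ℝ) ∞ f) (c : C) :
    ∃ e, IsSectionOf E L e ∧ ∀ᶠ q in 𝓝 c, (e q).2 = mvfderiv 𝓘(ℝ, E) (f ∘ p) q ∧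
      IsLiftAt L p q (mvfderiv 𝓘(ℝ, EQ) f (p q)) (e q).1 := by
  obtain ⟨e, he, hee⟩ := exists_hamiltonian_section h.isDirac h.submersion h.ker_iff
    (hf.comp h.contMDiff) (h.mvfderiv_comp_eq_zero hf) c
  refine ⟨e, he, ?_⟩
  filter_upwards [hee] with q hq
  refine ⟨hq, ?_⟩
  unfold IsLiftAt
  rw [← h.mvfderiv_comp hf, ← hq]
  exact he.2 q

/-- The Poisson bracket of two functions on the quotient. -/
lemma exists_bracket (h : IsReducible (EQ := EQ) L p) {f g : Q → ℝ}
    (hf : ContMDiff 𝓘(ℝ, EQ) 𝓘(ℝ) ∞ f) (hg : ContMDiff 𝓘(ℝ, EQ) 𝓘(ℝ) ∞ g) :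
    ∃ B : Q → ℝ, ContMDiff 𝓘(ℝ, EQ) 𝓘(ℝ) ∞ B ∧
      ∀ c Y, IsLiftAt L p c (mvfderiv 𝓘(ℝ, EQ) f (p c)) Y →
        B (p c) = mvfderiv 𝓘(ℝ, EQ) g (p c) (diff E EQ p c Y) := by
  choose Y hY using fun c => h.exists_lift (mvfderiv 𝓘(ℝ, EQ) f (p c))
  let k : C → ℝ := fun c => mvfderiv 𝓘(ℝ, EQ) g (p c) (diff E EQ p c (Y c))
  have hloc : ∀ e : GenSection E C, ∀ c,
      (∀ᶠ q in 𝓝 c, (e q).2 = mvfderiv 𝓘(ℝ, E) (f ∘ p) q ∧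
        IsLiftAt L p q (mvfderiv 𝓘(ℝ, EQ) f (p q)) (e q).1) →
      ∀ᶠ q in 𝓝 c, k q = mvfderiv 𝓘(ℝ, E) (g ∘ p) q (e q).1 := by
    intro e c he
    filter_upwards [he] with q hq
    rw [h.mvfderiv_comp hg]
    exact congrArg _ (h.lift_unique (hY q) hq.2)
  have hk : ContMDiff 𝓘(ℝ, E) 𝓘(ℝ) ∞ k := by
    intro c
    obtain ⟨e, he, hee⟩ := h.exists_section hf c
    exact ContMDiffAt.congr_of_eventuallyEq
      (SmoothVFAt.mvfderiv_apply (he.1.1 c) ((hg.comp h.contMDiff) c)) (hloc e c hee)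
  -- `dk` is the 1-form part of the bracket of the sections lifting `df` and `dg`, and isotropy
  -- pairs it to zero with `(W, 0) ∈ L`.
  have hkker : ∀ c (W : TangentSpace 𝓘(ℝ, E) c), mfderiv 𝓘(ℝ, E) 𝓘(ℝ, EQ) p c W = 0 →
      mvfderiv 𝓘(ℝ, E) k c W = 0 := by
    intro c W hW
    obtain ⟨e₁, he₁, hee₁⟩ := h.exists_section hf c
    obtain ⟨e₂, he₂, hee₂⟩ := h.exists_section hg c
    obtain ⟨e₃, he₃, hbr⟩ := h.isDirac.involutive e₁ e₂ he₁ he₂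
    have h1 := hbr.of_exact he₁.1 he₂.1 (hf.comp h.contMDiff) (hg.comp h.contMDiff)
      (hee₁.mono fun q hq => hq.1) (hee₂.mono fun q hq => hq.1)
    have h2 := h.isDirac.isotropic c _ (he₃.2 c) _ ((h.ker_iff c W).1 hW)
    rw [h1] at h2
    rw [mvfderiv_congr (hloc e₁ c hee₁)]
    simpa using h2
  have hconst := h.basic k hk hkker
  -- An arbitrary set-theoretic section suffices to define the function on the quotient; local
  -- smooth sections show that it is smooth.
  let σ : Q → C := Function.surjInv h.surjective
  have hσ : ∀ q, p (σ q) = q := Function.surjInv_eq h.surjective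
  have hB : ∀ c, k (σ (p c)) = k c := fun c => hconst _ _ (hσ (p c))
  refine ⟨fun q => k (σ q), fun q => ?_, fun c X hX => ?_⟩
  · obtain ⟨c, rfl⟩ := h.surjective q
    obtain ⟨s, hs, hsc, hps⟩ := exists_local_section (h.submersion.isSubmersionAt c)
    refine ContMDiffAt.congr_of_eventuallyEq ((hk (s (p c))).comp (p c) hs.self_of_nhds) ?_
    filter_upwards [hps] with q hq
    have h1 := hB (s q)
    rw [hq] at h1
    exact h1
  · exact (hB c).trans (congrArg _ (h.lift_unique (hY c) hX))

/-- The bracket of the lifts of `df` and `dg` is a lift of `d{f, g}` with vector part `[X_f, X_g]`.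
The Jacobi identity is then the commutator formula applied to `k ∘ p`. -/
lemma isPoisson (h : IsReducible (EQ := EQ) L p) {π : BiTensor EQ Q}
    (hπ : ∀ c (α β : Cotangent EQ (p c)) Y, IsLiftAt L p c α Y →
      π (p c) α β = β (diff E EQ p c Y)) : IsPoisson EQ π := by
  have := FiniteDimensional.complete ℝ E
  have hskew : ∀ q, ∀ α : Cotangent EQ q, π q α α = 0 := by
    intro q α
    obtain ⟨c, rfl⟩ := h.surjective q
    obtain ⟨Y, hY⟩ := h.exists_lift α
    have h1 := h.lift_skew hY hY
    rw [hπ c α α Y hY]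
    linarith
  have hskew' : ∀ q, ∀ α β : Cotangent EQ q, π q α β = -π q β α := by
    intro q α β
    have h1 := hskew q (α + β)
    rw [map_add, map_add, LinearMap.add_apply, LinearMap.add_apply, hskew, hskew] at h1
    linarith
  have hsm : ∀ f g : Q → ℝ, ContMDiff 𝓘(ℝ, EQ) 𝓘(ℝ) ∞ f → ContMDiff 𝓘(ℝ, EQ) 𝓘(ℝ) ∞ g →
      ContMDiff 𝓘(ℝ, EQ) 𝓘(ℝ) ∞ (poissonBr EQ π f g) := by
    intro f g hf hg
    obtain ⟨B, hBs, hB⟩ := h.exists_bracket hf hg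
    have h1 : poissonBr EQ π f g = B := by
      funext q
      obtain ⟨c, rfl⟩ := h.surjective q
      obtain ⟨Y, hY⟩ := h.exists_lift (mvfderiv 𝓘(ℝ, EQ) f (p c))
      exact (hπ c _ _ Y hY).trans (hB c Y hY).symm
    rwa [h1]
  have hval : ∀ (f g : Q → ℝ), ContMDiff 𝓘(ℝ, EQ) 𝓘(ℝ) ∞ g → ∀ c Y,
      IsLiftAt L p c (mvfderiv 𝓘(ℝ, EQ) f (p c)) Y →
      poissonBr EQ π f g (p c) = mvfderiv 𝓘(ℝ, E) (g ∘ p) c Y := by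
    intro f g hg c Y hY
    rw [h.mvfderiv_comp hg]
    exact hπ c _ _ Y hY
  refine ⟨hskew, hsm, fun f g k hf hg hk q => ?_⟩
  obtain ⟨c, rfl⟩ := h.surjective q
  obtain ⟨e₁, he₁, hee₁⟩ := h.exists_section hf c
  obtain ⟨e₂, he₂, hee₂⟩ := h.exists_section hg c
  obtain ⟨e₃, he₃, hbr⟩ := h.isDirac.involutive e₁ e₂ he₁ he₂
  have h1 := hbr.of_exact he₁.1 he₂.1 (hf.comp h.contMDiff) (hg.comp h.contMDiff)
    (hee₁.mono fun q hq => hq.1) (hee₂.mono fun q hq => hq.1)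
  have h2 : IsLiftAt L p c (mvfderiv 𝓘(ℝ, EQ) (poissonBr EQ π f g) (p c)) (e₃ c).1 := by
    unfold IsLiftAt
    rw [← h.mvfderiv_comp (hsm f g hf hg)]
    have h3 : mvfderiv 𝓘(ℝ, E) (poissonBr EQ π f g ∘ p) c = (e₃ c).2 := by
      rw [h1]
      refine ContinuousLinearMap.ext fun v => mvfderiv_congr ?_ v
      filter_upwards [hee₁] with q hq
      exact hval f g hg q _ hq.2
    rw [h3]
    exact he₃.2 c
  have t1 : poissonBr EQ π f (poissonBr EQ π g k) (p c)
      = mvfderiv 𝓘(ℝ, E) (fun q => mvfderiv 𝓘(ℝ, E) (k ∘ p) q (e₂ q).1) c (e₁ c).1 := by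
    rw [hval f _ (hsm g k hg hk) c _ hee₁.self_of_nhds.2]
    refine mvfderiv_congr ?_ _
    filter_upwards [hee₂] with q hq using hval g k hk q _ hq.2
  have t2 : poissonBr EQ π g (poissonBr EQ π k f) (p c)
      = -mvfderiv 𝓘(ℝ, E) (fun q => mvfderiv 𝓘(ℝ, E) (k ∘ p) q (e₁ q).1) c (e₂ c).1 := by
    rw [hval g _ (hsm k f hk hf) c _ hee₂.self_of_nhds.2]
    have h4 : poissonBr EQ π k f ∘ p =ᶠ[𝓝 c]
        fun q => (-1 : ℝ →L[ℝ] ℝ) (mvfderiv 𝓘(ℝ, E) (k ∘ p) q (e₁ q).1) := by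
      filter_upwards [hee₁] with q hq
      rw [← hval f k hk q _ hq.2]
      refine (hskew' _ _ _).trans ?_
      rw [_root_.neg_apply]
      rfl
    rw [mvfderiv_congr h4, mvfderiv_clm_comp]
    · rfl
    · exact (SmoothVFAt.mvfderiv_apply (he₁.1.1 c)
        ((hk.comp h.contMDiff) c)).mdifferentiableAt (by simp)
  have t3 : poissonBr EQ π k (poissonBr EQ π f g) (p c)
      = -mvfderiv 𝓘(ℝ, E) (k ∘ p) c (lieBr E (fun q => (e₁ q).1) (fun q => (e₂ q).1) c) := by
    rw [← hbr.1 c, ← hval _ k hk c _ h2]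
    exact hskew' _ _ _
  rw [t1, t2, t3, mvfderiv_lieBr (he₁.1.1 c) (he₂.1.1 c)
    (Eventually.of_forall (hk.comp h.contMDiff))]
  ring

variable [FiniteDimensional ℝ EQ] [T2Space Q]

/-- The reduced bivector field. -/
lemma exists_bivector (h : IsReducible (EQ := EQ) L p) :
    ∃ π : BiTensor EQ Q, ∀ c (α β : Cotangent EQ (p c)) Y, IsLiftAt L p c α Y →
      π (p c) α β = β (diff E EQ p c Y) := by
  have hbr : ∀ f g : {f : Q → ℝ // ContMDiff 𝓘(ℝ, EQ) 𝓘(ℝ) ∞ f},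
      ∃ B : Q → ℝ, ∀ c Y, IsLiftAt L p c (mvfderiv 𝓘(ℝ, EQ) f.1 (p c)) Y →
        B (p c) = mvfderiv 𝓘(ℝ, EQ) g.1 (p c) (diff E EQ p c Y) := fun f g => by
    obtain ⟨B, -, hB⟩ := h.exists_bracket f.2 g.2
    exact ⟨B, hB⟩
  choose B hB using hbr
  -- The bilinear form at `q` is built from lifts at one point over `q`. Every covector is the
  -- differential of a function, so `exists_bracket` makes the form independent of that point.
  have key : ∀ q : Q, ∃ P : Cotangent EQ q →ₗ[ℝ] Cotangent EQ q →ₗ[ℝ] ℝ,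
      ∀ f g : {f : Q → ℝ // ContMDiff 𝓘(ℝ, EQ) 𝓘(ℝ) ∞ f},
        P (mvfderiv 𝓘(ℝ, EQ) f.1 q) (mvfderiv 𝓘(ℝ, EQ) g.1 q) = B f g q := by
    intro q
    obtain ⟨c, rfl⟩ := h.surjective q
    choose Y hY using fun α : Cotangent EQ (p c) => h.exists_lift α
    refine ⟨LinearMap.mk₂ ℝ (fun α β => β (diff E EQ p c (Y α))) ?_ ?_ ?_ ?_, fun f g => ?_⟩
    · intro α α' β
      have h1 : IsLiftAt L p c (α + α') (Y α + Y α') := by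
        have h2 := (L c).add_mem (hY α) (hY α')
        rwa [Prod.mk_add_mk, ← ContinuousLinearMap.add_comp] at h2
      rw [h.lift_unique (hY _) h1, map_add, map_add]
    · intro a α β
      have h1 : IsLiftAt L p c (a • α) (a • Y α) := by
        have h2 := (L c).smul_mem a (hY α)
        rwa [Prod.smul_mk, ← ContinuousLinearMap.smul_comp] at h2
      rw [h.lift_unique (hY _) h1, map_smul, map_smul]
    · exact fun α β β' => rfl
    · exact fun a α β => rfl
    · exact (hB f g c _ (hY _)).symm
  choose π hπ using key
  refine ⟨π, fun c α β Y hY => ?_⟩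
  obtain ⟨f, hf, rfl⟩ := exists_function_mvfderiv_eq α
  obtain ⟨g, hg, rfl⟩ := exists_function_mvfderiv_eq β
  exact (hπ (p c) ⟨f, hf⟩ ⟨g, hg⟩).trans (hB ⟨f, hf⟩ ⟨g, hg⟩ c Y hY)

/-- Reduction of a Dirac structure along its kernel. -/
theorem exists_poisson (h : IsReducible (EQ := EQ) L p) :
    ∃ π : BiTensor EQ Q, IsPoisson EQ π ∧ IsForwardDirac p L (graphOf EQ π) ∧
      (∀ π' : BiTensor EQ Q, IsForwardDirac p L (graphOf EQ π') → π' = π) ∧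
      IsBackwardDirac p L (graphOf EQ π) ∧
      (∀ π' : BiTensor EQ Q, IsBackwardDirac p L (graphOf EQ π') → π' = π) := by
  obtain ⟨π, hπ⟩ := h.exists_bivector
  have hsurj := fun c => surjective_mfderiv_of_submersion (h.submersion.isSubmersionAt c)
  have hsep : ∀ (q : Q) (X X' : TangentSpace 𝓘(ℝ, EQ) q), (∀ β : Cotangent EQ q, β X = β X') →
      X = X' := by
    intro q X X' hX
    by_contra hne
    obtain ⟨β, hβ, -⟩ := exists_dual_vanishing (S := (⊥ : Submodule ℝ (TangentSpace 𝓘(ℝ, EQ) q)))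
      (v := X - X') fun h0 => hne (sub_eq_zero.1 ((Submodule.mem_bot ℝ).1 h0))
    exact hβ (by rw [map_sub, hX, sub_self])
  -- Every covector has a lift, so the projections of lifts determine the graph at each point of the
  -- quotient.
  have huniq : ∀ π' : BiTensor EQ Q, (∀ c (α : Cotangent EQ (p c)) Y, IsLiftAt L p c α Y →
      (diff E EQ p c Y, α) ∈ graphOf EQ π' (p c)) → π' = π := by
    intro π' hπ'
    funext q
    obtain ⟨c, rfl⟩ := h.surjective q
    refine LinearMap.ext fun α => LinearMap.ext fun β => ?_
    obtain ⟨Y, hY⟩ := h.exists_lift α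
    rw [hπ c α β Y hY]
    exact (hπ' c α Y hY β).symm
  refine ⟨π, h.isPoisson hπ, ⟨h.contMDiff, fun c X α => ?_⟩, fun π' hf => ?_,
    ⟨h.contMDiff, fun c => ?_⟩, fun π' hb => ?_⟩
  · constructor
    · intro hX
      obtain ⟨Y, hY⟩ := h.exists_lift α
      refine ⟨Y, hsep _ _ _ fun β => ?_, hY⟩
      rw [← hπ c α β Y hY]
      exact (hX β).symm
    · rintro ⟨Y, rfl, hY⟩ β
      exact (hπ c α β Y hY).symm
  · exact huniq π' fun c α Y hY => (hf.2 c _ α).2 ⟨Y, rfl, hY⟩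
  · ext ⟨Y, η⟩
    rw [mem_pullDirac]
    constructor
    · intro hmem
      obtain ⟨α, rfl⟩ := exists_factor_of_surjective (f := diff E EQ p c) (hsurj c) (β := η)
        fun W hW => by
          have h1 := h.isDirac.isotropic c _ hmem _ ((h.ker_iff c W).1 hW)
          rwa [_root_.zero_apply, zero_add] at h1
      exact ⟨α, rfl, fun β => (hπ c α β Y hmem).symm⟩
    · rintro ⟨α, hα, hgr⟩
      -- `Y` and the lift `X` have the same projection, so they differ by an element of the kernel,
      -- and `(Y, p^*α)` lies in `L` together with `(X, p^*α)`.
      obtain ⟨X, hX⟩ := h.exists_lift α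
      have h1 : diff E EQ p c Y = diff E EQ p c X := hsep _ _ _ fun β => by
        rw [← hπ c α β X hX]
        exact hgr β
      have h2 : (Y - X, (0 : Cotangent E c)) ∈ L c := (h.ker_iff c _).1 (by
        rw [map_sub]
        exact sub_eq_zero.2 h1)
      have h3 := (L c).add_mem h2 hX
      rw [Prod.mk_add_mk, sub_add_cancel, zero_add, ← hα] at h3
      exact h3
  · refine huniq π' fun c α Y hY => ?_
    have h1 : (Y, (α.comp (diff E EQ p c) : Cotangent E c)) ∈ pullDirac p (graphOf EQ π') c := by
      rw [← hb.2 c]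
      exact hY
    obtain ⟨α', hα', hmem⟩ := h1
    have h2 : α = α' := by
      refine ContinuousLinearMap.ext fun v => ?_
      obtain ⟨w, rfl⟩ := hsurj c v
      exact DFunLike.congr_fun hα' w
    rwa [h2]

end IsReducible

end Reduction

end DiracReduction

namespace DiracReduction

/-! ### Dirac realizations: the generators of the isotropy Lie algebra. -/

section Realization

lemma exists_basis_fin {W : Type*} [AddCommGroup W] [Module ℝ W] [FiniteDimensional ℝ W]
    (S : Submodule ℝ W) : ∃ n, Nonempty (Module.Basis (Fin n) ℝ S) :=
  ⟨_, ⟨Module.finBasis ℝ S⟩⟩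

open Filter Topology Set

variable {EM : Type*} [NormedAddCommGroup EM] [NormedSpace ℝ EM] [FiniteDimensional ℝ EM]
  {EN : Type*} [NormedAddCommGroup EN] [NormedSpace ℝ EN]
  {EC : Type*} [NormedAddCommGroup EC] [NormedSpace ℝ EC]
  {M : Type*} [TopologicalSpace M] [ChartedSpace EM M] [IsManifold 𝓘(ℝ, EM) ∞ M]
  {N : Type*} [TopologicalSpace N] [ChartedSpace EN N] [IsManifold 𝓘(ℝ, EN) ∞ N]
  {J : N → M} {x : M} [ChartedSpace EC (J ⁻¹' {x})] [IsManifold 𝓘(ℝ, EC) ∞ (J ⁻¹' {x})]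

-- Transport along `J c = x` becomes harmless once the covector is a value of a field on all of `M`.
-- The fields `ξ ∘ dχ` serve for this.
omit [FiniteDimensional ℝ EM] [IsManifold 𝓘(ℝ, EM) ∞ M] [TopologicalSpace N] [ChartedSpace EN N]
  [IsManifold 𝓘(ℝ, EN) ∞ N] [ChartedSpace EC (J ⁻¹' {x})]
  [IsManifold 𝓘(ℝ, EC) ∞ (J ⁻¹' {x})] in
lemma covectorAt_eq (α : ∀ z : M, Cotangent EM z) (c : J ⁻¹' {x}) :
    covectorAt (α x) c = α (J (incl J x c)) := by
  have h : ∀ z (hz : x = z),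
      (Eq.recOn (motive := fun z _ => Cotangent EM z) hz (α x) : Cotangent EM z) = α z := by
    rintro _ rfl
    rfl
  exact h _ _

omit [FiniteDimensional ℝ EM] [IsManifold 𝓘(ℝ, EM) ∞ M] [IsManifold 𝓘(ℝ, EN) ∞ N]
  [IsManifold 𝓘(ℝ, EC) ∞ (J ⁻¹' {x})] in
lemma mfderiv_incl_eq_zero (hJ : ContMDiff 𝓘(ℝ, EN) 𝓘(ℝ, EM) ∞ J)
    (hj : ContMDiff 𝓘(ℝ, EC) 𝓘(ℝ, EN) ∞ (incl J x)) (c : J ⁻¹' {x})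
    (w : TangentSpace 𝓘(ℝ, EC) c) :
    diff EN EM J (incl J x c) (diff EC EN (incl J x) c w) = 0 := by
  have h1 := mfderiv_comp_apply (I := 𝓘(ℝ, EC)) (I' := 𝓘(ℝ, EN)) (I'' := 𝓘(ℝ, EM)) c
    ((hJ (incl J x c)).mdifferentiableAt (by simp)) ((hj c).mdifferentiableAt (by simp)) w
  have h2 : J ∘ incl J x = fun _ => x := funext fun c => c.2
  refine h1.symm.trans ?_
  rw [h2, mfderiv_const]
  rfl

/-- The composition of `J` with a chart at the regular value `x`. -/
lemma isLevelImmersion_incl [FiniteDimensional ℝ EN]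
    (hJ : ContMDiff 𝓘(ℝ, EN) 𝓘(ℝ, EM) ∞ J) (hx : IsRegularValue EN EM J x)
    (hC : Manifold.IsSmoothEmbedding 𝓘(ℝ, EC) 𝓘(ℝ, EN) ∞ (incl J x))
    {χ : M → EM} (hχ : ContMDiff 𝓘(ℝ, EM) 𝓘(ℝ, EM) ∞ χ)
    (hχx : Function.Bijective (mvfderiv 𝓘(ℝ, EM) χ x)) :
    IsLevelImmersion EN EC (incl J x) (χ ∘ J) := by
  have hj := hC.isImmersion.contMDiff
  have hbij : ∀ c : J ⁻¹' {x}, Function.Bijective (mvfderiv 𝓘(ℝ, EM) χ (J (incl J x c))) := by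
    intro c
    have hc : J (incl J x c) = x := c.2
    rw [hc]
    exact hχx
  have hd : ∀ (c : J ⁻¹' {x}) Y, mvfderiv 𝓘(ℝ, EN) (χ ∘ J) (incl J x c) Y
      = mvfderiv 𝓘(ℝ, EM) χ (J (incl J x c)) (diff EN EM J (incl J x c) Y) := fun c Y =>
    mvfderiv_comp_apply' (E := EM) _ ((hχ _).mdifferentiableAt (by simp))
      ((hJ _).mdifferentiableAt (by simp)) Y
  refine ⟨hj, hC.isImmersion.isImmersionAt, hχ.comp hJ, fun c f => ?_, fun c Y => ?_⟩
  · obtain ⟨X, rfl⟩ := (hbij c).2 f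
    obtain ⟨Y, rfl⟩ := hx _ c.2 X
    exact ⟨Y, hd c Y⟩
  · rw [hd]
    constructor
    · intro hY
      have h0 : diff EN EM J (incl J x c) Y = 0 := (hbij c).1 (hY.trans (map_zero _).symm)
      refine exists_mfderiv_eq_of_ker hJ (hC.isImmersion.isImmersionAt c)
        hC.isEmbedding.isInducing (fun y hy => ?_) (hx _ c.2) h0
      exact ⟨⟨y, hy.trans c.2⟩, rfl⟩
    · rintro ⟨w, rfl⟩
      rw [mfderiv_incl_eq_zero hJ hj, map_zero]

variable [FiniteDimensional ℝ EN] [FiniteDimensional ℝ EC] [T2Space M]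
  [T2Space N] [SecondCountableTopology N] {φ : ThreeForm EM M} {LM : GenSubspace EM M}
  {LN : GenSubspace EN N}
  {EQ : Type*} [NormedAddCommGroup EQ] [NormedSpace ℝ EQ] [FiniteDimensional ℝ EQ]
  [ChartedSpace EQ (OrbitSpace EC J LN LM x)] [IsManifold 𝓘(ℝ, EQ) ∞ (OrbitSpace EC J LN LM x)]

/-- The pull-back of the Dirac structure of a Dirac realization to a regular fibre can be reduced to
the orbit space. -/
theorem isReducible_pullDirac_incl (hJ : IsDiracRealization φ J LN LM)
    (hx : IsRegularValue EN EM J x)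
    (hC : Manifold.IsSmoothEmbedding 𝓘(ℝ, EC) 𝓘(ℝ, EN) ∞ (incl J x))
    (hQ : Manifold.IsSubmersion 𝓘(ℝ, EC) 𝓘(ℝ, EQ) ∞ (orbitProj EC J LN LM x)) :
    IsReducible (EQ := EQ) (pullDirac (incl J x) LN : GenSubspace EC (J ⁻¹' {x}))
      (orbitProj EC J LN LM x) := by
  have hJs : ContMDiff 𝓘(ℝ, EN) 𝓘(ℝ, EM) ∞ J := hJ.forward.1
  have hj := hC.isImmersion.contMDiff
  -- Replacing `J` by `χ ∘ J` puts the isotropy Lie algebra into the fixed dual of `EM`, free of the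
  -- tangent spaces at the points `J c`.
  obtain ⟨χ, hχ, hχe⟩ := exists_global_chart (E := EM) x
  have hinj : Function.Injective (mvfderiv 𝓘(ℝ, EM) χ x) := fun w w' h => by
    rw [mvfderiv_congr hχe, mvfderiv_congr hχe] at h
    exact mfderiv_extChartAt_injective (mem_chart_source EM x) h
  have hbij : Function.Bijective (mvfderiv 𝓘(ℝ, EM) χ x) :=
    ⟨hinj, (LinearMap.injective_iff_surjective_of_finrank_eq_finrank
      (V := TangentSpace 𝓘(ℝ, EM) x) (f := (mvfderiv 𝓘(ℝ, EM) χ x).toLinearMap) rfl).1 hinj⟩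
  have h := isLevelImmersion_incl hJs hx hC hχ hbij
  set G := χ ∘ J with hG
  have hGd : ∀ (c : J ⁻¹' {x}) (ξ : EM →L[ℝ] ℝ),
      (ξ.comp (mvfderiv 𝓘(ℝ, EN) G (incl J x c)) : Cotangent EN (incl J x c))
        = (ξ.comp (mvfderiv 𝓘(ℝ, EM) χ (J (incl J x c))) : Cotangent EM (J (incl J x c))).comp
          (diff EN EM J (incl J x c)) := fun c ξ => ContinuousLinearMap.ext fun Y =>
    congrArg ξ (mvfderiv_comp_apply' (E := EM) _ ((hχ _).mdifferentiableAt (by simp))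
      ((hJs _).mdifferentiableAt (by simp)) Y)
  have hφ : ∀ (c : J ⁻¹' {x}) u v w, pullThree J φ (incl J x c) ![diff EC EN (incl J x) c u,
      diff EC EN (incl J x) c v, diff EC EN (incl J x) c w] = 0 := by
    intro c u v w
    refine (φ (J (incl J x c))).map_coord_zero (m := _) 0 ?_
    exact mfderiv_incl_eq_zero hJs hj c u
  have hnd : IsNondegenerateAlong EN LN (incl J x) G := by
    intro c Y hY hmem
    obtain ⟨w, rfl⟩ := (h.mem_ker_iff c Y).1 hY
    exact hJ.nondegenerate _ _ (mfderiv_incl_eq_zero hJs hj c w) hmem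
  -- the isotropy Lie algebra in the chart
  let P : M → (EM →L[ℝ] ℝ) → Prop := fun z ξ =>
    ((0 : TangentSpace 𝓘(ℝ, EM) z), (ξ.comp (mvfderiv 𝓘(ℝ, EM) χ z) : Cotangent EM z)) ∈ LM z
  have hP : ∀ ξ, ξ ∈ conormal LM χ x ↔ P x ξ := fun ξ => Iff.rfl
  have hPc : ∀ (c : J ⁻¹' {x}) ξ, P (J (incl J x c)) ξ ↔ P x ξ := by
    intro c ξ
    have hc : J (incl J x c) = x := c.2
    rw [hc]
  -- The forward Dirac condition for the vector 0: the `Y` it provides lies in `ker dJ`, hence is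
  -- tangent to the fibre.
  have hgen : ∀ (c : J ⁻¹' {x}) ξ, P x ξ ↔ ∃ w : TangentSpace 𝓘(ℝ, EC) c,
      IsGenAt LN (incl J x) G c ξ w := by
    intro c ξ
    rw [← hPc c]
    refine (hJ.forward.2 (incl J x c) _ _).trans ?_
    constructor
    · rintro ⟨Y, hY, hmem⟩
      obtain ⟨w, rfl⟩ := exists_mfderiv_eq_of_ker hJs (hC.isImmersion.isImmersionAt c)
        hC.isEmbedding.isInducing (fun y hy => ⟨⟨y, hy.trans c.2⟩, rfl⟩) (hx _ c.2) hY
      refine ⟨w, ?_⟩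
      unfold IsGenAt
      rw [hGd]
      exact hmem
    · rintro ⟨w, hw⟩
      refine ⟨_, mfderiv_incl_eq_zero hJs hj c w, ?_⟩
      unfold IsGenAt at hw
      rw [hGd] at hw
      exact hw
  have h𝔩 : ∀ (c : J ⁻¹' {x}) ξ (w : TangentSpace 𝓘(ℝ, EC) c),
      IsGenAt LN (incl J x) G c ξ w → ξ ∈ conormal LM χ x := fun c ξ w hw =>
    (hP ξ).2 ((hgen c ξ).2 ⟨w, hw⟩)
  obtain ⟨n, ⟨b⟩⟩ := exists_basis_fin (conormal LM χ x)
  choose V hV using fun i (c : J ⁻¹' {x}) => (hgen c (b i)).1 ((hP _).1 (b i).2)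
  have hiso : ∀ ξ : EM →L[ℝ] ℝ, (ξ.comp (mvfderiv 𝓘(ℝ, EM) χ x) : Cotangent EM x)
      ∈ isotropy LM x ↔ ξ ∈ conormal LM χ x := fun ξ => Iff.rfl
  have hgenV : ∀ (ξ : EM →L[ℝ] ℝ) (V' : VField EC (J ⁻¹' {x})),
      IsGenerator EC J LN (ξ.comp (mvfderiv 𝓘(ℝ, EM) χ x) : Cotangent EM x) V' ↔
        ∀ c, IsGenAt LN (incl J x) G c ξ (V' c) := by
    intro ξ V'
    refine forall_congr' fun c => ?_
    rw [covectorAt_eq (fun z => (ξ.comp (mvfderiv 𝓘(ℝ, EM) χ z) : Cotangent EM z)) c]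
    unfold IsGenAt
    rw [hGd]
    exact and_iff_right (mfderiv_incl_eq_zero hJs hj c (V' c))
  -- By uniqueness of generators, the generator of an element of `𝔩_x` is the combination of the `V
  -- i` with its coordinates as constant coefficients, so both kinds of step use the same curves.
  have hstep : OrbitStep EC J LN LM x = CurveStep V := by
    funext c c'
    refine propext ⟨?_, ?_⟩
    · rintro ⟨α, hα, V', hV', γ, hγ, h0, h1⟩
      obtain ⟨ξ, rfl⟩ := exists_factor_of_surjective hbij.2 (β := α) fun v hv => by
        rw [hinj (hv.trans (map_zero _).symm), map_zero]
      have hξ := (hiso ξ).1 hα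
      have hV'' := (hgenV ξ V').1 hV'
      refine ⟨b.repr ⟨ξ, hξ⟩, γ, ?_, h0, h1⟩
      have h2 : V' = fun c => ∑ i, b.repr ⟨ξ, hξ⟩ i • V i c := funext fun c =>
        IsGenAt.eq_sum h hnd (fun i => hV i c) hξ (hV'' c)
      rw [← h2]
      exact hγ
    · rintro ⟨a, γ, hγ, h0, h1⟩
      have hξ : ∑ i, a i • (b i : EM →L[ℝ] ℝ) ∈ conormal LM χ x :=
        Submodule.sum_mem _ fun i _ => Submodule.smul_mem _ _ (b i).2
      exact ⟨_, (hiso _).2 hξ, _, (hgenV _ _).2 fun c => IsGenAt.sum_smul (fun i => hV i c) a,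
        γ, hγ, h0, h1⟩
  have horb : ∀ c c', orbitProj EC J LN LM x c = orbitProj EC J LN LM x c' ↔
      Relation.EqvGen (CurveStep V) c c' := by
    intro c c'
    rw [← hstep]
    exact Quotient.eq (r := orbitSetoid EC J LN LM x)
  obtain ⟨hD, hker⟩ := isDirac_pullDirac_of_orbits h hJ.source hφ hnd h𝔩 hV hQ horb
  refine ⟨hD, hQ, Quotient.mk_surjective, hker, fun k hk hkker c c' hcc' => ?_⟩
  -- The generators lie in `ker dp`, so `k` has zero derivative along each step; induction over
  -- chains of steps makes it constant on orbits.
  have htan := mfderiv_eq_zero_of_curveStep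
    (fun i => smoothVF_of_isGenAt h hJ.source hnd (hV i)) (hQ.contMDiff.mdifferentiable (by simp))
    fun c c' hs => (horb c c').2 (Relation.EqvGen.rel _ _ hs)
  have hcc := (horb c c').1 hcc'
  induction hcc with
  | rel c c' hs =>
    obtain ⟨a, γ, hγ, rfl, rfl⟩ := hs
    refine (eq_of_hasDerivWithinAt_zero (f := k ∘ γ) (convex_Icc (0 : ℝ) 1) (fun t ht => ?_)
      (left_mem_Icc.2 zero_le_one) (right_mem_Icc.2 zero_le_one)).symm
    refine (hasDerivWithinAt_comp_curve ((hk _).mdifferentiableAt (by simp)) (hγ t ht)).congr_deriv ?_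
    refine hkker _ _ ?_
    rw [map_sum]
    refine Finset.sum_eq_zero fun i _ => ?_
    rw [map_smul, htan, smul_zero]
  | refl => rfl
  | symm c c' hs ih => exact (ih ((horb _ _).2 hs)).symm
  | trans c c' c'' hs hs' ih ih' =>
    exact (ih ((horb _ _).2 hs)).trans (ih' ((horb _ _).2 hs'))

end Realization

end DiracReduction

theorem mainTheorem4
    {EM : Type*} [NormedAddCommGroup EM] [NormedSpace ℝ EM] [FiniteDimensional ℝ EM]
    {EN : Type*} [NormedAddCommGroup EN] [NormedSpace ℝ EN] [FiniteDimensional ℝ EN]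
    {EC : Type*} [NormedAddCommGroup EC] [NormedSpace ℝ EC] [FiniteDimensional ℝ EC]
    {EQ : Type*} [NormedAddCommGroup EQ] [NormedSpace ℝ EQ] [FiniteDimensional ℝ EQ]
    {M : Type*} [TopologicalSpace M] [T2Space M] [SecondCountableTopology M]
    [ChartedSpace EM M] [IsManifold 𝓘(ℝ, EM) ∞ M]
    {N : Type*} [TopologicalSpace N] [T2Space N] [SecondCountableTopology N]
    [ChartedSpace EN N] [IsManifold 𝓘(ℝ, EN) ∞ N]
    -- a Dirac realization `J : (N, L_N) → (M, L_M)` of a `φ`-twisted Dirac manifold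
    (φ : DiracReduction.ThreeForm EM M)
    (LM : DiracReduction.GenSubspace EM M) (LN : DiracReduction.GenSubspace EN N)
    (J : N → M) (hJ : DiracReduction.IsDiracRealization φ J LN LM)
    -- a regular value `x`, and the embedded submanifold `C = J⁻¹(x)` of `N`
    (x : M) (hx : DiracReduction.IsRegularValue EN EM J x)
    [ChartedSpace EC (J ⁻¹' {x})] [IsManifold 𝓘(ℝ, EC) ∞ (J ⁻¹' {x})]
    (hC : Manifold.IsSmoothEmbedding 𝓘(ℝ, EC) 𝓘(ℝ, EN) ∞ (DiracReduction.incl J x))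
    -- the orbit space is a smooth manifold and the projection is a submersion
    [T2Space (DiracReduction.OrbitSpace EC J LN LM x)]
    [ChartedSpace EQ (DiracReduction.OrbitSpace EC J LN LM x)]
    [IsManifold 𝓘(ℝ, EQ) ∞ (DiracReduction.OrbitSpace EC J LN LM x)]
    (hQ : Manifold.IsSubmersion 𝓘(ℝ, EC) 𝓘(ℝ, EQ) ∞
      (DiracReduction.orbitProj EC J LN LM x)) :
    -- `ι^* L_N` is an (untwisted) Dirac structure on `C`
    DiracReduction.IsDirac EC (fun _ => 0)
        (DiracReduction.pullDirac (DiracReduction.incl J x) LN :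
          DiracReduction.GenSubspace EC (J ⁻¹' {x})) ∧
      ∃ π : DiracReduction.BiTensor EQ (DiracReduction.OrbitSpace EC J LN LM x),
        DiracReduction.IsPoisson EQ π ∧
        -- the projection is forward Dirac, and `π` is the only Poisson structure with this property
        DiracReduction.IsForwardDirac (DiracReduction.orbitProj EC J LN LM x)
          (DiracReduction.pullDirac (DiracReduction.incl J x) LN :
            DiracReduction.GenSubspace EC (J ⁻¹' {x}))
          (DiracReduction.graphOf EQ π) ∧
        (∀ π' : DiracReduction.BiTensor EQ (DiracReduction.OrbitSpace EC J LN LM x),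
          DiracReduction.IsPoisson EQ π' →
          DiracReduction.IsForwardDirac (DiracReduction.orbitProj EC J LN LM x)
            (DiracReduction.pullDirac (DiracReduction.incl J x) LN :
              DiracReduction.GenSubspace EC (J ⁻¹' {x}))
            (DiracReduction.graphOf EQ π') → π' = π) ∧
        -- the projection is also backward Dirac, and this property characterizes `π` as well
        DiracReduction.IsBackwardDirac (DiracReduction.orbitProj EC J LN LM x)
          (DiracReduction.pullDirac (DiracReduction.incl J x) LN :
            DiracReduction.GenSubspace EC (J ⁻¹' {x}))
          (DiracReduction.graphOf EQ π) ∧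
        (∀ π' : DiracReduction.BiTensor EQ (DiracReduction.OrbitSpace EC J LN LM x),
          DiracReduction.IsPoisson EQ π' →
          DiracReduction.IsBackwardDirac (DiracReduction.orbitProj EC J LN LM x)
            (DiracReduction.pullDirac (DiracReduction.incl J x) LN :
              DiracReduction.GenSubspace EC (J ⁻¹' {x}))
            (DiracReduction.graphOf EQ π') → π' = π) := by
  have h := DiracReduction.isReducible_pullDirac_incl hJ hx hC hQ
  obtain ⟨π, hπ, hf, hfu, hb, hbu⟩ := h.exists_poisson
  exact ⟨h.isDirac, π, hπ, hf, fun π' _ => hfu π', hb, fun π' _ => hbu π'⟩
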